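/- Let $\mathbb F$ be an algebraically closed field (of any characteristic $p\ge 0$) and $G$ a finite group. **Algebras.** For $n\ge 0$ let $\mathcal H_n(G)$ be the wreath Hecke algebra: the associative $\mathbb F$-algebra generated by the group $G^n$ and elements $x_1,\dots,x_n$, $s_1,\dots,s_{n-1}$ subject to (besides the multiplication rules of $G^n$) $$x_ix_j=x_jx_i,\quad x_ig=gx_i,\quad s_i^2=1,\quad s_is_j=s_js_i\ (|i-j|>1),\quad s_is_{i+1}s_i=s_{i+1}s_is_{i+1},$$ $$s_ix_i=x_{i+1}s_i-\sum_{h\in G}h^{(i)}(h^{-1})^{(i+1)},\quad s_ix_j=x_js_i\ (j\ne i,i+1),\quad s_ig={}^{s_i}g\,s_i ,$$ where $g\in G^n$, $h^{(i)}$ is $h$ placed in the $i$-th factor of $G^n$, and ${}^{s_i}g$ is $g$ with the entries $i$ and $i+1$ exchanged. For $n\geq 1$ let $\mathcal H_{n-1,1}(G)\cong\mathcal H_{n-1}(G)\otimes\mathcal H_1(G)$ be the subalgebra of $\mathcal H_n(G)$ generated by $G^n,x_1,\dots,x_n,s_1,\dots,s_{n-2}$. For $\widehat n=(n_1,\dots,n_r)$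 with $n_k\ge0$, $\sum_k n_k=n$, let $\mathcal H_{\widehat n}(G)\cong\mathcal H_{n_1}(G)\otimes\cdots\otimes\mathcal H_{n_r}(G)$ be the subalgebra generated by $G^n,x_1,\dots,x_n$ and the Young subgroup $S_{n_1}\times\cdots\times S_{n_r}$. For $u\in\{0,1\}$ let ${}^u\mathcal H_n$ be the algebra generated by $y_1,\dots,y_n,s_1,\dots,s_{n-1}$, where the $y_i$ commute, the $s_i$ satisfy the Coxeter relations of $S_n$ as above, $s_iy_i=y_{i+1}s_i-u$, and $s_iy_j=y_js_i$ for $j\neq i,i+1$ (the degenerate affine Hecke algebra if $u=1$, and $\mathbb F[y_1,\dots,y_n]\rtimes S_n$ if $u=0$). **Modules.** Let $V_1,\dots,V_r$ be pairwise non-isomorphic finite-dimensional simple $\mathbb FG$-modules (for instance, a complete set of representatives). For each $k$ let $c_k\in\mathbb F$ be the scalar such that $\sum_{h\in G}h\otimes h^{-1}$ acts on $V_k\otimes V_k$ as $c_k$ times the flip $v\otimes w\mapsto w\otimes v$. Put $u_k=1,\ \gamma_k=c_k$ if $c_k\ne0$ and $u_k=0,\ \gamma_k=1$ if $c_k=0$.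 If $L$ is a module over ${}^{u_k}\mathcal H_m$, then $V_k^{\otimes m}\otimes L$ is an $\mathcal H_m(G)$-module in which $G^m$ acts on $V_k^{\otimes m}$, $s_i$ acts by $s_i(v\otimes z)=s_iv\otimes s_iz$ (with $s_i$ permuting tensor factors of $V_k^{\otimes m}$), and $x_i(v\otimes z)=\gamma_k\,v\otimes y_iz$. For a composition $\widehat n$ of $n$ and modules $L_k$ over ${}^{u_k}\mathcal H_{n_k}$ put $$D_{\widehat n}(L_\centerdot)=\operatorname{ind}_{\mathcal H_{\widehat n}(G)}^{\mathcal H_n(G)}\bigl((V_1^{\otimes n_1}\otimes L_1)\otimes\cdots\otimes(V_r^{\otimes n_r}\otimes L_r)\bigr).$$ For a ${}^{u}\mathcal H_m$-module $N$, $m\ge1$, and $a\in\mathbb F$, let $e_aN$ be the generalized $a$-eigenspace of $y_m$ on $N$, regarded as a ${}^{u}\mathcal H_{m-1}$-module, and let $\tilde e_aN=\operatorname{soc}(e_aN)$ be its socle. Let $L(a)$ be the one-dimensional ${}^{u_k}\mathcal H_1$-module on which $y_1$ acts as $a$. If $n_k\ge1$, write $\widehat n_k^-$ for $\widehat n$ with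 $n_k$ replaced by $n_k-1$, and $D_{\widehat n_k^-}(\tilde e_aL_\centerdot)$ for the $\mathcal H_{n-1}(G)$-module $D$ attached to $\widehat n_k^-$ and to the family $L_\centerdot$ with $L_k$ replaced by $\tilde e_aL_k$. **Theorem (modular branching rule).** Let $n\ge1$, let $\widehat n=(n_1,\dots,n_r)$ be a composition of $n$ into $r$ parts $n_k\ge0$, and let $L_k$ be a simple ${}^{u_k}\mathcal H_{n_k}$-module for $1\le k\le r$. Then for all $a\in\mathbb F$ and all $k$ with $n_k\ge1$ the $\mathcal H_{n-1}(G)$-module $D_{\widehat n_k^-}(\tilde e_aL_\centerdot)$ is semisimple, and there is an isomorphism of $\mathcal H_{n-1,1}(G)$-modules $$\operatorname{soc}\Bigl(\operatorname{res}_{\mathcal H_{n-1,1}(G)}D_{\widehat n}(L_\centerdot)\Bigr)\;\cong\;\bigoplus_{a\in\mathbb F,\ 1\le k\le r,\ n_k\geq 1}D_{\widehat n_k^-}(\tilde e_aL_\centerdot)\otimes\bigl(V_k\otimes L(a)\bigr).$$ -/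

import Mathlib

open scoped TensorProduct DirectSum

namespace WreathHecke

noncomputable section

/-! ### Modules over algebras: restriction, induction, outer tensor products, socles -/

section Generalities

variable (F : Type*) [Field F]

/-- The module structure given by a representation `A → End(M)` of an algebra. -/
abbrev moduleOfHom {F A M : Type*} [Field F] [Ring A] [Algebra F A] [AddCommGroup M] [Module F M]
    (f : A →ₐ[F] Module.End F M) : Module A M :=
  Module.compHom M f.toRingHom

theorem moduleOfHom_tower {F A M : Type*} [Field F] [Ring A] [Algebra F A] [AddCommGroup M]
    [Module F M] (f : A →ₐ[F] Module.End F M) :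
    letI := moduleOfHom f
    IsScalarTower F A M := by
  let _ := moduleOfHom f
  refine ⟨fun c a m => ?_⟩
  change f (c • a) m = c • f a m
  rw [map_smul]; rfl

/-- The restriction of an `A`-module `M` along a homomorphism of algebras `φ : B → A`. -/
def Res {F A B : Type*} [Field F] [Ring A] [Algebra F A] [Ring B] [Algebra F B]
    (_φ : B →ₐ[F] A) (M : Type*) : Type _ := M

section Res

variable {F A B M : Type*} [Field F] [Ring A] [Algebra F A] [Ring B] [Algebra F B]
  (φ : B →ₐ[F] A) [AddCommGroup M] [Module F M] [Module A M] [IsScalarTower F A M]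

instance : AddCommGroup (Res φ M) := inferInstanceAs (AddCommGroup M)
instance : Module F (Res φ M) := inferInstanceAs (Module F M)
instance : Module B (Res φ M) := Module.compHom M φ.toRingHom
instance : IsScalarTower F B (Res φ M) := ⟨fun c b m => by
  change φ (c • b) • (show M from m) = c • (φ b • (show M from m))
  rw [map_smul, smul_assoc]⟩

end Res

section Ind

variable {F A B : Type*} [Field F] [Ring A] [Algebra F A] [Ring B] [Algebra F B]
  (φ : B →ₐ[F] A) (E : Type*) [AddCommGroup E] [Module F E] [Module B E] [IsScalarTower F B E]

/-- The `A`-submodule of `A ⊗_F E` by which one divides to obtain `A ⊗_B E`. -/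
def balancing : Submodule A (A ⊗[F] E) :=
  Submodule.span A
    {z | ∃ (a : A) (b : B) (e : E), z = (a * φ b) ⊗ₜ[F] e - a ⊗ₜ[F] (b • e)}

/-- The induced module `ind_B^A E = A ⊗_B E`, where `A` is a right `B`-module through `φ`. -/
def Ind : Type _ := (A ⊗[F] E) ⧸ balancing φ E

instance : AddCommGroup (Ind φ E) := inferInstanceAs (AddCommGroup (_ ⧸ balancing φ E))
instance : Module A (Ind φ E) := inferInstanceAs (Module A (_ ⧸ balancing φ E))
instance : Module F (Ind φ E) := inferInstanceAs (Module F (_ ⧸ balancing φ E))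
instance : IsScalarTower F A (Ind φ E) := inferInstanceAs (IsScalarTower F A (_ ⧸ balancing φ E))

end Ind

/-- The outer tensor product of an `A`-module and a `B`-module, a module over `A ⊗ B`. -/
def Outer (M N : Type*) [AddCommGroup M] [Module F M] [AddCommGroup N] [Module F N] : Type _ :=
  M ⊗[F] N

section Outer

variable (A B M N : Type*) [Ring A] [Algebra F A] [Ring B] [Algebra F B]
  [AddCommGroup M] [Module F M] [Module A M] [IsScalarTower F A M]
  [AddCommGroup N] [Module F N] [Module B N] [IsScalarTower F B N]

/-- `(a ⊗ b) (m ⊗ n) = a m ⊗ b n`. -/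
def outerHom : (A ⊗[F] B) →ₐ[F] Module.End F (M ⊗[F] N) :=
  (Module.endTensorEndAlgHom (R := F) (A := F)).comp
    (Algebra.TensorProduct.map (Algebra.lsmul F F M) (Algebra.lsmul F F N))

instance : AddCommGroup (Outer F M N) := inferInstanceAs (AddCommGroup (M ⊗[F] N))
instance : Module F (Outer F M N) := inferInstanceAs (Module F (M ⊗[F] N))
instance : Module (A ⊗[F] B) (Outer F M N) := moduleOfHom (outerHom F A B M N)
instance : IsScalarTower F (A ⊗[F] B) (Outer F M N) := moduleOfHom_tower (outerHom F A B M N)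

end Outer

/-- The outer tensor product `M_1 ⊗ ... ⊗ M_r` of modules `M_k` over algebras `A_k`, a module over
`A_1 ⊗ ... ⊗ A_r`. -/
def PiOuter {ι : Type*} (M : ι → Type*) [∀ k, AddCommGroup (M k)] [∀ k, Module F (M k)] : Type _ :=
  ⨂[F] k, M k

section PiOuter

variable {ι : Type*} (A : ι → Type*) [∀ k, Ring (A k)] [∀ k, Algebra F (A k)]
  (M : ι → Type*) [∀ k, AddCommGroup (M k)] [∀ k, Module F (M k)] [∀ k, Module (A k) (M k)]
  [∀ k, IsScalarTower F (A k) (M k)]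

/-- `(a_1 ⊗ ... ⊗ a_r) (m_1 ⊗ ... ⊗ m_r) = a_1 m_1 ⊗ ... ⊗ a_r m_r`. -/
def piOuterHom : (⨂[F] k, A k) →ₐ[F] Module.End F (⨂[F] k, M k) :=
  PiTensorProduct.liftAlgHom
    ((PiTensorProduct.mapMultilinear F M M).compLinearMap
      fun k => (Algebra.lsmul F F (M k) : A k →ₐ[F] Module.End F (M k)).toLinearMap)
    (by
      ext m
      simp [PiTensorProduct.mapMultilinear])
    (by
      intro a b
      ext m
      simp [PiTensorProduct.mapMultilinear])

instance : AddCommGroup (PiOuter F M) := inferInstanceAs (AddCommGroup (⨂[F] k, M k))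
instance : Module F (PiOuter F M) := inferInstanceAs (Module F (⨂[F] k, M k))
instance : Module (⨂[F] k, A k) (PiOuter F M) := moduleOfHom (piOuterHom F A M)
instance : IsScalarTower F (⨂[F] k, A k) (PiOuter F M) := moduleOfHom_tower (piOuterHom F A M)

end PiOuter

/-- The socle of a module: the sum of all its simple submodules. -/
def socle (A M : Type*) [Ring A] [AddCommGroup M] [Module A M] : Submodule A M :=
  sSup {N | IsSimpleModule A N}

end Generalities

/-! ### The wreath Hecke algebra -/

/-- The simple transposition `s_i = (i, i + 1)` (positions are counted from `0`). -/
abbrev adj {n : ℕ} (i : ℕ) (hi : i + 1 < n) : Equiv.Perm (Fin n) :=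
  Equiv.swap ⟨i, by omega⟩ ⟨i + 1, hi⟩

/-- The generators of the wreath Hecke algebra: the elements of `G^n`, the polynomial generators
`x_i`, and the simple reflections `s_i`. -/
inductive Gen (G : Type*) (n : ℕ)
  | g (a : Fin n → G)
  | x (i : Fin n)
  | s (i : ℕ) (hi : i + 1 < n)

/-- Put `a ∈ G^m` on the positions `d, ..., d + m - 1` of an element of `G^n`, with `1`
elsewhere. -/
def extG {G : Type*} [Group G] (d m n : ℕ) (a : Fin m → G) : Fin n → G := fun j =>
  if h : d ≤ (j : ℕ) ∧ (j : ℕ) < d + m then a ⟨j - d, by omega⟩ else 1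

section extG

variable {G : Type*} [Group G] {d m n : ℕ}

theorem extG_one : extG d m n (1 : Fin m → G) = 1 := by
  ext j; simp [extG]

theorem extG_mul (a b : Fin m → G) : extG d m n (a * b) = extG d m n a * extG d m n b := by
  ext j
  simp only [extG, Pi.mul_apply]
  split_ifs <;> simp

theorem extG_mulSingle (hd : d + m ≤ n) (i : Fin m) (h : G) :
    extG d m n (Pi.mulSingle i h) = Pi.mulSingle ⟨d + i, by omega⟩ h := by
  ext j
  simp only [extG, Pi.mulSingle_apply, Fin.ext_iff]
  grind

theorem extG_adj (hd : d + m ≤ n) (i : ℕ) (hi : i + 1 < m) (a : Fin m → G) :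
    extG d m n (fun j => a ((adj i hi)⁻¹ j))
      = fun j => extG d m n a ((adj (d + i) (by omega))⁻¹ j) := by
  ext j
  obtain ⟨j, hj⟩ := j
  simp only [extG, Equiv.swap_inv, Equiv.swap_apply_def, Fin.ext_iff]
  split_ifs <;> first | rfl | (exfalso; grind) | (congr 1; ext; grind)

theorem extG_adj_of_disjoint (i : ℕ) (hi : i + 1 < n) (h : i + 1 < d ∨ d + m ≤ i)
    (a : Fin m → G) :
    (fun j => extG d m n a ((adj i hi)⁻¹ j)) = extG d m n a := by
  ext j
  obtain ⟨j, hj⟩ := j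
  simp only [extG, Equiv.swap_inv, Equiv.swap_apply_def, Fin.ext_iff]
  split_ifs <;> first | rfl | (exfalso; grind)

theorem extG_commute {d' m' : ℕ} (h : d + m ≤ d') (a : Fin m → G) (b : Fin m' → G) :
    extG d m n a * extG d' m' n b = extG d' m' n b * extG d m n a := by
  ext j
  simp only [extG, Pi.mul_apply]
  split_ifs <;> first | simp | (exfalso; omega)

end extG

section Wreath

variable (F : Type*) [Field F] (G : Type*) [Group G] [Fintype G]

/-- A generator, as an element of the free algebra. -/
abbrev free {G : Type*} {n : ℕ} (a : Gen G n) : FreeAlgebra F (Gen G n) := FreeAlgebra.ι F a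

/-- The defining relations of the wreath Hecke algebra. -/
inductive Rel (n : ℕ) : FreeAlgebra F (Gen G n) → FreeAlgebra F (Gen G n) → Prop
  | g_one : Rel n (free F (.g 1)) 1
  | g_mul (a b : Fin n → G) : Rel n (free F (.g (a * b))) (free F (.g a) * free F (.g b))
  | x_x (i j : Fin n) : Rel n (free F (.x i) * free F (.x j)) (free F (.x j) * free F (.x i))
  | x_g (i : Fin n) (a : Fin n → G) :
      Rel n (free F (.x i) * free F (.g a)) (free F (.g a) * free F (.x i))
  | s_sq (i : ℕ) (hi : i + 1 < n) : Rel n (free F (.s i hi) * free F (.s i hi)) 1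
  | s_s (i j : ℕ) (hi : i + 1 < n) (hj : j + 1 < n) (hij : i + 1 < j) :
      Rel n (free F (.s i hi) * free F (.s j hj)) (free F (.s j hj) * free F (.s i hi))
  | braid (i : ℕ) (hi : i + 1 < n) (hj : i + 1 + 1 < n) :
      Rel n (free F (.s i hi) * free F (.s (i + 1) hj) * free F (.s i hi))
        (free F (.s (i + 1) hj) * free F (.s i hi) * free F (.s (i + 1) hj))
  | s_x (i : ℕ) (hi : i + 1 < n) :
      Rel n (free F (.s i hi) * free F (.x ⟨i, by omega⟩))
        (free F (.x ⟨i + 1, hi⟩) * free F (.s i hi)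
          - ∑ h : G, free F (.g (Pi.mulSingle ⟨i, by omega⟩ h * Pi.mulSingle ⟨i + 1, hi⟩ h⁻¹)))
  | s_x_of_ne (i : ℕ) (hi : i + 1 < n) (j : Fin n) (h₀ : (j : ℕ) ≠ i) (h₁ : (j : ℕ) ≠ i + 1) :
      Rel n (free F (.s i hi) * free F (.x j)) (free F (.x j) * free F (.s i hi))
  | s_g (i : ℕ) (hi : i + 1 < n) (a : Fin n → G) :
      Rel n (free F (.s i hi) * free F (.g a))
        (free F (.g fun j => a ((adj i hi)⁻¹ j)) * free F (.s i hi))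

/-- The wreath Hecke algebra `H_n(G)` over `F`. -/
def WHecke (n : ℕ) : Type _ := RingQuot (Rel F G n)

instance (n : ℕ) : Ring (WHecke F G n) := inferInstanceAs (Ring (RingQuot (Rel F G n)))
instance (n : ℕ) : Algebra F (WHecke F G n) :=
  inferInstanceAs (Algebra F (RingQuot (Rel F G n)))

namespace WHecke

variable {G} {n : ℕ}

/-- The quotient map from the free algebra. -/
def mk : FreeAlgebra F (Gen G n) →ₐ[F] WHecke F G n := RingQuot.mkAlgHom F (Rel F G n)

theorem mk_surjective : Function.Surjective (mk F (G := G) (n := n)) :=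
  RingQuot.mkAlgHom_surjective F _

/-- The image of a generator in `H_n(G)`. -/
def gen (a : Gen G n) : WHecke F G n := mk F (free F a)

variable {F} {A : Type*} [Ring A] [Algebra F A]

/-- A map on generators that respects the relations extends to `H_n(G)`. -/
def lift (f : Gen G n → A)
    (hf : ∀ ⦃p q⦄, Rel F G n p q → FreeAlgebra.lift F f p = FreeAlgebra.lift F f q) :
    WHecke F G n →ₐ[F] A :=
  RingQuot.liftAlgHom F ⟨FreeAlgebra.lift F f, hf⟩

@[simp] theorem lift_gen (f : Gen G n → A)
    (hf : ∀ ⦃p q⦄, Rel F G n p q → FreeAlgebra.lift F f p = FreeAlgebra.lift F f q)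
    (a : Gen G n) : lift f hf (gen F a) = f a :=
  (RingQuot.liftAlgHom_mkAlgHom_apply F (FreeAlgebra.lift F f) hf _).trans (by simp)

theorem rel {p q : FreeAlgebra F (Gen G n)} (h : Rel F G n p q) :
    FreeAlgebra.lift F (gen F) p = FreeAlgebra.lift F (gen F) q := by
  have key : FreeAlgebra.lift F (gen F (G := G) (n := n)) = mk F := by
    ext a
    simp only [Function.comp_apply, FreeAlgebra.lift_ι_apply, gen]
  rw [key]
  exact RingQuot.mkAlgHom_rel F h

theorem adjoin_gen : Algebra.adjoin F (Set.range (gen F (G := G) (n := n))) = ⊤ := by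
  have key : Set.range (gen F (G := G) (n := n)) = mk F '' Set.range (FreeAlgebra.ι F) := by
    rw [← Set.range_comp]; rfl
  rw [key, ← AlgHom.map_adjoin, FreeAlgebra.adjoin_range_ι, Algebra.map_top,
    AlgHom.range_eq_top]
  exact mk_surjective F

/-- Two homomorphisms commute elementwise once they do so on generators. -/
theorem commute_of_gen {m₁ m₂ : ℕ} (f₁ : WHecke F G m₁ →ₐ[F] A) (f₂ : WHecke F G m₂ →ₐ[F] A)
    (h : ∀ a b, Commute (f₁ (gen F a)) (f₂ (gen F b))) (u : WHecke F G m₁) (v : WHecke F G m₂) :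
    Commute (f₁ u) (f₂ v) := by
  have hu : u ∈ Algebra.adjoin F (Set.range (gen F (G := G) (n := m₁))) := by
    rw [adjoin_gen]; trivial
  have hv : v ∈ Algebra.adjoin F (Set.range (gen F (G := G) (n := m₂))) := by
    rw [adjoin_gen]; trivial
  induction hu using Algebra.adjoin_induction with
  | mem u hu =>
    obtain ⟨a, rfl⟩ := hu
    induction hv using Algebra.adjoin_induction with
    | mem v hv => obtain ⟨b, rfl⟩ := hv; exact h a b
    | algebraMap c => rw [AlgHom.commutes]; exact (Algebra.commutes c _).symm
    | add v w _ _ hv hw => rw [map_add]; exact hv.add_right hw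
    | mul v w _ _ hv hw => rw [map_mul]; exact hv.mul_right hw
  | algebraMap c => rw [AlgHom.commutes]; exact Algebra.commutes c _
  | add v w _ _ hv hw => rw [map_add]; exact hv.add_left hw
  | mul v w _ _ hv hw => rw [map_mul]; exact hv.mul_left hw

section relations

theorem gen_g_one : gen F (.g (1 : Fin n → G)) = 1 := by simpa using rel (F := F) (G := G) (n := n) .g_one
theorem gen_g_mul (a b : Fin n → G) :
    gen F (.g (a * b)) = gen F (.g a) * gen F (.g b) := by simpa using rel (F := F) (.g_mul a b)
theorem gen_x_x (i j : Fin n) :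
    gen F (.x i : Gen G n) * gen F (.x j) = gen F (.x j) * gen F (.x i) := by
  simpa using rel (F := F) (G := G) (.x_x i j)
theorem gen_x_g (i : Fin n) (a : Fin n → G) :
    gen F (.x i) * gen F (.g a) = gen F (.g a) * gen F (.x i) := by
  simpa using rel (F := F) (.x_g i a)
theorem gen_s_sq (i : ℕ) (hi : i + 1 < n) :
    gen F (.s i hi : Gen G n) * gen F (.s i hi) = 1 := by
  simpa using rel (F := F) (G := G) (.s_sq i hi)
theorem gen_s_s (i j : ℕ) (hi : i + 1 < n) (hj : j + 1 < n) (hij : i + 1 < j) :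
    gen F (.s i hi : Gen G n) * gen F (.s j hj) = gen F (.s j hj) * gen F (.s i hi) := by
  simpa using rel (F := F) (G := G) (.s_s i j hi hj hij)
theorem gen_braid (i : ℕ) (hi : i + 1 < n) (hj : i + 1 + 1 < n) :
    gen F (.s i hi : Gen G n) * gen F (.s (i + 1) hj) * gen F (.s i hi)
      = gen F (.s (i + 1) hj) * gen F (.s i hi) * gen F (.s (i + 1) hj) := by
  simpa using rel (F := F) (G := G) (.braid i hi hj)
theorem gen_s_x (i : ℕ) (hi : i + 1 < n) :
    gen F (.s i hi : Gen G n) * gen F (.x ⟨i, by omega⟩)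
      = gen F (.x ⟨i + 1, hi⟩) * gen F (.s i hi)
        - ∑ h : G, gen F (.g (Pi.mulSingle ⟨i, by omega⟩ h * Pi.mulSingle ⟨i + 1, hi⟩ h⁻¹)) := by
  simpa using rel (F := F) (G := G) (.s_x i hi)
theorem gen_s_x_of_ne (i : ℕ) (hi : i + 1 < n) (j : Fin n) (h₀ : (j : ℕ) ≠ i)
    (h₁ : (j : ℕ) ≠ i + 1) :
    gen F (.s i hi : Gen G n) * gen F (.x j) = gen F (.x j) * gen F (.s i hi) := by
  simpa using rel (F := F) (G := G) (.s_x_of_ne i hi j h₀ h₁)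
theorem gen_s_g (i : ℕ) (hi : i + 1 < n) (a : Fin n → G) :
    gen F (.s i hi) * gen F (.g a)
      = gen F (.g fun j => a ((adj i hi)⁻¹ j)) * gen F (.s i hi) := by
  simpa using rel (F := F) (.s_g i hi a)

end relations

end WHecke

/-! ### Parabolic subalgebras -/

section block

variable {G} {d m n : ℕ}

/-- The generator of `H_n(G)` obtained from a generator of `H_m(G)` by shifting positions by `d`. -/
def shiftGen (hd : d + m ≤ n) : Gen G m → Gen G n
  | .g a => .g (extG d m n a)
  | .x i => .x ⟨d + i, by omega⟩
  | .s i hi => .s (d + i) (by omega)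

/-- The embedding `H_m(G) → H_n(G)` onto the positions `d, ..., d + m - 1`:
`x_i ↦ x_{d + i}`, `s_i ↦ s_{d + i}`, and `G^m → G^n` is the embedding into these factors. -/
def block (hd : d + m ≤ n) : WHecke F G m →ₐ[F] WHecke F G n :=
  WHecke.lift (fun a => WHecke.gen F (shiftGen hd a)) (by
    intro p q h
    cases h with
    | g_one => simpa [shiftGen, extG_one] using WHecke.gen_g_one
    | g_mul a b => simpa [shiftGen, extG_mul] using WHecke.gen_g_mul _ _
    | x_x i j => simpa [shiftGen] using WHecke.gen_x_x _ _
    | x_g i a => simpa [shiftGen] using WHecke.gen_x_g _ _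
    | s_sq i hi => simpa [shiftGen] using WHecke.gen_s_sq _ _
    | s_s i j hi hj hij => simpa [shiftGen] using WHecke.gen_s_s _ _ _ _ (by omega)
    | braid i hi hj => simpa [shiftGen, ← Nat.add_assoc] using WHecke.gen_braid (F := F) (G := G) (n := n) (d + i) (by omega) (by omega)
    | s_x i hi =>
      simpa [shiftGen, extG_mul, extG_mulSingle hd, ← Nat.add_assoc] using
        WHecke.gen_s_x (F := F) (G := G) (n := n) (d + i) (by omega)
    | s_x_of_ne i hi j h₀ h₁ =>
      simpa [shiftGen] using
        WHecke.gen_s_x_of_ne (F := F) (G := G) (n := n) (d + i) (by omega) ⟨d + j, by omega⟩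
          (by simpa using h₀) (by simp; omega)
    | s_g i hi a =>
      have := WHecke.gen_s_g (F := F) (d + i) (by omega) (extG d m n a)
      rw [← extG_adj hd i hi] at this
      simpa [shiftGen] using this)

theorem block_gen (hd : d + m ≤ n) (a : Gen G m) :
    block F hd (WHecke.gen F a) = WHecke.gen F (shiftGen hd a) := by
  simp [block]

/-- Blocks at disjoint positions commute with each other. -/
theorem block_commute {d' m' : ℕ} (hd : d + m ≤ n) (hd' : d' + m' ≤ n) (h : d + m ≤ d')
    (u : WHecke F G m) (v : WHecke F G m') : Commute (block F hd u) (block F hd' v) := by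
  refine WHecke.commute_of_gen _ _ (fun a b => ?_) u v
  rw [block_gen, block_gen]
  cases a with
  | g a =>
    cases b with
    | g b =>
      simp only [shiftGen, Commute, SemiconjBy, ← WHecke.gen_g_mul]
      rw [extG_commute h]
    | x j => exact (WHecke.gen_x_g _ _).symm
    | s j hj =>
      have := WHecke.gen_s_g (F := F) (d' + j) (by omega) (extG d m n a)
      rw [extG_adj_of_disjoint _ _ (by omega)] at this
      exact this.symm
  | x i =>
    cases b with
    | g b => exact WHecke.gen_x_g _ _
    | x j => exact WHecke.gen_x_x _ _
    | s j hj => exact (WHecke.gen_s_x_of_ne _ _ _ (by simp; omega) (by simp; omega)).symm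
  | s i hi =>
    cases b with
    | g b =>
      have := WHecke.gen_s_g (F := F) (d + i) (by omega) (extG d' m' n b)
      rw [extG_adj_of_disjoint _ _ (by omega)] at this
      exact this
    | x j => exact WHecke.gen_s_x_of_ne _ _ _ (by simp; omega) (by simp; omega)
    | s j hj => exact WHecke.gen_s_s _ _ _ _ (by omega)

variable (G) in
/-- The homomorphism `H_n(G) ⊗ H_1(G) → H_{n + 1}(G)`, with image the subalgebra `H_{n,1}(G)`
generated by `G^{n + 1}`, `x_1, ..., x_{n + 1}` and `S_n`. -/
def lastHom (n : ℕ) : (WHecke F G n ⊗[F] WHecke F G 1) →ₐ[F] WHecke F G (n + 1) :=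
  Algebra.TensorProduct.lift (block F (d := 0) (by omega)) (block F (d := n) (by omega))
    (fun u v => block_commute F _ _ (by omega) u v)

/-- The first position of the `k`-th block of a composition. -/
def offset {r : ℕ} (c : Fin r → ℕ) (k : Fin r) : ℕ := ∑ j ∈ Finset.Iio k, c j

theorem offset_add {r : ℕ} (c : Fin r → ℕ) (k : Fin r) :
    offset c k + c k = ∑ j ∈ Finset.Iic k, c j := by
  rw [offset, ← Finset.Iio_insert, Finset.sum_insert (by simp), add_comm]

theorem offset_add_le {r : ℕ} (c : Fin r → ℕ) {n : ℕ} (hc : ∑ k, c k = n) (k : Fin r) :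
    offset c k + c k ≤ n := by
  rw [offset_add, ← hc]
  exact Finset.sum_le_sum_of_subset (Finset.subset_univ _)

theorem offset_add_le_offset {r : ℕ} (c : Fin r → ℕ) {j k : Fin r} (h : j < k) :
    offset c j + c j ≤ offset c k := by
  rw [offset_add]
  refine Finset.sum_le_sum_of_subset fun i hi => ?_
  simp only [Finset.mem_Iic, Finset.mem_Iio] at hi ⊢
  exact lt_of_le_of_lt hi h

theorem prod_ofFn_mul {M : Type*} [Monoid M] : ∀ {r : ℕ} (a b : Fin r → M),
    (∀ i j, i ≠ j → Commute (a i) (b j)) →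
    (List.ofFn fun i => a i * b i).prod = (List.ofFn a).prod * (List.ofFn b).prod
  | 0, _, _, _ => by simp
  | r + 1, a, b, h => by
    rw [List.ofFn_succ, List.ofFn_succ, List.ofFn_succ, List.prod_cons, List.prod_cons,
      List.prod_cons, prod_ofFn_mul (fun i => a i.succ) (fun i => b i.succ)
        (fun i j hij => h _ _ (by simpa using hij))]
    have hc : Commute (List.ofFn fun i : Fin r => a i.succ).prod (b 0) := by
      refine Commute.list_prod_left _ _ fun x hx => ?_
      obtain ⟨i, rfl⟩ := (List.mem_ofFn' _ _).1 hx
      exact h _ _ (Fin.succ_ne_zero i)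
    simp only [mul_assoc]
    rw [← mul_assoc (b 0), ← hc.eq, mul_assoc]

variable (G) in
/-- For a composition `c = (n_1, ..., n_r)` of `n`, the homomorphism
`H_{n_1}(G) ⊗ ... ⊗ H_{n_r}(G) → H_n(G)`, with image the subalgebra `H_c(G)` generated by `G^n`,
`x_1, ..., x_n` and the Young subgroup `S_c`. -/
def youngHom {r : ℕ} (c : Fin r → ℕ) (hc : ∑ k, c k = n) :
    (⨂[F] k, WHecke F G (c k)) →ₐ[F] WHecke F G n :=
  PiTensorProduct.liftAlgHom
    ((MultilinearMap.mkPiAlgebraFin F r (WHecke F G n)).compLinearMap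
      fun k => (block F (offset_add_le c hc k)).toLinearMap)
    (by simp [List.ofFn_const])
    (by
      intro a b
      simp only [MultilinearMap.compLinearMap_apply, MultilinearMap.mkPiAlgebraFin_apply,
        AlgHom.toLinearMap_apply, Pi.mul_apply, map_mul]
      refine prod_ofFn_mul _ _ fun i j hij => ?_
      rcases lt_or_gt_of_ne hij with h | h
      · exact block_commute F _ _ (offset_add_le_offset c h) _ _
      · exact (block_commute F _ _ (offset_add_le_offset c h) _ _).symm)

variable (G n) in
/-- The subalgebra of `H_n(G)` generated by `G^n`, `x_1, ..., x_n` and the `s_i` with `i ∈ S`. -/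
def parabolic (S : Set ℕ) : Subalgebra F (WHecke F G n) :=
  Algebra.adjoin F {z | (∃ a, z = WHecke.gen F (.g a)) ∨ (∃ i, z = WHecke.gen F (.x i)) ∨
    ∃ i hi, i ∈ S ∧ z = WHecke.gen F (.s i hi)}

theorem block_mem_parabolic (hd : d + m ≤ n) (S : Set ℕ)
    (hS : ∀ i, d ≤ i → i + 1 < d + m → i ∈ S) (u : WHecke F G m) :
    block F hd u ∈ parabolic F G n S := by
  have hu : u ∈ Algebra.adjoin F (Set.range (WHecke.gen F (G := G) (n := m))) := by
    rw [WHecke.adjoin_gen]; trivial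
  induction hu using Algebra.adjoin_induction with
  | mem u hu =>
    obtain ⟨a, rfl⟩ := hu
    rw [block_gen]
    refine Algebra.subset_adjoin ?_
    cases a with
    | g a => exact Or.inl ⟨_, rfl⟩
    | x i => exact Or.inr (Or.inl ⟨_, rfl⟩)
    | s i hi => exact Or.inr (Or.inr ⟨_, _, hS _ (by omega) (by omega), rfl⟩)
  | algebraMap c => rw [AlgHom.commutes]; exact Subalgebra.algebraMap_mem _ c
  | add v w _ _ hv hw => rw [map_add]; exact add_mem hv hw
  | mul v w _ _ hv hw => rw [map_mul]; exact mul_mem hv hw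

theorem parabolic_le (S : Set ℕ) (P : Subalgebra F (WHecke F G n))
    (h₀ : ∀ j : Fin n, ∃ (d m : ℕ) (hd : d + m ≤ n), d ≤ j ∧ (j : ℕ) < d + m ∧
      (block F (G := G) hd).range ≤ P)
    (hS : ∀ i ∈ S, i + 1 < n → ∃ (d m : ℕ) (hd : d + m ≤ n), d ≤ i ∧ i + 1 < d + m ∧
      (block F (G := G) hd).range ≤ P) :
    parabolic F G n S ≤ P := by
  refine Algebra.adjoin_le ?_
  rintro z (⟨a, rfl⟩ | ⟨j, rfl⟩ | ⟨i, hi, hiS, rfl⟩)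
  · let T : Submonoid (Fin n → G) :=
      { carrier := {a | WHecke.gen F (.g a) ∈ P}
        one_mem' := by
          change WHecke.gen F (.g 1) ∈ P
          rw [WHecke.gen_g_one]; exact one_mem P
        mul_mem' := fun {a b} ha hb => by
          change WHecke.gen F (.g (a * b)) ∈ P
          rw [WHecke.gen_g_mul]; exact mul_mem ha hb }
    have hT : a ∈ T := Submonoid.pi_mem_of_mulSingle_mem a fun j => by
      obtain ⟨d, m, hd, h₁, h₂, h₃⟩ := h₀ j
      refine h₃ ⟨WHecke.gen F (.g (Pi.mulSingle ⟨j - d, by omega⟩ (a j))), ?_⟩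
      change block F hd (WHecke.gen F _) = _
      rw [block_gen, shiftGen, extG_mulSingle hd]
      congr 3
      ext
      simp [h₁]
    exact hT
  · obtain ⟨d, m, hd, h₁, h₂, h₃⟩ := h₀ j
    refine h₃ ⟨WHecke.gen F (.x ⟨j - d, by omega⟩), ?_⟩
    change block F hd (WHecke.gen F _) = _
    rw [block_gen, shiftGen]
    congr 2
    ext
    simp [h₁]
  · obtain ⟨d, m, hd, h₁, h₂, h₃⟩ := hS i hiS hi
    refine h₃ ⟨WHecke.gen F (.s (i - d) (by omega)), ?_⟩
    change block F hd (WHecke.gen F _) = _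
    rw [block_gen, shiftGen]
    congr 2
    omega

/-- The image of `H_n(G) ⊗ H_1(G)` is the subalgebra generated by `G^{n + 1}`, all `x_i` and
`S_n`. -/
theorem range_lastHom (n : ℕ) :
    (lastHom F G n).range = parabolic F G (n + 1) {i | i + 1 < n} := by
  refine le_antisymm ?_ (parabolic_le F _ _ ?_ ?_)
  · rintro _ ⟨z, rfl⟩
    change lastHom F G n z ∈ _
    induction z using TensorProduct.induction_on with
    | zero => rw [map_zero]; exact zero_mem _
    | tmul u v =>
      rw [lastHom, Algebra.TensorProduct.lift_tmul]
      exact mul_mem (block_mem_parabolic F _ _ (by intro i; simp) u)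
        (block_mem_parabolic F _ _ (by intro i; simp; omega) v)
    | add u v hu hv => rw [map_add]; exact add_mem hu hv
  · intro j
    by_cases hj : (j : ℕ) < n
    · refine ⟨0, n, by omega, by omega, by omega, ?_⟩
      rintro _ ⟨u, rfl⟩
      exact ⟨u ⊗ₜ 1, by simp [lastHom]⟩
    · refine ⟨n, 1, by omega, by omega, by omega, ?_⟩
      rintro _ ⟨u, rfl⟩
      exact ⟨1 ⊗ₜ u, by simp [lastHom]⟩
  · intro i hi _
    refine ⟨0, n, by omega, by omega, by simpa using hi, ?_⟩
    rintro _ ⟨u, rfl⟩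
    exact ⟨u ⊗ₜ 1, by simp [lastHom]⟩

theorem exists_block {r : ℕ} (c : Fin r → ℕ) (hc : ∑ k, c k = n) (j : ℕ) (hj : j < n) :
    ∃ k, offset c k ≤ j ∧ j < offset c k + c k := by
  by_contra! hcon
  have h : ∀ (k : ℕ) (hk : k < r), offset c ⟨k, hk⟩ ≤ j := by
    intro k
    induction k with
    | zero =>
      intro hk
      rw [offset, Finset.sum_eq_zero]
      · omega
      · intro i hi
        simp [Fin.lt_def] at hi
    | succ k ih =>
      intro hk
      have h1 := hcon ⟨k, by omega⟩ (ih (by omega))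
      rw [offset_add] at h1
      refine le_trans (le_of_eq ?_) h1
      rw [offset]
      congr 1
      ext i
      simp only [Finset.mem_Iio, Finset.mem_Iic, Fin.lt_def, Fin.le_def]
      omega
  rcases r with _ | r
  · simp at hc; omega
  · have h1 := hcon (Fin.last r) (h r (by omega))
    rw [offset_add] at h1
    have h2 : Finset.Iic (Fin.last r) = Finset.univ := by ext i; simp [Fin.le_last]
    rw [h2, hc] at h1
    omega

theorem prod_ofFn_single {M : Type*} [Monoid M] : ∀ {r : ℕ} (f : Fin r → M) (k : Fin r),
    (∀ i, i ≠ k → f i = 1) → (List.ofFn f).prod = f k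
  | 0, _, k, _ => k.elim0
  | r + 1, f, k, h => by
    rw [List.ofFn_succ, List.prod_cons]
    induction k using Fin.cases with
    | zero =>
      have : (fun i : Fin r => f i.succ) = fun _ => 1 :=
        funext fun i => h _ (Fin.succ_ne_zero i)
      simp [this, List.ofFn_const]
    | succ k =>
      rw [h 0 (Fin.succ_ne_zero k).symm, one_mul,
        prod_ofFn_single (fun i => f i.succ) k fun i hi => h _ (by simpa using hi)]

theorem youngHom_single {r : ℕ} (c : Fin r → ℕ) (hc : ∑ k, c k = n) (k : Fin r)
    (u : WHecke F G (c k)) :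
    youngHom F G c hc (PiTensorProduct.singleAlgHom (A := fun k => WHecke F G (c k)) k u)
      = block F (offset_add_le c hc k) u := by
  have h1 : youngHom F G c hc
        (PiTensorProduct.singleAlgHom (A := fun k => WHecke F G (c k)) k u)
      = (List.ofFn fun j => block F (offset_add_le c hc j)
          (Pi.mulSingle (M := fun k => WHecke F G (c k)) k u j)).prod := by
    simp [youngHom, PiTensorProduct.singleAlgHom]
  rw [h1, prod_ofFn_single _ k]
  · simp
  · intro i hi
    rw [Pi.mulSingle_eq_of_ne hi, map_one]

/-- The image of `H_{n_1}(G) ⊗ ... ⊗ H_{n_r}(G)` is the subalgebra generated by `G^n`, all `x_i`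
and the Young subgroup. -/
theorem range_youngHom {r : ℕ} (c : Fin r → ℕ) (hc : ∑ k, c k = n) :
    (youngHom F G c hc).range
      = parabolic F G n {i | ∃ k, offset c k ≤ i ∧ i + 1 < offset c k + c k} := by
  refine le_antisymm ?_ (parabolic_le F _ _ ?_ ?_)
  · rintro _ ⟨z, rfl⟩
    change youngHom F G c hc z ∈ _
    induction z using PiTensorProduct.induction_on with
    | smul_tprod t u =>
      rw [map_smul]
      refine Subalgebra.smul_mem _ ?_ t
      have : youngHom F G c hc (PiTensorProduct.tprod F u)
          = (List.ofFn fun k => block F (offset_add_le c hc k) (u k)).prod := by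
        simp [youngHom]
      rw [this]
      refine Subalgebra.list_prod_mem _ fun x hx => ?_
      obtain ⟨k, rfl⟩ := (List.mem_ofFn' _ _).1 hx
      exact block_mem_parabolic F _ _ (fun i h₁ h₂ => Set.mem_ofPred.2 ⟨k, h₁, h₂⟩) _
    | add u v hu hv => rw [map_add]; exact add_mem hu hv
  · intro j
    obtain ⟨k, h₁, h₂⟩ := exists_block c hc j j.2
    refine ⟨_, _, offset_add_le c hc k, h₁, h₂, ?_⟩
    rintro _ ⟨u, rfl⟩
    exact ⟨_, youngHom_single F c hc k u⟩
  · rintro i ⟨k, h₁, h₂⟩ _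
    refine ⟨_, _, offset_add_le c hc k, h₁, h₂, ?_⟩
    rintro _ ⟨u, rfl⟩
    exact ⟨_, youngHom_single F c hc k u⟩

end block

end Wreath

/-! ### The degenerate affine Hecke algebra -/

/-- The generators `y_i`, `s_i` of the degenerate affine Hecke algebra. -/
inductive DGen (n : ℕ)
  | y (i : Fin n)
  | s (i : ℕ) (hi : i + 1 < n)

section Degenerate

variable (F : Type*) [Field F] (u : F)

/-- A generator, as an element of the free algebra. -/
abbrev dfree {n : ℕ} (a : DGen n) : FreeAlgebra F (DGen n) := FreeAlgebra.ι F a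

/-- The defining relations of the degenerate affine Hecke algebra with parameter `u`. -/
inductive DRel (n : ℕ) : FreeAlgebra F (DGen n) → FreeAlgebra F (DGen n) → Prop
  | y_y (i j : Fin n) : DRel n (dfree F (.y i) * dfree F (.y j)) (dfree F (.y j) * dfree F (.y i))
  | s_sq (i : ℕ) (hi : i + 1 < n) : DRel n (dfree F (.s i hi) * dfree F (.s i hi)) 1
  | s_s (i j : ℕ) (hi : i + 1 < n) (hj : j + 1 < n) (hij : i + 1 < j) :
      DRel n (dfree F (.s i hi) * dfree F (.s j hj)) (dfree F (.s j hj) * dfree F (.s i hi))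
  | braid (i : ℕ) (hi : i + 1 < n) (hj : i + 1 + 1 < n) :
      DRel n (dfree F (.s i hi) * dfree F (.s (i + 1) hj) * dfree F (.s i hi))
        (dfree F (.s (i + 1) hj) * dfree F (.s i hi) * dfree F (.s (i + 1) hj))
  | s_y (i : ℕ) (hi : i + 1 < n) :
      DRel n (dfree F (.s i hi) * dfree F (.y ⟨i, by omega⟩))
        (dfree F (.y ⟨i + 1, hi⟩) * dfree F (.s i hi) - algebraMap F _ u)
  | s_y_of_ne (i : ℕ) (hi : i + 1 < n) (j : Fin n) (h₀ : (j : ℕ) ≠ i) (h₁ : (j : ℕ) ≠ i + 1) :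
      DRel n (dfree F (.s i hi) * dfree F (.y j)) (dfree F (.y j) * dfree F (.s i hi))

/-- The degenerate affine Hecke algebra with parameter `u`: this is `H_n` for `u = 1`, and
`⁰H_n = F[y_1, ..., y_n] ⋊ S_n` for `u = 0`. -/
def DHecke (n : ℕ) : Type _ := RingQuot (DRel F u n)

instance (n : ℕ) : Ring (DHecke F u n) := inferInstanceAs (Ring (RingQuot (DRel F u n)))
instance (n : ℕ) : Algebra F (DHecke F u n) :=
  inferInstanceAs (Algebra F (RingQuot (DRel F u n)))

namespace DHecke

variable {n : ℕ}

/-- The quotient map from the free algebra. -/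
def mk : FreeAlgebra F (DGen n) →ₐ[F] DHecke F u n := RingQuot.mkAlgHom F (DRel F u n)

theorem mk_surjective : Function.Surjective (mk F u (n := n)) :=
  RingQuot.mkAlgHom_surjective F _

/-- The image of a generator in the degenerate affine Hecke algebra. -/
def gen (a : DGen n) : DHecke F u n := mk F u (dfree F a)

variable {F u} {A : Type*} [Ring A] [Algebra F A]

/-- A map on generators that respects the relations extends to the whole algebra. -/
def lift (f : DGen n → A)
    (hf : ∀ ⦃p q⦄, DRel F u n p q → FreeAlgebra.lift F f p = FreeAlgebra.lift F f q) :
    DHecke F u n →ₐ[F] A :=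
  RingQuot.liftAlgHom F ⟨FreeAlgebra.lift F f, hf⟩

@[simp] theorem lift_gen (f : DGen n → A)
    (hf : ∀ ⦃p q⦄, DRel F u n p q → FreeAlgebra.lift F f p = FreeAlgebra.lift F f q)
    (a : DGen n) : lift f hf (gen F u a) = f a :=
  (RingQuot.liftAlgHom_mkAlgHom_apply F (FreeAlgebra.lift F f) hf _).trans (by simp)

theorem rel {p q : FreeAlgebra F (DGen n)} (h : DRel F u n p q) :
    FreeAlgebra.lift F (gen F u) p = FreeAlgebra.lift F (gen F u) q := by
  have key : FreeAlgebra.lift F (gen F u (n := n)) = mk F u := by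
    ext a
    simp only [Function.comp_apply, FreeAlgebra.lift_ι_apply, gen]
  rw [key]
  exact RingQuot.mkAlgHom_rel F h

theorem adjoin_gen : Algebra.adjoin F (Set.range (gen F u (n := n))) = ⊤ := by
  have key : Set.range (gen F u (n := n)) = mk F u '' Set.range (FreeAlgebra.ι F) := by
    rw [← Set.range_comp]; rfl
  rw [key, ← AlgHom.map_adjoin, FreeAlgebra.adjoin_range_ι, Algebra.map_top,
    AlgHom.range_eq_top]
  exact mk_surjective F u

section relations

variable (F u)

theorem gen_y_y (i j : Fin n) :
    gen F u (.y i) * gen F u (.y j) = gen F u (.y j) * gen F u (.y i) := by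
  simpa using rel (F := F) (u := u) (.y_y i j)
theorem gen_s_sq (i : ℕ) (hi : i + 1 < n) :
    gen F u (.s i hi) * gen F u (.s i hi) = 1 := by
  simpa using rel (F := F) (u := u) (.s_sq i hi)
theorem gen_s_s (i j : ℕ) (hi : i + 1 < n) (hj : j + 1 < n) (hij : i + 1 < j) :
    gen F u (.s i hi) * gen F u (.s j hj) = gen F u (.s j hj) * gen F u (.s i hi) := by
  simpa using rel (F := F) (u := u) (.s_s i j hi hj hij)
theorem gen_braid (i : ℕ) (hi : i + 1 < n) (hj : i + 1 + 1 < n) :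
    gen F u (.s i hi) * gen F u (.s (i + 1) hj) * gen F u (.s i hi)
      = gen F u (.s (i + 1) hj) * gen F u (.s i hi) * gen F u (.s (i + 1) hj) := by
  simpa using rel (F := F) (u := u) (.braid i hi hj)
theorem gen_s_y (i : ℕ) (hi : i + 1 < n) :
    gen F u (.s i hi) * gen F u (.y ⟨i, by omega⟩)
      = gen F u (.y ⟨i + 1, hi⟩) * gen F u (.s i hi) - algebraMap F _ u := by
  simpa using rel (F := F) (u := u) (.s_y i hi)
theorem gen_s_y_of_ne (i : ℕ) (hi : i + 1 < n) (j : Fin n) (h₀ : (j : ℕ) ≠ i)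
    (h₁ : (j : ℕ) ≠ i + 1) :
    gen F u (.s i hi) * gen F u (.y j) = gen F u (.y j) * gen F u (.s i hi) := by
  simpa using rel (F := F) (u := u) (.s_y_of_ne i hi j h₀ h₁)

end relations

/-- The generator of the algebra of rank `n + 1` named by a generator of the algebra of rank `n`. -/
def succGen : DGen n → DGen (n + 1)
  | .y i => .y i.castSucc
  | .s i hi => .s i (by omega)

variable (F u n) in
/-- The embedding of the algebra of rank `n` into the one of rank `n + 1`: `y_i ↦ y_i`,
`s_i ↦ s_i`. -/
def toSucc : DHecke F u n →ₐ[F] DHecke F u (n + 1) :=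
  lift (fun a => gen F u (succGen a)) (by
    intro p q h
    cases h with
    | y_y i j => simpa [succGen] using gen_y_y F u _ _
    | s_sq i hi => simpa [succGen] using gen_s_sq F u _ _
    | s_s i j hi hj hij => simpa [succGen] using gen_s_s F u _ _ _ _ (by omega)
    | braid i hi hj => simpa [succGen] using gen_braid F u i _ (by omega)
    | s_y i hi => simpa [succGen] using gen_s_y F u i (by omega)
    | s_y_of_ne i hi j h₀ h₁ =>
      simpa [succGen] using gen_s_y_of_ne F u i (by omega) j.castSucc (by simpa) (by simpa))

theorem toSucc_gen (a : DGen n) : toSucc F u n (gen F u a) = gen F u (succGen a) := by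
  simp [toSucc]

/-- The last polynomial generator commutes with the algebra of smaller rank. -/
theorem commute_last (v : DHecke F u n) :
    Commute (gen F u (.y (Fin.last n))) (toSucc F u n v) := by
  have hv : v ∈ Algebra.adjoin F (Set.range (gen F u (n := n))) := by
    rw [adjoin_gen]; trivial
  induction hv using Algebra.adjoin_induction with
  | mem v hv =>
    obtain ⟨a, rfl⟩ := hv
    rw [toSucc_gen]
    cases a with
    | y i => exact gen_y_y F u _ _
    | s i hi =>
      exact (gen_s_y_of_ne F u _ _ _ (by simp; omega) (by simp; omega)).symm
  | algebraMap c => rw [AlgHom.commutes]; exact (Algebra.commutes c _).symm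
  | add v w _ _ hv hw => rw [map_add]; exact hv.add_right hw
  | mul v w _ _ hv hw => rw [map_mul]; exact hv.mul_right hw

/-- The module `e_a N`: the generalized `a`-eigenspace of the last polynomial generator on `N`,
as a module over the algebra of smaller rank. -/
def eMod (N : Type*) [AddCommGroup N] [Module F N] [Module (DHecke F u (n + 1)) N]
    [IsScalarTower F (DHecke F u (n + 1)) N] (a : F) :
    Submodule (DHecke F u n) (Res (toSucc F u n) N) where
  carrier := {v | (show N from v) ∈ Module.End.maxGenEigenspace
    (Algebra.lsmul F F N (gen F u (.y (Fin.last n))) : Module.End F N) a}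
  add_mem' h₁ h₂ := Submodule.add_mem (Module.End.maxGenEigenspace
    (Algebra.lsmul F F N (gen F u (.y (Fin.last n))) : Module.End F N) a) h₁ h₂
  zero_mem' := Submodule.zero_mem (Module.End.maxGenEigenspace
    (Algebra.lsmul F F N (gen F u (.y (Fin.last n))) : Module.End F N) a)
  smul_mem' h v hv := by
    refine Module.End.mapsTo_maxGenEigenspace_of_comm
      (g := (Algebra.lsmul F F N (toSucc F u n h) : Module.End F N)) ?_ a hv
    exact (commute_last h).map (Algebra.lsmul F F N)

/-- The one-dimensional module `L(a)` over the algebra of rank `1`, on which the polynomial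
generator acts as the scalar `a`. -/
def LOne (F : Type*) [Field F] (_u _a : F) : Type _ := F

section LOne

variable (a : F)

variable (u) in
/-- The action on `L(a)`. -/
def lOneHom : DHecke F u 1 →ₐ[F] Module.End F F :=
  lift (fun b => match b with
    | .y _ => algebraMap F _ a
    | .s _ hi => absurd hi (by omega)) (by
    intro p q h
    cases h with
    | y_y i j => simp
    | s_sq i hi => omega
    | s_s i j hi hj hij => omega
    | braid i hi hj => omega
    | s_y i hi => omega
    | s_y_of_ne i hi j h₀ h₁ => omega)

instance : AddCommGroup (LOne F u a) := inferInstanceAs (AddCommGroup F)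
instance : Module F (LOne F u a) := inferInstanceAs (Module F F)
instance : Module (DHecke F u 1) (LOne F u a) := moduleOfHom (lOneHom u a)
instance : IsScalarTower F (DHecke F u 1) (LOne F u a) := moduleOfHom_tower (lOneHom u a)

end LOne

end DHecke

/-- A number `n` together with a module over the degenerate affine Hecke algebra of rank `n` with
parameter `u`. -/
structure DMod.{v, w} (F : Type v) [Field F] (u : F) where
  /-- the rank -/
  rank : ℕ
  /-- the module -/
  carrier : Type w
  [addCommGroup : AddCommGroup carrier]
  [moduleField : Module F carrier]
  [module : Module (DHecke F u rank) carrier]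
  [isScalarTower : IsScalarTower F (DHecke F u rank) carrier]

attribute [instance] DMod.addCommGroup DMod.moduleField DMod.module DMod.isScalarTower

/-- `ẽ_a N = soc(e_a N)`, a module of rank `n - 1` if `N` has rank `n ≥ 1` (and zero for `n = 0`). -/
def DMod.eTilde.{v, w} {F : Type v} [Field F] {u : F} (a : F) : DMod.{v, w} F u → DMod.{v, w} F u
  | @DMod.mk _ _ _ 0 _ _ _ _ _ =>
    { rank := 0, carrier := PUnit.{w + 1} }
  | @DMod.mk _ _ _ (n + 1) N _ _ _ _ =>
    { rank := n, carrier := socle (DHecke F u n) (DHecke.eMod (u := u) (n := n) N a) }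

theorem DMod.eTilde_rank.{v, w} {F : Type v} [Field F] {u : F} (a : F) (N : DMod.{v, w} F u) :
    (N.eTilde a).rank = N.rank - 1 := by
  obtain ⟨n, N⟩ := N
  cases n <;> rfl

end Degenerate

/-! ### The modules `V^{⊗ m} ⊗ L` over `H_m(G)` -/

section Factor

variable {F : Type*} [Field F] {G : Type*} [Group G] [Fintype G]
  {V : Type*} [AddCommGroup V] [Module F V] (ρ : Representation F G V)

/-- `c` is the scalar such that `∑_h h ⊗ h⁻¹` acts on `V ⊗ V` as `c` times the flip. -/
def IsFlipScalar (c : F) : Prop :=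
  ∀ v w : V, ∑ h : G, ρ h v ⊗ₜ[F] ρ h⁻¹ w = c • (w ⊗ₜ[F] v)

/-- For a simple module over an algebraically closed field, `∑_h h ⊗ h⁻¹` acts on `V ⊗ V` as a
multiple of the flip. -/
theorem exists_isFlipScalar [IsAlgClosed F] [FiniteDimensional F V] [ρ.IsIrreducible] :
    ∃ c : F, IsFlipScalar ρ c := by
  classical
  have key : ∀ (φ : Module.Dual F V) (v : V), ∃ c : F, ∀ w,
      ∑ h : G, φ (ρ h⁻¹ w) • ρ h v = c • w := by
    intro φ v
    let T : V →ₗ[F] V := ∑ h : G, (φ ∘ₗ ρ h⁻¹).smulRight (ρ h v)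
    have hT : ∀ w, T w = ∑ h : G, φ (ρ h⁻¹ w) • ρ h v := fun w => by
      simp [T, LinearMap.sum_apply]
    let T' : Representation.IntertwiningMap ρ ρ := T.intertwiningMap_of_isIntertwiningMap ρ ρ (by
      intro g w
      rw [hT, hT, map_sum]
      refine Fintype.sum_equiv (Equiv.mulLeft g⁻¹) _ _ fun h => ?_
      simp only [map_smul, Equiv.coe_mulLeft, mul_inv_rev, inv_inv, map_mul, Module.End.mul_apply]
      congr 1
      rw [← Module.End.mul_apply, ← Module.End.mul_apply, ← map_mul, ← map_mul]
      simp)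
    obtain ⟨c, hc⟩ :=
      (Representation.IsIrreducible.algebraMap_intertwiningMap_bijective_of_isAlgClosed
      (ρ := ρ)).2 T'
    refine ⟨c, fun w => ?_⟩
    rw [← hT]
    have : T' w = c • w := by rw [← hc]; rfl
    exact this
  choose lam hlam using key
  obtain ⟨w₀, hw₀⟩ : ∃ w : V, w ≠ 0 := by
    by_contra! hcon
    have h1 : (⊥ : Subrepresentation ρ) ≠ ⊤ := bot_ne_top
    apply h1
    ext w
    simp [hcon w]
  obtain ⟨φ₀, hφ₀⟩ := Module.Projective.exists_dual_eq_one F hw₀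
  have hlam' : ∀ (φ : Module.Dual F V) (v : V), lam φ v = lam φ₀ w₀ * φ v := by
    intro φ v
    have h1 := congrArg φ₀ (hlam φ v w₀)
    have h2 := congrArg φ (hlam φ₀ w₀ v)
    simp only [map_sum, map_smul, smul_eq_mul, hφ₀, mul_one] at h1 h2
    rw [← h1, ← h2]
    refine Fintype.sum_equiv (Equiv.inv G) _ _ fun h => ?_
    simp [mul_comm]
  refine ⟨lam φ₀ w₀, fun v w => ?_⟩
  let b := Module.finBasis F V
  refine (b.tensorProduct b).repr.injective (Finsupp.ext fun ⟨i, j⟩ => ?_)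
  have h1 := congrArg (b.coord i) (hlam (b.coord j) v w)
  rw [hlam'] at h1
  simp only [map_sum, map_smul, smul_eq_mul, Module.Basis.coord_apply] at h1
  simp only [map_sum, map_smul, Finsupp.coe_finsetSum, Finset.sum_apply, Finsupp.smul_apply,
    Module.Basis.tensorProduct_repr_tmul_apply, smul_eq_mul]
  rw [← mul_assoc, ← h1]

open Classical in
/-- The scalar `c` by which `∑_h h ⊗ h⁻¹`, composed with the flip, acts on `V ⊗ V`. -/
def flipScalar : F := if h : ∃ c : F, IsFlipScalar ρ c then h.choose else 0

theorem isFlipScalar_flipScalar [IsAlgClosed F] [FiniteDimensional F V] [ρ.IsIrreducible] :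
    IsFlipScalar ρ (flipScalar ρ) := by
  have h := exists_isFlipScalar ρ
  rw [flipScalar, dif_pos h]
  exact h.choose_spec

open Classical in
/-- The parameter of the algebra `ᶜH_m`, which is `H_m` for `c ≠ 0` and `⁰H_m` for `c = 0`. -/
def twist (c : F) : F := if c = 0 then 0 else 1

open Classical in
/-- The factor that relates `x_i` and `y_i`: it is `c` for `c ≠ 0` and `1` for `c = 0`. -/
def scale (c : F) : F := if c = 0 then 1 else c

theorem scale_mul_twist (c : F) : scale c * twist c = c := by
  by_cases h : c = 0 <;> simp [scale, twist, h]

/-- The place permutation `σ (v_1 ⊗ ... ⊗ v_m) = v_{σ⁻¹(1)} ⊗ ... ⊗ v_{σ⁻¹(m)}`. -/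
def permute (F V : Type*) [Field F] [AddCommGroup V] [Module F V] {m : ℕ}
    (σ : Equiv.Perm (Fin m)) : Module.End F (⨂[F] _ : Fin m, V) :=
  (PiTensorProduct.reindex F (fun _ => V) σ).toLinearMap

theorem permute_tprod {m : ℕ} (σ : Equiv.Perm (Fin m)) (v : Fin m → V) :
    permute F V σ (⨂ₜ[F] i, v i) = ⨂ₜ[F] i, v (σ⁻¹ i) := by
  simp [permute]

theorem permute_mul {m : ℕ} (σ τ : Equiv.Perm (Fin m)) :
    permute F V (σ * τ) = permute F V σ * permute F V τ := by
  ext v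
  simp only [LinearMap.compMultilinearMap_apply, Module.End.mul_apply, permute_tprod]
  rfl

theorem permute_one {m : ℕ} : permute F V (1 : Equiv.Perm (Fin m)) = 1 := by
  ext v
  simp only [LinearMap.compMultilinearMap_apply, permute_tprod]
  rfl

/-- The action of `G^m` on `V^{⊗ m}`. -/
def tensorPow {m : ℕ} (a : Fin m → G) : Module.End F (⨂[F] _ : Fin m, V) :=
  PiTensorProduct.map fun i => ρ (a i)

theorem tensorPow_tprod {m : ℕ} (a : Fin m → G) (v : Fin m → V) :
    tensorPow ρ a (⨂ₜ[F] i, v i) = ⨂ₜ[F] i, ρ (a i) (v i) := by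
  simp [tensorPow]

theorem tensorPow_mul {m : ℕ} (a b : Fin m → G) :
    tensorPow ρ (a * b) = tensorPow ρ a * tensorPow ρ b := by
  ext v
  simp [tensorPow_tprod]

theorem tensorPow_one {m : ℕ} : tensorPow ρ (1 : Fin m → G) = 1 := by
  ext v
  simp [tensorPow_tprod]

theorem permute_mul_tensorPow {m : ℕ} (σ : Equiv.Perm (Fin m)) (a : Fin m → G) :
    permute F V σ * tensorPow ρ a = tensorPow ρ (fun j => a (σ⁻¹ j)) * permute F V σ := by
  ext v
  simp only [LinearMap.compMultilinearMap_apply, Module.End.mul_apply, permute_tprod,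
    tensorPow_tprod]

/-- `∑_h h^{(i)} (h⁻¹)^{(j)}` acts on `V^{⊗ m}` as a multiple of the transposition of the factors
`i` and `j`. -/
theorem sum_tensorPow {m : ℕ} {c : F} (hc : IsFlipScalar ρ c) {i j : Fin m} (hij : i ≠ j) :
    ∑ h : G, tensorPow ρ (Pi.mulSingle i h * Pi.mulSingle j h⁻¹)
      = c • permute F V (Equiv.swap i j) := by
  ext v
  let T : V →ₗ[F] V →ₗ[F] (⨂[F] _ : Fin m, V) := LinearMap.mk₂ F
    (fun a b => PiTensorProduct.tprod F (Function.update (Function.update v i a) j b))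
    (fun a a' b => by
      rw [Function.update_comm hij, Function.update_comm hij, Function.update_comm hij,
        MultilinearMap.map_update_add])
    (fun t a b => by
      rw [Function.update_comm hij, Function.update_comm hij, MultilinearMap.map_update_smul])
    (fun a b b' => by rw [MultilinearMap.map_update_add])
    (fun t a b => by rw [MultilinearMap.map_update_smul])
  have h1 := congrArg (TensorProduct.lift T) (hc (v i) (v j))
  simp only [map_sum, map_smul, TensorProduct.lift.tmul, T, LinearMap.mk₂_apply] at h1
  simp only [LinearMap.compMultilinearMap_apply, LinearMap.sum_apply, LinearMap.smul_apply,
    tensorPow_tprod, permute_tprod]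
  convert h1 using 2
  · rename_i h _
    congr 1
    ext k
    by_cases h₁ : k = j
    · subst h₁; simp [hij.symm]
    · by_cases h₂ : k = i
      · subst h₂; simp [hij]
      · simp [h₁, h₂]
  · congr 1
    ext k
    by_cases h₁ : k = j
    · subst h₁
      rw [Function.update_self]
      exact congrArg v (by simp)
    · rw [Function.update_of_ne h₁]
      by_cases h₂ : k = i
      · subst h₂
        rw [Function.update_self]
        exact congrArg v (by simp)
      · rw [Function.update_of_ne h₂]
        exact congrArg v (by simp [Equiv.swap_apply_of_ne_of_ne h₂ h₁])

/-- The space `V^{⊗ m} ⊗ L`. -/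
def Factor (_ρ : Representation F G V) (m : ℕ) (L : Type*) [AddCommGroup L] [Module F L] : Type _ :=
  (⨂[F] _ : Fin m, V) ⊗[F] L

variable [IsAlgClosed F] [FiniteDimensional F V] [ρ.IsIrreducible] (m : ℕ)
  (L : Type*) [AddCommGroup L] [Module F L] [Module (DHecke F (twist (flipScalar ρ)) m) L]
  [IsScalarTower F (DHecke F (twist (flipScalar ρ)) m) L]

/-- The operators on `V^{⊗ m} ⊗ L` by which the generators of `H_m(G)` act:
`g (v ⊗ z) = g v ⊗ z`, `s_i (v ⊗ z) = s_i v ⊗ s_i z`, and `x_i (v ⊗ z)` is `c v ⊗ y_i z` for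
`c ≠ 0` and `v ⊗ y_i z` for `c = 0`. -/
def factorGen : Gen G m → Module.End F ((⨂[F] _ : Fin m, V) ⊗[F] L)
  | .g a => TensorProduct.map (tensorPow ρ a) 1
  | .x i => TensorProduct.map 1 (scale (flipScalar ρ) •
      (Algebra.lsmul F F L (DHecke.gen F (twist (flipScalar ρ)) (.y i)) : Module.End F L))
  | .s i hi => TensorProduct.map (permute F V (adj i hi))
      (Algebra.lsmul F F L (DHecke.gen F (twist (flipScalar ρ)) (.s i hi)) : Module.End F L)

theorem adj_braid {n : ℕ} (i : ℕ) (hi : i + 1 < n) (hj : i + 1 + 1 < n) :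
    adj i hi * adj (i + 1) hj * adj i hi = adj (i + 1) hj * adj i hi * adj (i + 1) hj := by
  ext k
  obtain ⟨k, hk⟩ := k
  simp only [Equiv.Perm.mul_apply, Equiv.swap_apply_def, Fin.ext_iff]
  grind

theorem adj_comm {n : ℕ} (i j : ℕ) (hi : i + 1 < n) (hj : j + 1 < n) (hij : i + 1 < j) :
    (adj i hi : Equiv.Perm (Fin n)) * adj j hj = adj j hj * adj i hi := by
  ext k
  obtain ⟨k, hk⟩ := k
  simp only [Equiv.Perm.mul_apply, Equiv.swap_apply_def, Fin.ext_iff]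
  grind

/-- The action of `H_m(G)` on `V^{⊗ m} ⊗ L`, for a module `L` over `ᶜH_m`. -/
def factorHom : WHecke F G m →ₐ[F] Module.End F ((⨂[F] _ : Fin m, V) ⊗[F] L) :=
  WHecke.lift (factorGen ρ m L) (by
    intro p q h
    cases h <;> simp only [factorGen, map_mul, map_one, map_sub, map_sum, FreeAlgebra.lift_ι_apply,
      ← TensorProduct.map_mul]
    case g_one => rw [tensorPow_one, TensorProduct.map_one]
    case g_mul a b => rw [tensorPow_mul, mul_one]
    case x_x i j =>
      simp only [smul_mul_smul_comm, ← map_mul, DHecke.gen_y_y _ _ i j]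
    case x_g i a => simp only [one_mul, mul_one]
    case s_sq i hi =>
      rw [← permute_mul, ← map_mul, DHecke.gen_s_sq, Equiv.swap_mul_self, permute_one, map_one,
        TensorProduct.map_one]
    case s_s i j hi hj hij =>
      rw [← permute_mul, ← permute_mul, ← map_mul, ← map_mul, DHecke.gen_s_s _ _ i j hi hj hij,
        adj_comm i j hi hj hij]
    case braid i hi hj =>
      simp only [← permute_mul, adj_braid i hi hj]
      simp only [← map_mul, DHecke.gen_braid _ _ i hi hj]
    case s_x i hi =>
      have hne : (⟨i, by omega⟩ : Fin m) ≠ ⟨i + 1, hi⟩ := by simp [Fin.ext_iff]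
      have ht := sum_tensorPow ρ (m := m) (isFlipScalar_flipScalar ρ) hne
      simp only [mul_one, one_mul, mul_smul_comm, smul_mul_assoc]
      rw [← map_mul, ← map_mul, DHecke.gen_s_y]
      refine TensorProduct.ext' fun v z => ?_
      have htv := congrArg (fun f => f v) ht
      simp only [LinearMap.sum_apply, LinearMap.smul_apply] at htv
      simp only [LinearMap.sub_apply, LinearMap.sum_apply, TensorProduct.map_tmul,
        LinearMap.smul_apply, map_sub, Module.End.one_apply, ← TensorProduct.sum_tmul, htv,
        AlgHom.commutes, smul_sub, TensorProduct.tmul_sub, Module.algebraMap_end_apply, smul_smul,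
        scale_mul_twist, TensorProduct.smul_tmul, TensorProduct.tmul_smul]
    case s_x_of_ne i hi j h₀ h₁ =>
      simp only [mul_one, one_mul, mul_smul_comm, smul_mul_assoc, ← map_mul,
        DHecke.gen_s_y_of_ne _ _ i hi j h₀ h₁]
    case s_g i hi a => rw [permute_mul_tensorPow, mul_one, one_mul])

instance : AddCommGroup (Factor ρ m L) :=
  inferInstanceAs (AddCommGroup ((⨂[F] _ : Fin m, V) ⊗[F] L))
instance : Module F (Factor ρ m L) :=
  inferInstanceAs (Module F ((⨂[F] _ : Fin m, V) ⊗[F] L))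
instance : Module (WHecke F G m) (Factor ρ m L) := moduleOfHom (factorHom ρ m L)
instance : IsScalarTower F (WHecke F G m) (Factor ρ m L) := moduleOfHom_tower (factorHom ρ m L)

end Factor

/-! ### The modules `D` and the branching data -/

section Branching

variable {F : Type*} [Field F] {G : Type*} [Group G] [Fintype G]
  {r : ℕ} {V : Fin r → Type*} [∀ k, AddCommGroup (V k)] [∀ k, Module F (V k)]
  (ρ : ∀ k, Representation F G (V k))

/-- A composition `(n_1, ..., n_r)` together with modules `L_k` over `ᶜH_{n_k}`, where `c = c_k` is
the scalar attached to `V_k`. -/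
abbrev Family.{w} : Type _ := ∀ k, DMod.{_, w} F (twist (flipScalar (ρ k)))

variable {ρ}

/-- The family in which `(n_k, L_k)` is replaced by `(n_k - 1, ẽ_a L_k)`. -/
abbrev Family.remove (L : Family ρ) (k : Fin r) (a : F) : Family ρ :=
  Function.update L k ((L k).eTilde a)

theorem Family.sum_rank_remove {L : Family ρ} {n : ℕ}
    (hn : ∑ k, (L k).rank = n + 1) {k : Fin r} (hk : 0 < (L k).rank) (a : F) :
    ∑ j, (L.remove k a j).rank = n := by
  have h1 : ∀ j, (L.remove k a j).rank
      = Function.update (fun j => (L j).rank) k ((L k).rank - 1) j := by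
    intro j
    by_cases h : j = k
    · subst h; simp [Family.remove, DMod.eTilde_rank]
    · simp [Family.remove, h]
  simp only [h1]
  rw [Finset.sum_update_of_mem (Finset.mem_univ k)]
  have h2 := Finset.add_sum_erase Finset.univ (fun j => (L j).rank) (Finset.mem_univ k)
  rw [Finset.sdiff_singleton_eq_erase]
  omega

variable [IsAlgClosed F] [∀ k, FiniteDimensional F (V k)] [∀ k, (ρ k).IsIrreducible]

/-- The `H_n(G)`-module `D(L) = ind ((V_1^{⊗ n_1} ⊗ L_1) ⊗ ... ⊗ (V_r^{⊗ n_r} ⊗ L_r))`, where the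
induction is from `H_{n_1}(G) ⊗ ... ⊗ H_{n_r}(G)`. -/
abbrev Family.D (L : Family ρ) {n : ℕ} (hn : ∑ k, (L k).rank = n) : Type _ :=
  Ind (youngHom F G (fun k => (L k).rank) hn)
    (PiOuter F fun k => Factor (ρ k) (L k).rank (L k).carrier)

end Branching

end

end WreathHecke

/-! Let E be the outer tensor product of the modules V_k^{⊗n_k} ⊗ L_k, so that D(L) = ind E. The V_k
are pairwise non-isomorphic simple modules over an algebraically closed field, so the density
theorem yields elements ε_l of the group algebra of G that act as 1 on V_l and as 0 on every other
V_k (`exists_isSeparating`). Moving ε_l through ∑ h ⊗ h⁻¹ from one tensor factor to the other shows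
that this sum kills E at two positions of different blocks (`IsBlockIdempotent.sum_cross`). Between
different blocks the relation of s_i and x_i therefore loses its correction term, and ind E can be
written down explicitly. It is the space of functions from shuffles to E, where a shuffle amounts to
a word containing the letter k exactly n_k times; s_i exchanges words when their letters at i and i
+ 1 differ, and acts through E when they agree (`modelHom`, `exists_indEquiv`). This description
takes the place of a basis theorem for H_n(G).

Submodules are controlled by three lattice isomorphisms. Products of the ε_l project onto single
words, so submodules of ind E correspond to submodules of E (`exists_ind_orderIso`). By Burnside's
theorem, if all factors of E but the k-th are simple, the submodules of E correspond to those of the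
k-th factor (`exists_piOuter_orderIso`), and the submodules of V^{⊗m} ⊗ L correspond to those of L
(`exists_factor_orderIso`). Burnside's theorem needs finite dimension, which holds for simple
modules over the degenerate affine Hecke algebras by the Nullstellensatz
(`DHecke.finite_of_isSimpleModule`). Since ẽ_a L_k is a socle and hence semisimple, the
semisimplicity of the modules D(ẽ_a L) follows.

For the branching rule, the sum of all y_i is central. On a simple submodule of the restriction of
L_k to the smaller algebra both the full sum and the sum without the last term are scalars, hence so
is the last y (`DHecke.exists_last_eq_smul`). On ẽ_a L_k it is the scalar a, so ẽ_a L_k ⊗ L(a) maps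
into L_k compatibly with all y_i. Placing E' ⊗ (V_k ⊗ L(a)), where E' is the outer tensor product
after removal, at the shuffle whose last letter is k and whose other letters increase, Frobenius
reciprocity gives maps from the summands to the restriction of D(L) (`exists_branchMap`). They are
injective by the lattice isomorphisms, and their sum is injective because x_n and the ε_l at the
last place act on the summands by distinguishing scalars (`toModule_injective`).

Conversely, a simple submodule S of the restriction has a nonzero component at a shuffle; the
elements s_i that fix the last place move it to the special shuffle of its last letter k
(`exists_component_ne_bot`). This component is stable under all generators of the Young subalgebra
but the last reflection of the k-th block. Splitting off the other factors leaves a nonzero subspace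
of L_k that is stable under the smaller algebra, and this meets some ẽ_a L_k
(`Family.exists_branch_mem`). Thus S meets the image of a summand, and being simple it lies in the
sum of the images. -/

open scoped TensorProduct DirectSum

namespace WreathHecke

noncomputable section

/-! ### The Coxeter presentation of the symmetric group -/

section Coxeter

variable {M : Type*}

/-- The Coxeter relations of type `A_{n-1}` for elements `σ_0, ..., σ_{n-2}` of a monoid. -/
structure CoxeterRel [Monoid M] (n : ℕ) (σ : ℕ → M) : Prop where
  sq : ∀ i, i + 1 < n → σ i * σ i = 1
  comm : ∀ i j, i + 1 < j → j + 1 < n → σ i * σ j = σ j * σ i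
  braid : ∀ i, i + 2 < n → σ i * σ (i + 1) * σ i = σ (i + 1) * σ i * σ (i + 1)

theorem CoxeterRel.mono [Monoid M] {m n : ℕ} {σ : ℕ → M} (h : CoxeterRel n σ) (hm : m ≤ n) :
    CoxeterRel m σ :=
  ⟨fun i hi => h.sq i (by omega), fun i j hij hj => h.comm i j hij (by omega),
    fun i hi => h.braid i (by omega)⟩

/-- The product `σ_{n-d} ... σ_{n-1}`. -/
def coxeterChain [Monoid M] (σ : ℕ → M) (n : ℕ) : ℕ → M
  | 0 => 1
  | d + 1 => σ (n - (d + 1)) * coxeterChain σ n d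

theorem mul_coxeterChain_of_lt [Monoid M] {n : ℕ} {σ : ℕ → M} (h : CoxeterRel (n + 1) σ)
    (d : ℕ) (i : ℕ) (hi : i + 1 + d < n) :
    σ i * coxeterChain σ n d = coxeterChain σ n d * σ i := by
  induction d with
  | zero => simp [coxeterChain]
  | succ d ih =>
    rw [coxeterChain, ← mul_assoc, h.comm i _ (by omega) (by omega), mul_assoc,
      ih (by omega), mul_assoc]

/-- The chain acts like a cycle, so moving a generator through it shifts the index. Everything
commutes except where the chain contains σ_i σ_{i+1}, and there one braid relation does the shift.
-/
theorem mul_coxeterChain_of_gt [Monoid M] {n : ℕ} {σ : ℕ → M} (h : CoxeterRel (n + 1) σ)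
    (d : ℕ) (hd : d ≤ n) (i : ℕ) (hi : n < i + 1 + d) (hin : i + 1 < n) :
    σ (i + 1) * coxeterChain σ n d = coxeterChain σ n d * σ i := by
  induction d with
  | zero => omega
  | succ d ih =>
    rw [coxeterChain]
    rcases eq_or_ne (n - (d + 1)) i with hj | hj
    · obtain _ | d := d
      · omega
      rw [coxeterChain, show n - (d + 1) = i + 1 by omega, hj, ← mul_assoc, ← mul_assoc,
        ← h.braid i (by omega), mul_assoc, mul_coxeterChain_of_lt h d i (by omega), ← mul_assoc, mul_assoc, mul_assoc, mul_assoc, mul_assoc]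
    · rw [← mul_assoc, ← h.comm (n - (d + 1)) (i + 1) (by omega) (by omega), mul_assoc,
        ih (by omega) (by omega), mul_assoc]

/-- Elements that satisfy the Coxeter relations generate a group of order at most `n!`. -/
theorem exists_finset_of_coxeterRel [Monoid M] [DecidableEq M] {σ : ℕ → M} :
    ∀ n, CoxeterRel n σ → ∃ S : Finset M, 1 ∈ S ∧ S.card ≤ n.factorial ∧
      ∀ i, i + 1 < n → ∀ w ∈ S, σ i * w ∈ S
  | 0, _ => ⟨{1}, by simp, by simp, by intro i hi; omega⟩
  | n + 1, h => by
    obtain ⟨S, h1, hc, hS⟩ := exists_finset_of_coxeterRel n (h.mono (Nat.le_succ n))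
    -- The n + 1 chains serve as coset representatives, which multiplies the bound n! by n + 1.
    refine ⟨(Finset.range (n + 1) ×ˢ S).image fun p => coxeterChain σ n p.1 * p.2, ?_, ?_, ?_⟩
    · exact Finset.mem_image.2 ⟨(0, 1), by simp [h1], by simp [coxeterChain]⟩
    · refine Finset.card_image_le.trans ?_
      rw [Finset.card_product, Finset.card_range, Nat.factorial_succ]
      exact Nat.mul_le_mul_left _ hc
    · intro i hi w hw
      obtain ⟨⟨d, w⟩, hd, rfl⟩ := Finset.mem_image.1 hw
      simp only [Finset.mem_product, Finset.mem_range] at hd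
      have key : ∀ e v, e ≤ n → v ∈ S → coxeterChain σ n e * v ∈
          (Finset.range (n + 1) ×ˢ S).image fun p => coxeterChain σ n p.1 * p.2 := fun e v he hv =>
        Finset.mem_image.2 ⟨(e, v), by simp [hv]; omega, rfl⟩
      simp only
      rw [← mul_assoc]
      -- Four cases: σ_i lies to the left of the chain and passes through, or extends it by one
      -- letter, or cancels its first letter, or passes through with its index lowered by one.
      rcases lt_trichotomy (i + 1 + d) n with hlt | heq | hgt
      · rw [mul_coxeterChain_of_lt h d i (by omega), mul_assoc]
        exact key _ _ (by omega) (hS i (by omega) _ hd.2)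
      · have : σ i * coxeterChain σ n d = coxeterChain σ n (d + 1) := by
          rw [coxeterChain, show n - (d + 1) = i by omega]
        rw [this]
        exact key _ _ (by omega) hd.2
      · rcases eq_or_ne (i + d) n with hj | hj
        · obtain _ | d := d
          · omega
          rw [coxeterChain, show n - (d + 1) = i by omega, ← mul_assoc, h.sq i hi, one_mul]
          exact key _ _ (by omega) hd.2
        · obtain _ | i := i
          · omega
          rw [mul_coxeterChain_of_gt h d (by omega) i (by omega) (by omega), mul_assoc]
          exact key _ _ (by omega) (hS i (by omega) _ hd.2)

theorem closure_adj (n : ℕ) :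
    Submonoid.closure {w : Equiv.Perm (Fin n) | ∃ i hi, w = adj i hi} = ⊤ := by
  obtain _ | n := n
  · exact Subsingleton.elim _ _
  rw [eq_top_iff, ← Equiv.Perm.mclosure_swap_castSucc_succ]
  refine Submonoid.closure_mono ?_
  rintro _ ⟨i, rfl⟩
  exact ⟨i, by omega, rfl⟩

theorem perm_induction {n : ℕ} {p : Equiv.Perm (Fin n) → Prop} (h1 : p 1)
    (hs : ∀ i hi w, p w → p (adj i hi * w)) (w : Equiv.Perm (Fin n)) : p w := by
  have hw : w ∈ Submonoid.closure {w : Equiv.Perm (Fin n) | ∃ i hi, w = adj i hi} := by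
    rw [closure_adj]; trivial
  refine Submonoid.closure_induction_left h1 ?_ hw
  rintro _ ⟨i, hi, rfl⟩ y _ hy
  exact hs i hi y hy

theorem adj_mul_self {n : ℕ} (i : ℕ) (hi : i + 1 < n) :
    (adj i hi : Equiv.Perm (Fin n)) * adj i hi = 1 := Equiv.swap_mul_self _ _

/-- The Coxeter presentation of the symmetric group. -/
theorem exists_perm_hom [Group M] {n : ℕ} {σ : ℕ → M} (h : CoxeterRel n σ) :
    ∃ T : Equiv.Perm (Fin n) →* M, ∀ i hi, T (adj i hi) = σ i := by
  classical
  -- The submonoid generated by these pairs will be the graph of the required homomorphism. It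
  -- projects onto S_n and lies in a set of at most n! elements, so the projection is injective.
  let τ : ℕ → Equiv.Perm (Fin n) × M := fun i => (if hi : i + 1 < n then adj i hi else 1, σ i)
  have hτ : CoxeterRel n τ := by
    refine ⟨fun i hi => ?_, fun i j hij hj => ?_, fun i hi => ?_⟩
    · simp only [τ, dif_pos hi, Prod.mk_mul_mk, h.sq i hi, adj_mul_self]; rfl
    · simp only [τ, dif_pos hj, dif_pos (show i + 1 < n by omega), Prod.mk_mul_mk,
        h.comm i j hij hj, adj_comm i j (by omega) hj hij]
    · simp only [τ, dif_pos (show i + 1 < n by omega), dif_pos (show i + 1 + 1 < n by omega),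
        Prod.mk_mul_mk, h.braid i hi, adj_braid i (show i + 1 < n by omega)
          (show i + 1 + 1 < n by omega)]
  obtain ⟨S, hS1, hSc, hS⟩ := exists_finset_of_coxeterRel n hτ
  let H : Submonoid (Equiv.Perm (Fin n) × M) :=
    Submonoid.closure {w | ∃ i, i + 1 < n ∧ w = τ i}
  have hHS : ∀ w ∈ H, w ∈ S := by
    intro w hw
    refine Submonoid.closure_induction_left hS1 ?_ hw
    rintro _ ⟨i, hi, rfl⟩ y _ hy
    exact hS i hi y hy
  have hsurj : ∀ w : Equiv.Perm (Fin n), ∃ m, (w, m) ∈ H := by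
    refine perm_induction ⟨1, H.one_mem⟩ ?_
    rintro i hi w ⟨m, hm⟩
    refine ⟨σ i * m, ?_⟩
    have : (adj i hi * w, σ i * m) = τ i * (w, m) := by
      simp only [τ, dif_pos hi, Prod.mk_mul_mk]
    rw [this]
    exact H.mul_mem (Submonoid.subset_closure ⟨i, hi, rfl⟩) hm
  have himg : S.image Prod.fst = Finset.univ := by
    ext w
    simp only [Finset.mem_image, Finset.mem_univ, iff_true]
    obtain ⟨m, hm⟩ := hsurj w
    exact ⟨_, hHS _ hm, rfl⟩
  have hinj : Set.InjOn Prod.fst (S : Set (Equiv.Perm (Fin n) × M)) := by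
    refine Finset.card_image_iff.1 (le_antisymm Finset.card_image_le ?_)
    rw [himg, Finset.card_univ, Fintype.card_perm, Fintype.card_fin]
    exact hSc
  choose t ht using hsurj
  have huniq : ∀ w m, (w, m) ∈ H → m = t w := fun w m hm =>
    congrArg Prod.snd (hinj (hHS _ hm) (hHS _ (ht w)) rfl)
  refine ⟨⟨⟨t, (huniq 1 1 H.one_mem).symm⟩, fun v w => (huniq _ _ ?_).symm⟩, fun i hi => ?_⟩
  · exact H.mul_mem (ht v) (ht w)
  · refine (huniq _ _ ?_).symm
    have : (adj i hi, σ i) = τ i := by simp only [τ, dif_pos hi]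
    rw [this]
    exact Submonoid.subset_closure ⟨i, hi, rfl⟩

/-- The Coxeter presentation of the symmetric group, for elements of a monoid. -/
theorem exists_perm_hom_monoid [Monoid M] {n : ℕ} (σ : ∀ i, i + 1 < n → M)
    (sq : ∀ i hi, σ i hi * σ i hi = 1)
    (comm : ∀ i j (hi : i + 1 < n) (hj : j + 1 < n), i + 1 < j → σ i hi * σ j hj = σ j hj * σ i hi)
    (braid : ∀ i (hi : i + 1 < n) (hj : i + 1 + 1 < n),
      σ i hi * σ (i + 1) hj * σ i hi = σ (i + 1) hj * σ i hi * σ (i + 1) hj) :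
    ∃ T : Equiv.Perm (Fin n) →* M, ∀ i hi, T (adj i hi) = σ i hi := by
  let τ : ℕ → Mˣ := fun i => if hi : i + 1 < n then ⟨σ i hi, σ i hi, sq i hi, sq i hi⟩ else 1
  have hτ : CoxeterRel n τ := by
    refine ⟨fun i hi => ?_, fun i j hij hj => ?_, fun i hi => ?_⟩ <;> ext
    · simp only [τ, dif_pos hi, Units.val_mul, sq i hi, Units.val_one]
    · simp only [τ, dif_pos hj, dif_pos (show i + 1 < n by omega), Units.val_mul,
        comm i j (by omega) hj hij]
    · simp only [τ, dif_pos (show i + 1 < n by omega), dif_pos (show i + 1 + 1 < n by omega),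
        Units.val_mul, braid i (by omega) (by omega)]
  obtain ⟨T, hT⟩ := exists_perm_hom hτ
  refine ⟨(Units.coeHom M).comp T, fun i hi => ?_⟩
  simp [hT, τ, dif_pos hi]

end Coxeter

/-! ### Finite dimension of simple modules over the degenerate affine Hecke algebra -/

section Finiteness

/-- Zariski's form of the Nullstellensatz: the module is B/I for a maximal ideal I, and a field of
finite type over F is finite over F. -/
theorem finite_of_isSimpleModule_commRing (F B M : Type*) [Field F] [CommRing B] [Algebra F B]
    [Algebra.FiniteType F B] [AddCommGroup M] [Module F M] [Module B M] [IsScalarTower F B M]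
    [IsSimpleModule B M] : FiniteDimensional F M := by
  obtain ⟨I, hI, ⟨e⟩⟩ := isSimpleModule_iff_quot_maximal.1 ‹IsSimpleModule B M›
  let _ := Ideal.Quotient.field I
  have : Module.Finite F (B ⧸ I) := finite_of_finite_type_of_isJacobsonRing F (B ⧸ I)
  exact Module.Finite.equiv (e.restrictScalars F).symm

open scoped IsMulCommutative in
/-- A simple module over an algebra that is spanned by finitely many left translates of a finitely
generated commutative subalgebra is finite-dimensional. -/
theorem finite_of_isSimpleModule_of_comm {F A L ι : Type*} [Field F] [Ring A] [Algebra F A]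
    [AddCommGroup L] [Module F L] [Module A L] [IsScalarTower F A L] [IsSimpleModule A L]
    [Finite ι] (B : Subalgebra F A) [IsMulCommutative B] (hfg : B.FG) (T : ι → A)
    (hT : ∀ a : A, a ∈ Submodule.span F {z | ∃ b ∈ B, ∃ i, z = b * T i}) :
    FiniteDimensional F L := by
  have : Algebra.FiniteType F B := B.fg_iff_finiteType.1 hfg
  have : Nontrivial L := IsSimpleModule.nontrivial A L
  obtain ⟨v, hv⟩ := exists_ne (0 : L)
  have hmem : ∀ (X : Submodule B L) (a : A) (w : L), (∀ i, T i • w ∈ X) → a • w ∈ X := by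
    intro X a w hX
    refine Submodule.span_induction (p := fun a _ => a • w ∈ X) ?_ ?_ ?_ ?_ (hT a)
    · rintro _ ⟨b, hb, i, rfl⟩
      rw [mul_smul]
      exact X.smul_mem ⟨b, hb⟩ (hX i)
    · rw [zero_smul]; exact X.zero_mem
    · intro x y _ _ hx hy; rw [add_smul]; exact X.add_mem hx hy
    · intro c x _ hx
      rw [smul_assoc, ← algebraMap_smul B c (x • w)]
      exact X.smul_mem _ hx
  have hfin : Module.Finite B L := by
    refine ⟨Submodule.fg_def.2 ⟨Set.range fun i => T i • v, Set.finite_range _, ?_⟩⟩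
    refine eq_top_iff.2 fun w _ => ?_
    have hw : w ∈ Submodule.span A {v} := by
      rw [IsSimpleModule.span_singleton_eq_top A hv]; trivial
    obtain ⟨a, rfl⟩ := Submodule.mem_span_singleton.1 hw
    exact hmem _ a v fun i => Submodule.subset_span ⟨i, rfl⟩
  -- L is finitely generated over B but need not be simple over it, so the Nullstellensatz is
  -- applied to a simple quotient L/X.
  obtain ⟨X, hX, -⟩ := (eq_top_or_exists_le_coatom (⊥ : Submodule B L)).resolve_left bot_ne_top
  have hsimp : IsSimpleModule B (L ⧸ X) := isSimpleModule_iff_isCoatom.2 hX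
  have hq : FiniteDimensional F (L ⧸ X) :=
    finite_of_isSimpleModule_commRing F B (L ⧸ X)
  -- The largest A-submodule contained in X. It vanishes because L is simple, so w ↦ (T_i w mod X)_i
  -- embeds L into finitely many copies of L/X.
  let U : Submodule A L :=
    { carrier := {w | ∀ a : A, a • w ∈ X}
      add_mem' := fun h h' a => by rw [smul_add]; exact X.add_mem (h a) (h' a)
      zero_mem' := fun a => by rw [smul_zero]; exact X.zero_mem
      smul_mem' := fun b w h a => by rw [← mul_smul]; exact h _ }
  have hU : U = ⊥ := by
    refine (eq_bot_or_eq_top U).resolve_right fun h => hX.1 (eq_top_iff.2 fun w _ => ?_)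
    have : w ∈ U := h ▸ trivial
    simpa using this 1
  let f : L →ₗ[F] (ι → L ⧸ X) :=
    LinearMap.pi fun i => (X.mkQ.restrictScalars F) ∘ₗ (Algebra.lsmul F F L (T i))
  refine FiniteDimensional.of_injective f ((injective_iff_map_eq_zero f).2 fun w hw => ?_)
  have : w ∈ U := fun a => hmem X a w fun i => by
    have := congrFun hw i
    exact (Submodule.Quotient.mk_eq_zero X).1 this
  rwa [hU] at this

namespace DHecke

variable {F : Type*} [Field F] {u : F} {n : ℕ}

variable (F u n) in
/-- The subalgebra generated by the polynomial generators. -/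
def polySub : Subalgebra F (DHecke F u n) := Algebra.adjoin F (Set.range fun i => gen F u (.y i))

instance : IsMulCommutative (polySub F u n) :=
  Algebra.isMulCommutative_adjoin F (by
    rintro _ ⟨i, rfl⟩ _ ⟨j, rfl⟩; exact gen_y_y F u i j)

theorem gen_s_y' (i : ℕ) (hi : i + 1 < n) :
    gen F u (.s i hi) * gen F u (.y ⟨i + 1, hi⟩)
      = gen F u (.y ⟨i, by omega⟩) * gen F u (.s i hi) + algebraMap F _ u := by
  have h1 := congrArg (fun z => gen F u (.s i hi) * z * gen F u (.s i hi)) (gen_s_y F u i hi)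
  simp only [mul_sub, sub_mul, ← mul_assoc, gen_s_sq, one_mul] at h1
  rw [mul_assoc _ (gen F u (.s i hi)) (gen F u (.s i hi)), gen_s_sq, mul_one,
    ← Algebra.commutes u (gen F u (DGen.s i hi)), mul_assoc, gen_s_sq, mul_one] at h1
  rw [h1]; abel

/-- Polynomials can be moved to the left of a reflection at the cost of a polynomial correction
term, which keeps the span of the products (polynomial)·(permutation) stable under left
multiplication. -/
theorem gen_s_mul_polySub (i : ℕ) (hi : i + 1 < n) (b : DHecke F u n) (hb : b ∈ polySub F u n) :
    ∃ b' ∈ polySub F u n, ∃ b'' ∈ polySub F u n,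
      gen F u (.s i hi) * b = b' * gen F u (.s i hi) + b'' := by
  have hy : ∀ j, gen F u (.y j) ∈ polySub F u n := fun j => Algebra.subset_adjoin ⟨j, rfl⟩
  induction hb using Algebra.adjoin_induction with
  | mem b hb =>
    obtain ⟨j, rfl⟩ := hb
    by_cases h₀ : (j : ℕ) = i
    · subst h₀
      exact ⟨_, hy _, -algebraMap F _ u, neg_mem (Subalgebra.algebraMap_mem _ _), by
        rw [gen_s_y, sub_eq_add_neg]⟩
    by_cases h₁ : (j : ℕ) = i + 1
    · have hj : j = ⟨i + 1, hi⟩ := Fin.ext h₁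
      rw [hj]
      exact ⟨_, hy _, algebraMap F _ u, Subalgebra.algebraMap_mem _ _, gen_s_y' i hi⟩
    · exact ⟨_, hy j, 0, zero_mem _, by simp only [add_zero]; exact gen_s_y_of_ne F u i hi j h₀ h₁⟩
  | algebraMap c =>
    exact ⟨_, Subalgebra.algebraMap_mem _ c, 0, zero_mem _, by rw [add_zero, Algebra.commutes]⟩
  | add b d _ _ hb hd =>
    obtain ⟨b', h1, b'', h2, h3⟩ := hb
    obtain ⟨d', k1, d'', k2, k3⟩ := hd
    exact ⟨b' + d', add_mem h1 k1, b'' + d'', add_mem h2 k2, by rw [mul_add, h3, k3]; noncomm_ring⟩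
  | mul b d hb' hd' hb hd =>
    obtain ⟨b', h1, b'', h2, h3⟩ := hb
    obtain ⟨d', k1, d'', k2, k3⟩ := hd
    refine ⟨b' * d', mul_mem h1 k1, b' * d'' + b'' * d,
      add_mem (mul_mem h1 k2) (mul_mem h2 hd'), ?_⟩
    rw [← mul_assoc, h3, add_mul, mul_assoc, k3]; noncomm_ring

theorem exists_permHom : ∃ T : Equiv.Perm (Fin n) →* DHecke F u n,
    ∀ i hi, T (adj i hi) = gen F u (.s i hi) :=
  exists_perm_hom_monoid (fun i hi => gen F u (.s i hi)) (gen_s_sq F u)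
    (fun i j hi hj hij => gen_s_s F u i j hi hj hij) (gen_braid F u)

/-- Products of polynomials and permutations span the algebra, since their span contains 1 and is
stable under the generators. Only spanning is used, not linear independence. -/
theorem finite_of_isSimpleModule (L : Type*) [AddCommGroup L] [Module F L]
    [Module (DHecke F u n) L] [IsScalarTower F (DHecke F u n) L] [IsSimpleModule (DHecke F u n) L] :
    FiniteDimensional F L := by
  obtain ⟨T, hT⟩ := exists_permHom (F := F) (u := u) (n := n)
  refine finite_of_isSimpleModule_of_comm (polySub F u n)
    (Subalgebra.fg_def.2 ⟨_, Set.finite_range _, rfl⟩) T fun a => ?_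
  set X := Submodule.span F {z | ∃ b ∈ polySub F u n, ∃ w, z = b * T w}
  have h1 : (1 : DHecke F u n) ∈ X := Submodule.subset_span ⟨1, one_mem _, 1, by simp⟩
  suffices h : ∀ x ∈ X, a * x ∈ X by simpa using h 1 h1
  have ha : a ∈ Algebra.adjoin F (Set.range (gen F u (n := n))) := by rw [adjoin_gen]; trivial
  induction ha using Algebra.adjoin_induction with
  | mem a ha =>
    obtain ⟨a, rfl⟩ := ha
    intro x hx
    induction hx using Submodule.span_induction with
    | mem x hx =>
      obtain ⟨b, hb, w, rfl⟩ := hx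
      rw [← mul_assoc]
      cases a with
      | y i => exact Submodule.subset_span ⟨_, mul_mem (Algebra.subset_adjoin ⟨i, rfl⟩) hb, w, rfl⟩
      | s i hi =>
        obtain ⟨b', h1, b'', h2, h3⟩ := gen_s_mul_polySub i hi b hb
        rw [h3, add_mul, mul_assoc, ← hT i hi, ← map_mul]
        exact add_mem (Submodule.subset_span ⟨b', h1, _, rfl⟩)
          (Submodule.subset_span ⟨b'', h2, _, rfl⟩)
    | zero => rw [mul_zero]; exact zero_mem _
    | add x y _ _ hx hy => rw [mul_add]; exact add_mem hx hy
    | smul c x _ hx => rw [mul_smul_comm]; exact X.smul_mem c hx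
  | algebraMap c => intro x hx; rw [← Algebra.smul_def]; exact X.smul_mem c hx
  | add a b _ _ ha hb => intro x hx; rw [add_mul]; exact add_mem (ha x hx) (hb x hx)
  | mul a b _ _ ha hb => intro x hx; rw [mul_assoc]; exact ha _ (hb x hx)

variable (F u n) in
/-- The sum of the polynomial generators. -/
def ySum : DHecke F u n := ∑ i, gen F u (.y i)

/-- In s_i (y_i + y_{i+1}) the two corrections -u and +u cancel. -/
theorem commute_ySum (a : DHecke F u n) : Commute (ySum F u n) a := by
  have ha : a ∈ Algebra.adjoin F (Set.range (gen F u (n := n))) := by rw [adjoin_gen]; trivial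
  induction ha using Algebra.adjoin_induction with
  | mem a ha =>
    obtain ⟨a, rfl⟩ := ha
    cases a with
    | y j => exact Commute.sum_left _ _ _ fun i _ => gen_y_y F u i j
    | s i hi =>
      refine Commute.symm ?_
      have hne : (⟨i, by omega⟩ : Fin n) ≠ ⟨i + 1, hi⟩ := by simp [Fin.ext_iff]
      rw [ySum, ← Finset.add_sum_erase _ _ (Finset.mem_univ (⟨i, by omega⟩ : Fin n)),
        ← Finset.add_sum_erase _ _ (Finset.mem_erase.2 ⟨hne.symm, Finset.mem_univ _⟩), ← add_assoc]
      refine Commute.add_right ?_ (Commute.sum_right _ _ _ fun j hj => ?_)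
      · rw [Commute, SemiconjBy, mul_add, add_mul, gen_s_y, gen_s_y']; abel
      · simp only [Finset.mem_erase, Finset.mem_univ, and_true, ne_eq, Fin.ext_iff] at hj
        exact gen_s_y_of_ne F u i hi j hj.2 hj.1
  | algebraMap c => exact (Algebra.commutes c _).symm
  | add v w _ _ hv hw => exact hv.add_right hw
  | mul v w _ _ hv hw => exact hv.mul_right hw

end DHecke

/-- A central element acts on a finite-dimensional simple module as a scalar. -/
theorem exists_scalar_of_commute {F A L : Type*} [Field F] [IsAlgClosed F] [Ring A] [Algebra F A]
    [AddCommGroup L] [Module F L] [Module A L] [IsScalarTower F A L] [IsSimpleModule A L]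
    [FiniteDimensional F L] (z : A) (hz : ∀ a, Commute z a) : ∃ c : F, ∀ x : L, z • x = c • x := by
  let f : Module.End A L :=
    { toFun := fun x => z • x
      map_add' := smul_add z
      map_smul' := fun a x => by
        rw [RingHom.id_apply, ← mul_smul, ← mul_smul, (hz a).eq] }
  obtain ⟨c, hc⟩ := (IsSimpleModule.algebraMap_end_bijective_of_isAlgClosed (A := A) (V := L) F).2 f
  exact ⟨c, fun x => (congrArg (fun g : Module.End A L => g x) hc).symm⟩

end Finiteness

/-! ### The density theorem and prescribed actions of the group algebra -/

section Density

/-- The density theorem for finitely many pairwise non-isomorphic simple modules. -/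
theorem exists_smul_eq_of_simple {F A ι : Type*} [Field F] [IsAlgClosed F] [Ring A] [Algebra F A]
    [Finite ι] {M : ι → Type*} [∀ i, AddCommGroup (M i)] [∀ i, Module F (M i)]
    [∀ i, Module A (M i)] [∀ i, IsScalarTower F A (M i)] [∀ i, IsSimpleModule A (M i)]
    [∀ i, FiniteDimensional F (M i)] (hM : ∀ i j, i ≠ j → IsEmpty (M i ≃ₗ[A] M j))
    (T : ∀ i, Module.End F (M i)) : ∃ a : A, ∀ i (m : M i), a • m = T i m := by
  classical
  have := Fintype.ofFinite ι
  -- By Schur's lemma, and because the M_i are pairwise non-isomorphic, endomorphisms of the product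
  -- are diagonal with scalar entries. Every tuple of F-linear maps commutes with them, so Jacobson
  -- density applies to it.
  have hg : ∀ (g : Module.End A (∀ i, M i)) (i : ι), ∃ c : F, ∀ v, g v i = c • v i := by
    intro g i
    have h0 : ∀ j, j ≠ i → ∀ x : M j, g (Pi.single j x) i = 0 := by
      intro j hj x
      let f : M j →ₗ[A] M i := LinearMap.proj i ∘ₗ g ∘ₗ LinearMap.single A M j
      rcases f.bijective_or_eq_zero with h | h
      · exact ((hM j i hj).false (LinearEquiv.ofBijective f h)).elim
      · exact congrArg (fun f : M j →ₗ[A] M i => f x) h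
    let f : Module.End A (M i) := LinearMap.proj i ∘ₗ g ∘ₗ LinearMap.single A M i
    obtain ⟨c, hc⟩ :=
      (IsSimpleModule.algebraMap_end_bijective_of_isAlgClosed (A := A) (V := M i) F).2 f
    refine ⟨c, fun v => ?_⟩
    conv_lhs => rw [← Finset.univ_sum_single v, map_sum, Finset.sum_apply]
    rw [Finset.sum_eq_single i (fun j _ hj => h0 j hj _) (by simp)]
    exact (congrArg (fun g : Module.End A (M i) => g (v i)) hc).symm
  let f : Module.End (Module.End A (∀ i, M i)) (∀ i, M i) :=
    { toFun := fun v i => T i (v i)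
      map_add' := fun v w => by ext i; simp
      map_smul' := fun g v => by
        ext i
        obtain ⟨c, hc⟩ := hg g i
        simp only [Module.End.smul_def, RingHom.id_apply, hc, map_smul] }
  let s : Finset (∀ i, M i) := Finset.univ.biUnion fun i =>
    Finset.univ.image fun j => Pi.single i (Module.finBasis F (M i) j)
  obtain ⟨a, ha⟩ := jacobson_density f s
  refine ⟨a, fun i m => ?_⟩
  have key : (Algebra.lsmul F F (M i) a : Module.End F (M i)) = T i := by
    refine (Module.finBasis F (M i)).ext fun j => ?_
    have h := congrFun (ha (Pi.single i (Module.finBasis F (M i) j)) (by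
      simp only [s, Finset.mem_biUnion, Finset.mem_image]
      exact ⟨i, by simp, j, by simp, rfl⟩)) i
    simp only [f, LinearMap.coe_mk, AddHom.coe_mk, Pi.single_eq_same, Pi.smul_apply] at h
    exact h.symm
  exact congrArg (fun g : Module.End F (M i) => g m) key

/-- Burnside's theorem. -/
theorem exists_smul_eq_end {F A M : Type*} [Field F] [IsAlgClosed F] [Ring A] [Algebra F A]
    [AddCommGroup M] [Module F M] [Module A M] [IsScalarTower F A M] [IsSimpleModule A M]
    [FiniteDimensional F M] (T : Module.End F M) : ∃ a : A, ∀ m : M, a • m = T m := by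
  obtain ⟨a, ha⟩ := exists_smul_eq_of_simple (F := F) (A := A) (ι := Unit) (M := fun _ => M)
    (fun i j hij => (hij rfl).elim) (fun _ => T)
  exact ⟨a, ha ()⟩

/-- Density over the group algebra, written with coefficients so that the same element can later be
inserted at any single place of G^n. -/
theorem exists_coeff {F G ι : Type*} [Field F] [IsAlgClosed F] [Group G] [Fintype G] [Finite ι]
    {V : ι → Type*} [∀ k, AddCommGroup (V k)] [∀ k, Module F (V k)]
    [∀ k, FiniteDimensional F (V k)] (ρ : ∀ k, Representation F G (V k))
    [∀ k, (ρ k).IsIrreducible] (hρ : ∀ j k, j ≠ k → IsEmpty ((ρ j).Equiv (ρ k)))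
    (T : ∀ k, Module.End F (V k)) :
    ∃ ε : G → F, ∀ k v, ∑ g, ε g • ρ k g v = T k v := by
  obtain ⟨a, ha⟩ := exists_smul_eq_of_simple (F := F) (A := MonoidAlgebra F G)
    (M := fun k => (ρ k).asModule) (fun i j hij => ⟨fun e => (hρ i j hij).false
      (((Representation.IntertwiningMap.equivLinearMapAsModule (ρ i) (ρ j)).symm
        e.toLinearMap).ofBijective e.bijective)⟩) T
  refine ⟨fun g => a.coeff g, fun k v => ?_⟩
  have h := ha k v
  have h2 := (ρ k).asModuleEquiv_map_smul a v
  rw [h] at h2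
  refine Eq.trans ?_ h2.symm
  rw [Representation.asAlgebraHom_def, MonoidAlgebra.lift_apply, Finsupp.sum_fintype _ _ (by simp)]
  simp [LinearMap.sum_apply]
  rfl

theorem exists_coeff_single {F G V : Type*} [Field F] [IsAlgClosed F] [Group G] [Fintype G]
    [AddCommGroup V] [Module F V] [FiniteDimensional F V] (ρ : Representation F G V)
    [ρ.IsIrreducible] (T : Module.End F V) : ∃ ε : G → F, ∑ g, ε g • ρ g = T := by
  obtain ⟨ε, h⟩ := exists_coeff (ι := Unit) (fun _ => ρ) (fun i j hij => (hij rfl).elim)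
    (fun _ => T)
  exact ⟨ε, LinearMap.ext fun v => by simpa [LinearMap.sum_apply] using h () v⟩

end Density

/-! ### Subspaces of W ⊗ N and the transfer of submodule lattices -/

section TensorLattice

variable {F W N : Type*} [Field F] [AddCommGroup W] [Module F W] [AddCommGroup N] [Module F N]

variable (W) in
/-- The subspace `W ⊗ K` of `W ⊗ N`. -/
def tens (K : Submodule F N) : Submodule F (W ⊗[F] N) := LinearMap.range (K.subtype.lTensor W)

theorem tmul_mem_tens {K : Submodule F N} (w : W) {x : N} (hx : x ∈ K) : w ⊗ₜ[F] x ∈ tens W K :=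
  ⟨w ⊗ₜ ⟨x, hx⟩, rfl⟩

theorem tens_induction {K : Submodule F N} {p : W ⊗[F] N → Prop} (h0 : p 0)
    (hadd : ∀ x y, p x → p y → p (x + y)) (h : ∀ w, ∀ x ∈ K, p (w ⊗ₜ x)) {z : W ⊗[F] N}
    (hz : z ∈ tens W K) : p z := by
  obtain ⟨z, rfl⟩ := hz
  induction z using TensorProduct.induction_on with
  | zero => simpa using h0
  | tmul w x => exact h w x x.2
  | add x y hx hy => rw [map_add]; exact hadd _ _ hx hy

theorem tens_le_iff {K : Submodule F N} {Z : Submodule F (W ⊗[F] N)} :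
    tens W K ≤ Z ↔ ∀ w, ∀ x ∈ K, w ⊗ₜ x ∈ Z :=
  ⟨fun h w _ hx => h (tmul_mem_tens w hx), fun h _ hz =>
    tens_induction Z.zero_mem (fun _ _ => Z.add_mem) h hz⟩

/-- Contraction with a functional that takes the value 1 at w maps W ⊗ K into K and w ⊗ x to x. -/
theorem mem_of_tmul_mem_tens {K : Submodule F N} {w : W} (hw : w ≠ 0) {x : N}
    (h : w ⊗ₜ[F] x ∈ tens W K) : x ∈ K := by
  obtain ⟨φ, hφ⟩ := Module.Projective.exists_dual_eq_one F hw
  have key : ∀ z ∈ tens W K, TensorProduct.lid F N (φ.rTensor N z) ∈ K := by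
    intro z hz
    refine tens_induction (p := fun z => TensorProduct.lid F N (φ.rTensor N z) ∈ K) ?_ ?_ ?_ hz
    · simp
    · intro x y hx hy; rw [map_add, map_add]; exact K.add_mem hx hy
    · intro w x hx; simpa using K.smul_mem _ hx
  simpa [hφ] using key _ h

theorem tens_le_tens_iff [Nontrivial W] {K K' : Submodule F N} :
    tens W K ≤ tens W K' ↔ K ≤ K' := by
  obtain ⟨w, hw⟩ := exists_ne (0 : W)
  exact ⟨fun h x hx => mem_of_tmul_mem_tens hw (h (tmul_mem_tens w hx)),
    fun h => tens_le_iff.2 fun w x hx => tmul_mem_tens w (h hx)⟩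

/-- The largest subspace `K` with `W ⊗ K ≤ Z`. -/
def untens (Z : Submodule F (W ⊗[F] N)) : Submodule F N where
  carrier := {x | ∀ w : W, w ⊗ₜ x ∈ Z}
  add_mem' hx hy w := by rw [TensorProduct.tmul_add]; exact Z.add_mem (hx w) (hy w)
  zero_mem' w := by rw [TensorProduct.tmul_zero]; exact Z.zero_mem
  smul_mem' c x hx w := by rw [TensorProduct.tmul_smul]; exact Z.smul_mem c (hx w)

/-- A subspace of `W ⊗ N` that is stable under `End(W) ⊗ 1` has the form `W ⊗ K`. -/
theorem tens_untens [FiniteDimensional F W] (Z : Submodule F (W ⊗[F] N))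
    (hZ : ∀ T : Module.End F W, ∀ z ∈ Z, T.rTensor N z ∈ Z) : tens W (untens Z) = Z := by
  refine le_antisymm (tens_le_iff.2 fun w x hx => hx w) fun z hz => ?_
  let b := Module.finBasis F W
  have hsum : ∀ z : W ⊗[F] N,
      z = ∑ i, b i ⊗ₜ TensorProduct.lid F N ((b.coord i).rTensor N z) := by
    intro z
    induction z using TensorProduct.induction_on with
    | zero => simp
    | tmul w x =>
      simp only [LinearMap.rTensor_tmul, TensorProduct.lid_tmul, TensorProduct.tmul_smul]
      simp [TensorProduct.smul_tmul', ← TensorProduct.sum_tmul, b.sum_repr]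
    | add x y hx hy =>
      conv_lhs => rw [hx, hy]
      simp only [map_add, TensorProduct.tmul_add, Finset.sum_add_distrib]
  rw [hsum z]
  refine Submodule.sum_mem _ fun i _ => tmul_mem_tens _ fun w => ?_
  -- Replacing b_i by an arbitrary w in the i-th term of the expansion of z is the action of a
  -- rank-one endomorphism of W, under which the subspace is stable.
  have h1 : ∀ z : W ⊗[F] N, w ⊗ₜ TensorProduct.lid F N ((b.coord i).rTensor N z)
      = ((b.coord i).smulRight w).rTensor N z := by
    intro z
    induction z using TensorProduct.induction_on with
    | zero => simp
    | tmul v x => simp [TensorProduct.smul_tmul']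
    | add x y hx hy => simp only [map_add, TensorProduct.tmul_add, hx, hy]
  rw [h1]
  exact hZ _ z hz

end TensorLattice

section TensorLattice

variable {F W N Z A B : Type*} [Field F] [AddCommGroup W] [Module F W] [AddCommGroup N] [Module F N]
  [AddCommGroup Z] [Module F Z] [Ring A] [Algebra F A] [Ring B] [Algebra F B] [Module A Z]
  [IsScalarTower F A Z] [Module B N] [IsScalarTower F B N]

/-- If `Z ≅ W ⊗ N` and the `A`-submodules of `Z` are the subspaces `W ⊗ K` for `B`-submodules `K`,
then these lattices of submodules are isomorphic. -/
theorem exists_orderIso_tens [FiniteDimensional F W] [Nontrivial W] (Φ : Z ≃ₗ[F] W ⊗[F] N)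
    (h₁ : ∀ (K : Submodule B N) (a : A) (z : Z),
      Φ z ∈ tens W (K.restrictScalars F) → Φ (a • z) ∈ tens W (K.restrictScalars F))
    (h₂ : ∀ (Y : Submodule A Z) (T : Module.End F W) (z : Z),
      z ∈ Y → Φ.symm (T.rTensor N (Φ z)) ∈ Y)
    (h₃ : ∀ (Y : Submodule A Z) (x : N), (∀ w, Φ.symm (w ⊗ₜ x) ∈ Y) →
      ∀ (b : B) (w : W), Φ.symm (w ⊗ₜ (b • x)) ∈ Y) :
    ∃ e : Submodule A Z ≃o Submodule B N, ∀ Y x, x ∈ e Y ↔ ∀ w, Φ.symm (w ⊗ₜ x) ∈ Y := by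
  let f : Submodule B N → Submodule A Z := fun K =>
    { (tens W (K.restrictScalars F)).comap (Φ : Z →ₗ[F] W ⊗[F] N) with
      smul_mem' := fun a z hz => h₁ K a z hz }
  have hf : ∀ K z, z ∈ f K ↔ Φ z ∈ tens W (K.restrictScalars F) := fun K z => Iff.rfl
  have hle : ∀ K K', f K ≤ f K' ↔ K ≤ K' := by
    intro K K'
    rw [← Submodule.restrictScalars_le (S := F) (s := K), ← tens_le_tens_iff (W := W)]
    refine ⟨fun h z hz => ?_, fun h z hz => h hz⟩
    have := h ((hf K (Φ.symm z)).2 (by simpa using hz))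
    simpa [hf] using this
  -- Stability under End(W) (`h₂`) forces Y to have the form W ⊗ K, and `h₃` makes K a B-submodule.
  have hsurj : ∀ Y, ∃ K, f K = Y := by
    intro Y
    let Y' : Submodule F (W ⊗[F] N) := (Y.restrictScalars F).comap (Φ.symm : W ⊗[F] N →ₗ[F] Z)
    have hY' : ∀ z, z ∈ Y' ↔ Φ.symm z ∈ Y := fun z => Iff.rfl
    let K : Submodule B N := { untens Y' with smul_mem' := fun b x hx w => h₃ Y x hx b w }
    have hK : K.restrictScalars F = untens Y' := rfl
    refine ⟨K, ?_⟩
    ext z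
    rw [hf, hK, tens_untens Y' fun T z hz => ?_, hY', Φ.symm_apply_apply]
    have := h₂ Y T (Φ.symm z) hz
    rwa [Φ.apply_symm_apply] at this
  let e : Submodule B N ≃o Submodule A Z :=
    { Equiv.ofBijective f ⟨fun K K' h => le_antisymm ((hle _ _).1 h.le) ((hle _ _).1 h.ge), hsurj⟩ with
      map_rel_iff' := fun {K K'} => hle K K' }
  refine ⟨e.symm, fun Y x => ?_⟩
  obtain ⟨K, rfl⟩ := e.surjective Y
  rw [e.symm_apply_apply]
  change _ ↔ ∀ w, Φ.symm (w ⊗ₜ x) ∈ f K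
  simp only [hf, Φ.apply_symm_apply]
  obtain ⟨w, hw⟩ := exists_ne (0 : W)
  exact ⟨fun h w => tmul_mem_tens w h, fun h => mem_of_tmul_mem_tens hw (h w)⟩

end TensorLattice

theorem isSimpleModule_of_orderIso {A B M N : Type*} [Ring A] [Ring B] [AddCommGroup M]
    [AddCommGroup N] [Module A M] [Module B N] (e : Submodule A M ≃o Submodule B N)
    [h : IsSimpleModule B N] : IsSimpleModule A M := by
  rw [isSimpleModule_iff] at h ⊢
  exact e.isSimpleOrder

theorem isSemisimpleModule_of_orderIso {A B M N : Type*} [Ring A] [Ring B] [AddCommGroup M]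
    [AddCommGroup N] [Module A M] [Module B N] (e : Submodule A M ≃o Submodule B N)
    [h : IsSemisimpleModule B N] : IsSemisimpleModule A M := by
  rw [isSemisimpleModule_iff] at h ⊢
  exact e.complementedLattice_iff.2 h

/-! ### Endomorphisms of a tensor product of several spaces -/

section PiTensor

variable {F ι : Type*} [Field F] [Finite ι] {M : ι → Type*} [∀ i, AddCommGroup (M i)]
  [∀ i, Module F (M i)] [∀ i, FiniteDimensional F (M i)]

/-- Rank-one operators span, and a rank-one operator given by a dual basis vector and a pure tensor
is a tensor product of rank-one operators. This extends Burnside's theorem from the factors to the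
tensor product. -/
theorem span_piTensorProduct_map :
    Submodule.span F (Set.range (PiTensorProduct.map (R := F) (s := M) (t := M))) = ⊤ := by
  classical
  have := Fintype.ofFinite ι
  refine eq_top_iff.2 fun T _ => ?_
  set X := Submodule.span F (Set.range (PiTensorProduct.map (R := F) (s := M) (t := M)))
  let b := fun i => Module.finBasis F (M i)
  let B := Basis.piTensorProduct b
  have h1 : ∀ p (w : ⨂[F] i, M i), (B.coord p).smulRight w ∈ X := by
    intro p w
    have hw : w ∈ Submodule.span F (Set.range (PiTensorProduct.tprod F (s := M))) := by
      rw [PiTensorProduct.span_tprod_eq_top]; trivial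
    induction hw using Submodule.span_induction with
    | mem w hw =>
      obtain ⟨m, rfl⟩ := hw
      refine Submodule.subset_span ⟨fun i => ((b i).coord (p i)).smulRight (m i), ?_⟩
      ext v
      simp only [LinearMap.compMultilinearMap_apply, PiTensorProduct.map_tprod,
        LinearMap.smulRight_apply, Module.Basis.coord_apply, B, Basis.piTensorProduct_repr_tprod_apply]
      rw [MultilinearMap.map_smul_univ]
    | zero => simp
    | add x y _ _ hx hy =>
      convert X.add_mem hx hy using 1
      ext; simp
    | smul c x _ hx =>
      convert X.smul_mem c hx using 1
      ext; simp [smul_smul, mul_comm]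
  have h2 : T = ∑ p, (B.coord p).smulRight (T (B p)) := by
    refine LinearMap.ext fun z => ?_
    rw [LinearMap.sum_apply]
    conv_lhs => rw [← B.sum_repr z, map_sum]
    exact Finset.sum_congr rfl fun p _ => map_smul _ _ _
  rw [h2]
  exact Submodule.sum_mem _ fun p _ => h1 p _

end PiTensor

/-! ### Generators of the Young subalgebra by positions, and block idempotents -/

section Positions

variable (F : Type*) [Field F] {G : Type*} [Group G] [Fintype G] {r : ℕ} {c : Fin r → ℕ}

/-- The positions of a composition: the `j`-th place of the `k`-th block. -/
abbrev Pos {r : ℕ} (c : Fin r → ℕ) : Type := (k : Fin r) × Fin (c k)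

theorem pos_ext_iff {p q : Pos c} : p = q ↔ p.1 = q.1 ∧ (p.2 : ℕ) = q.2 := by
  obtain ⟨k, i⟩ := p
  obtain ⟨l, j⟩ := q
  constructor
  · rintro h; cases h; exact ⟨rfl, rfl⟩
  · rintro ⟨h, h'⟩
    obtain rfl : k = l := h
    obtain rfl : i = j := Fin.ext h'
    rfl

/-- The element `b ∈ G^{n_1} × ... × G^{n_r}` of `H_{n_1}(G) ⊗ ... ⊗ H_{n_r}(G)`. -/
def gP (b : Pos c → G) : ⨂[F] k, WHecke F G (c k) :=
  PiTensorProduct.tprod F fun k => WHecke.gen F (.g fun j => b ⟨k, j⟩)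

variable (G) in
/-- The polynomial generator of `H_{n_1}(G) ⊗ ... ⊗ H_{n_r}(G)` at a position. -/
def xP (p : Pos c) : ⨂[F] k, WHecke F G (c k) :=
  PiTensorProduct.singleAlgHom (A := fun k => WHecke F G (c k)) p.1 (WHecke.gen F (.x p.2))

variable (G) in
/-- The simple reflection of `H_{n_1}(G) ⊗ ... ⊗ H_{n_r}(G)` that exchanges a position with the next
position of the same block. -/
def sP (k : Fin r) (j : ℕ) (hj : j + 1 < c k) : ⨂[F] k, WHecke F G (c k) :=
  PiTensorProduct.singleAlgHom (A := fun k => WHecke F G (c k)) k (WHecke.gen F (.s j hj))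

variable {F}

theorem single_commute {j k : Fin r} (h : j ≠ k) (u : WHecke F G (c j)) (v : WHecke F G (c k)) :
    Commute (PiTensorProduct.singleAlgHom (R := F) (A := fun k => WHecke F G (c k)) j u)
      (PiTensorProduct.singleAlgHom (R := F) (A := fun k => WHecke F G (c k)) k v) := by
  simp only [Commute, SemiconjBy, PiTensorProduct.singleAlgHom_apply,
    PiTensorProduct.tprod_mul_tprod, MonoidHom.mulSingle_apply]
  exact congrArg _ (Pi.mulSingle_commute (f := fun k => WHecke F G (c k)) h u v).eq

theorem gP_one : gP F (1 : Pos c → G) = 1 := by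
  have : (fun k => WHecke.gen F (.g fun j : Fin (c k) => (1 : Pos c → G) ⟨k, j⟩)) = 1 :=
    funext fun k => WHecke.gen_g_one
  rw [gP, this]; rfl

theorem gP_mul (a b : Pos c → G) : gP F (a * b) = gP F a * gP F b := by
  rw [gP, gP, gP, PiTensorProduct.tprod_mul_tprod]
  congr 1
  exact funext fun k => WHecke.gen_g_mul _ _

theorem gP_eq_single (k : Fin r) (b : Pos c → G) (hb : ∀ l, l ≠ k → ∀ j, b ⟨l, j⟩ = 1) :
    gP F b = PiTensorProduct.singleAlgHom (R := F) (A := fun k => WHecke F G (c k)) k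
      (WHecke.gen F (.g fun j => b ⟨k, j⟩)) := by
  rw [gP, PiTensorProduct.singleAlgHom_apply, MonoidHom.mulSingle_apply]
  congr 1
  ext l
  by_cases h : l = k
  · subst h; simp
  · rw [Pi.mulSingle_eq_of_ne h, ← WHecke.gen_g_one]
    congr 2
    ext j
    exact hb l h j

theorem gP_mulSingle (p : Pos c) (h : G) :
    gP F (Pi.mulSingle p h) = PiTensorProduct.singleAlgHom (R := F) (A := fun k => WHecke F G (c k))
      p.1 (WHecke.gen F (.g (Pi.mulSingle p.2 h))) := by
  rw [gP_eq_single p.1]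
  · congr 3
    ext j
    simp only [Pi.mulSingle_apply, pos_ext_iff, true_and, Fin.ext_iff]
  · intro l hl j
    exact Pi.mulSingle_eq_of_ne (fun h => hl (congrArg Sigma.fst h)) _

theorem xP_mul_xP (p q : Pos c) : xP F G p * xP F G q = xP F G q * xP F G p := by
  obtain ⟨k, i⟩ := p
  obtain ⟨l, j⟩ := q
  by_cases h : k = l
  · subst h
    simp only [xP, ← map_mul, WHecke.gen_x_x i j]
  · exact single_commute h _ _

theorem single_mul_gP (k : Fin r) (u : WHecke F G (c k)) (b b' : Pos c → G)
    (hk : u * WHecke.gen F (.g fun j => b ⟨k, j⟩) = WHecke.gen F (.g fun j => b' ⟨k, j⟩) * u)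
    (hl : ∀ l, l ≠ k → ∀ j, b ⟨l, j⟩ = b' ⟨l, j⟩) :
    PiTensorProduct.singleAlgHom (R := F) (A := fun k => WHecke F G (c k)) k u * gP F b
      = gP F b' * PiTensorProduct.singleAlgHom (R := F) (A := fun k => WHecke F G (c k)) k u := by
  rw [gP, gP, PiTensorProduct.singleAlgHom_apply, MonoidHom.mulSingle_apply,
    PiTensorProduct.tprod_mul_tprod, PiTensorProduct.tprod_mul_tprod]
  congr 1
  ext l
  simp only [Pi.mul_apply]
  by_cases h : l = k
  · subst h; simpa using hk
  · rw [Pi.mulSingle_eq_of_ne h, one_mul, mul_one]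
    congr 2
    ext j
    exact hl l h j

theorem xP_mul_gP (p : Pos c) (b : Pos c → G) : xP F G p * gP F b = gP F b * xP F G p :=
  single_mul_gP _ _ _ _ (WHecke.gen_x_g _ _) fun _ _ _ => rfl

theorem sP_mul_self (k : Fin r) (j : ℕ) (hj : j + 1 < c k) : sP F G k j hj * sP F G k j hj = 1 := by
  rw [sP, ← map_mul, WHecke.gen_s_sq, map_one]

theorem sP_comm (k : Fin r) (i j : ℕ) (hi : i + 1 < c k) (hj : j + 1 < c k) (hij : i + 1 < j) :
    sP F G k i hi * sP F G k j hj = sP F G k j hj * sP F G k i hi := by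
  simp only [sP, ← map_mul, WHecke.gen_s_s i j hi hj hij]

theorem sP_comm_of_ne {k l : Fin r} (h : k ≠ l) (i j : ℕ) (hi : i + 1 < c k) (hj : j + 1 < c l) :
    sP F G k i hi * sP F G l j hj = sP F G l j hj * sP F G k i hi := single_commute h _ _

theorem sP_braid (k : Fin r) (j : ℕ) (hj : j + 1 < c k) (hj' : j + 1 + 1 < c k) :
    sP F G k j hj * sP F G k (j + 1) hj' * sP F G k j hj
      = sP F G k (j + 1) hj' * sP F G k j hj * sP F G k (j + 1) hj' := by
  simp only [sP, ← map_mul, WHecke.gen_braid j hj hj']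

theorem sP_mul_xP (k : Fin r) (j : ℕ) (hj : j + 1 < c k) :
    sP F G k j hj * xP F G ⟨k, ⟨j, by omega⟩⟩ = xP F G ⟨k, ⟨j + 1, hj⟩⟩ * sP F G k j hj
      - ∑ h : G, gP F (Pi.mulSingle (⟨k, ⟨j, by omega⟩⟩ : Pos c) h
          * Pi.mulSingle (⟨k, ⟨j + 1, hj⟩⟩ : Pos c) h⁻¹) := by
  simp only [sP, xP, ← map_mul, WHecke.gen_s_x j hj, map_sub, map_sum, gP_mul, gP_mulSingle,
    WHecke.gen_g_mul]

theorem sP_mul_xP_of_ne (k : Fin r) (j : ℕ) (hj : j + 1 < c k) (p : Pos c)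
    (h₀ : p ≠ ⟨k, ⟨j, by omega⟩⟩) (h₁ : p ≠ ⟨k, ⟨j + 1, hj⟩⟩) :
    sP F G k j hj * xP F G p = xP F G p * sP F G k j hj := by
  obtain ⟨l, i⟩ := p
  by_cases h : k = l
  · subst h
    simp only [pos_ext_iff, true_and, ne_eq] at h₀ h₁
    simp only [sP, xP, ← map_mul, WHecke.gen_s_x_of_ne j hj i h₀ h₁]
  · exact single_commute h _ _

theorem sP_mul_gP (k : Fin r) (j : ℕ) (hj : j + 1 < c k) (b : Pos c → G) :
    sP F G k j hj * gP F b
      = gP F (b ∘ Equiv.swap (⟨k, ⟨j, by omega⟩⟩ : Pos c) ⟨k, ⟨j + 1, hj⟩⟩) * sP F G k j hj := by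
  refine single_mul_gP _ _ _ _ ?_ fun l hl i => ?_
  · rw [WHecke.gen_s_g]
    congr 3
    ext i
    simp only [Function.comp_apply, Equiv.swap_inv, Equiv.swap_apply_def, pos_ext_iff, true_and,
      Fin.ext_iff]
    split_ifs <;> rfl
  · simp only [Function.comp_apply]
    rw [Equiv.swap_apply_of_ne_of_ne] <;> · intro h; exact hl (congrArg Sigma.fst h)

variable (c) in
/-- `H_{n_1}(G) ⊗ ... ⊗ H_{n_r}(G)` is generated by the elements of `G` at single positions and by
the `x_p` and `s_p`. -/
theorem adjoin_positions : Algebra.adjoin F ({z | ∃ (p : Pos c) (h : G), z = gP F (Pi.mulSingle p h)}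
    ∪ {z | ∃ p : Pos c, z = xP F G p} ∪ {z | ∃ k j hj, z = sP F G (c := c) k j hj}) = ⊤ := by
  rw [eq_top_iff]
  set S := Algebra.adjoin F ({z | ∃ (p : Pos c) (h : G), z = gP F (Pi.mulSingle p h)}
    ∪ {z | ∃ p : Pos c, z = xP F G p} ∪ {z | ∃ k j hj, z = sP F G (c := c) k j hj})
  have h1 : ∀ k (u : WHecke F G (c k)),
      PiTensorProduct.singleAlgHom (R := F) (A := fun k => WHecke F G (c k)) k u ∈ S := by
    intro k u
    have hg : ∀ a : Fin (c k) → G,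
        PiTensorProduct.singleAlgHom (R := F) (A := fun k => WHecke F G (c k)) k
          (WHecke.gen F (.g a)) ∈ S := by
      intro a
      let T : Submonoid (Fin (c k) → G) :=
        { carrier := {a | PiTensorProduct.singleAlgHom (R := F) (A := fun k => WHecke F G (c k)) k
            (WHecke.gen F (.g a)) ∈ S}
          one_mem' := by
            rw [Set.mem_ofPred_eq, WHecke.gen_g_one, map_one]; exact one_mem S
          mul_mem' := fun {a b} ha hb => by
            rw [Set.mem_ofPred_eq, WHecke.gen_g_mul, map_mul]; exact mul_mem ha hb }
      have hT : a ∈ T := Submonoid.pi_mem_of_mulSingle_mem a fun j => by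
        refine Algebra.subset_adjoin (Or.inl (Or.inl ⟨⟨k, j⟩, a j, ?_⟩))
        rw [gP_mulSingle]
      exact hT
    have hu : u ∈ Algebra.adjoin F (Set.range (WHecke.gen F (G := G) (n := c k))) := by
      rw [WHecke.adjoin_gen]; trivial
    induction hu using Algebra.adjoin_induction with
    | mem u hu =>
      obtain ⟨a, rfl⟩ := hu
      cases a with
      | g a => exact hg a
      | x i => exact Algebra.subset_adjoin (Or.inl (Or.inr ⟨⟨k, i⟩, rfl⟩))
      | s i hi => exact Algebra.subset_adjoin (Or.inr ⟨k, i, hi, rfl⟩)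
    | algebraMap c => rw [AlgHom.commutes]; exact Subalgebra.algebraMap_mem _ c
    | add v w _ _ hv hw => rw [map_add]; exact add_mem hv hw
    | mul v w _ _ hv hw => rw [map_mul]; exact mul_mem hv hw
  intro z _
  induction z using PiTensorProduct.induction_on with
  | smul_tprod t u =>
    refine S.smul_mem ?_ t
    let T : Submonoid (∀ k, WHecke F G (c k)) :=
      S.toSubmonoid.comap (PiTensorProduct.tprodMonoidHom F)
    have hT : u ∈ T := Submonoid.pi_mem_of_mulSingle_mem u fun k => h1 k (u k)
    exact hT
  | add x y hx hy => exact add_mem (hx trivial) (hy trivial)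

/-- To prove a property of the action of all elements of `H_{n_1}(G) ⊗ ... ⊗ H_{n_r}(G)`, it
suffices to treat generators. -/
theorem pos_induction {p : (⨂[F] k, WHecke F G (c k)) → Prop}
    (hg : ∀ q h, p (gP F (Pi.mulSingle q h))) (hx : ∀ q, p (xP F G q))
    (hs : ∀ k j hj, p (sP F G k j hj)) (hc : ∀ t, p (algebraMap F _ t))
    (hadd : ∀ a b, p a → p b → p (a + b)) (hmul : ∀ a b, p a → p b → p (a * b))
    (b : ⨂[F] k, WHecke F G (c k)) : p b := by
  have hb : b ∈ Algebra.adjoin F ({z | ∃ (p : Pos c) (h : G), z = gP F (Pi.mulSingle p h)}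
    ∪ {z | ∃ p : Pos c, z = xP F G p} ∪ {z | ∃ k j hj, z = sP F G (c := c) k j hj}) := by
    rw [adjoin_positions]; trivial
  induction hb using Algebra.adjoin_induction with
  | mem z hz =>
    rcases hz with (⟨q, h, rfl⟩ | ⟨q, rfl⟩) | ⟨k, j, hj, rfl⟩
    exacts [hg q h, hx q, hs k j hj]
  | algebraMap t => exact hc t
  | add v w _ _ hv hw => exact hadd _ _ hv hw
  | mul v w _ _ hv hw => exact hmul _ _ hv hw

section youngHom

variable {n : ℕ} (hc : ∑ k, c k = n)

/-- The place of a position, when the blocks are put next to each other. -/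
def basePlace (hc : ∑ k, c k = n) (p : Pos c) : Fin n :=
  ⟨offset c p.1 + p.2, by have := offset_add_le c hc p.1; omega⟩

theorem youngHom_gP_mulSingle (p : Pos c) (h : G) :
    youngHom F G c hc (gP F (Pi.mulSingle p h))
      = WHecke.gen F (.g (Pi.mulSingle (basePlace hc p) h)) := by
  rw [gP_mulSingle, youngHom_single, block_gen, shiftGen, extG_mulSingle (offset_add_le c hc p.1)]
  rfl

theorem youngHom_xP (p : Pos c) :
    youngHom F G c hc (xP F G p) = WHecke.gen F (.x (basePlace hc p)) := by
  rw [xP, youngHom_single, block_gen, shiftGen]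
  rfl

theorem youngHom_sP (k : Fin r) (j : ℕ) (hj : j + 1 < c k) :
    youngHom F G c hc (sP F G k j hj) = WHecke.gen F (.s (offset c k + j)
      (by have := offset_add_le c hc k; omega)) := by
  rw [sP, youngHom_single, block_gen, shiftGen]

end youngHom

section Isotypic

variable (E : Type*) [AddCommGroup E] [Module F E] [Module (⨂[F] k, WHecke F G (c k)) E]
  [IsScalarTower F (⨂[F] k, WHecke F G (c k)) E]

/-- The coefficients `ε_l` give elements of the group algebra of `G` which act at positions of the
`l`-th block as the identity and at other positions as zero. -/
def IsBlockIdempotent (ε : Fin r → G → F) : Prop :=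
  ∀ l (p : Pos c) (v : E), ∑ g, ε l g • gP F (Pi.mulSingle p g) • v = if p.1 = l then v else 0

variable {E}

/-- The substitution h ↦ g h turns g at p times the sum into the sum times g at q. So the idempotent
of the block of p, which is the identity at p, can be moved to q, where it is zero. This is why no
correction terms occur between different blocks. -/
theorem IsBlockIdempotent.sum_cross {ε : Fin r → G → F} (hε : IsBlockIdempotent (c := c) E ε)
    {p q : Pos c} (hpq : p.1 ≠ q.1) (v : E) :
    ∑ h : G, gP F (Pi.mulSingle p h * Pi.mulSingle q h⁻¹ : Pos c → G) • v = 0 := by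
  have h1 := hε p.1 p (∑ h : G, gP F (Pi.mulSingle p h * Pi.mulSingle q h⁻¹ : Pos c → G) • v)
  rw [if_pos rfl] at h1
  rw [← h1]
  have h2 : ∀ g, ε p.1 g • gP F (Pi.mulSingle p g)
        • ∑ h : G, gP F (Pi.mulSingle p h * Pi.mulSingle q h⁻¹ : Pos c → G) • v
      = ∑ h : G, gP F (Pi.mulSingle p h * Pi.mulSingle q h⁻¹ : Pos c → G)
          • ε p.1 g • gP F (Pi.mulSingle q g) • v := by
    intro g
    rw [Finset.smul_sum, Finset.smul_sum]
    refine Fintype.sum_equiv (Equiv.mulLeft g) _ _ fun h => ?_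
    rw [smul_comm _ (ε p.1 g), ← mul_smul, ← mul_smul, ← gP_mul, ← gP_mul, ← mul_assoc,
      ← Pi.mulSingle_mul, mul_assoc, ← Pi.mulSingle_mul]
    simp
  rw [Finset.sum_congr rfl fun g _ => h2 g, Finset.sum_comm]
  refine Finset.sum_eq_zero fun h _ => ?_
  rw [← Finset.smul_sum, hε p.1 q v, if_neg (Ne.symm hpq), smul_zero]

end Isotypic

end Positions

/-! ### Shuffles, viewed as words in the blocks -/

section Shuffles

variable {r : ℕ} {c : Fin r → ℕ} {n : ℕ}

/-- The shuffles of type `c`: the bijections from the positions of `c` to `{0, ..., n - 1}` that are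
increasing on each block. -/
abbrev Shuffle {r : ℕ} (c : Fin r → ℕ) (n : ℕ) : Type :=
  {w : Pos c ≃ Fin n // ∀ k, StrictMono fun j : Fin (c k) => w ⟨k, j⟩}

namespace Shuffle

/-- The block to which a place belongs. -/
def letter (w : Shuffle c n) (i : Fin n) : Fin r := (w.1.symm i).1

theorem letter_apply (w : Shuffle c n) (p : Pos c) : w.letter (w.1 p) = p.1 := by
  simp [letter]

theorem lt_iff (w : Shuffle c n) {p q : Pos c} (h : p.1 = q.1) :
    w.1 p < w.1 q ↔ (p.2 : ℕ) < q.2 := by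
  obtain ⟨k, i⟩ := p
  obtain ⟨l, j⟩ := q
  obtain rfl : k = l := h
  exact (w.2 k).lt_iff_lt

/-- Exchange two adjacent places of different blocks. -/
def swap (w : Shuffle c n) (i : ℕ) (hi : i + 1 < n)
    (h : w.letter ⟨i, by omega⟩ ≠ w.letter ⟨i + 1, hi⟩) : Shuffle c n :=
  ⟨w.1.trans (adj i hi), fun k a b hab => by
    have h1 : w.1 ⟨k, a⟩ < w.1 ⟨k, b⟩ := w.2 k hab
    have h2 : ¬ (w.1 ⟨k, a⟩ = ⟨i, by omega⟩ ∧ w.1 ⟨k, b⟩ = ⟨i + 1, hi⟩) := by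
      rintro ⟨ha, hb⟩
      rw [← ha, ← hb, letter_apply, letter_apply] at h
      exact h rfl
    change adj i hi (w.1 ⟨k, a⟩) < adj i hi (w.1 ⟨k, b⟩)
    simp only [Equiv.swap_apply_def]
    simp only [Fin.ext_iff, Fin.lt_def] at h1 h2 ⊢
    split_ifs <;> (try simp only) <;> omega⟩

theorem letter_swap (w : Shuffle c n) (i : ℕ) (hi : i + 1 < n)
    (h : w.letter ⟨i, by omega⟩ ≠ w.letter ⟨i + 1, hi⟩) (j : Fin n) :
    (w.swap i hi h).letter j = w.letter (adj i hi j) := by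
  simp [letter, swap]

theorem symm_swap (w : Shuffle c n) (i : ℕ) (hi : i + 1 < n)
    (h : w.letter ⟨i, by omega⟩ ≠ w.letter ⟨i + 1, hi⟩) (j : Fin n) :
    (w.swap i hi h).1.symm j = w.1.symm (adj i hi j) := by
  simp [swap]

/-- Two adjacent places of the same block are occupied by two adjacent positions. -/
theorem exists_of_letter_eq (w : Shuffle c n) (i : ℕ) (hi : i + 1 < n)
    (h : w.letter ⟨i, by omega⟩ = w.letter ⟨i + 1, hi⟩) :
    ∃ (k : Fin r) (j : ℕ) (hj : j + 1 < c k),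
      w.1 ⟨k, ⟨j, by omega⟩⟩ = ⟨i, by omega⟩ ∧ w.1 ⟨k, ⟨j + 1, hj⟩⟩ = ⟨i + 1, hi⟩ := by
  obtain ⟨⟨k, a⟩, ha⟩ := w.1.surjective ⟨i, by omega⟩
  obtain ⟨⟨l, b⟩, hb⟩ := w.1.surjective ⟨i + 1, hi⟩
  rw [← ha, ← hb, letter_apply, letter_apply] at h
  obtain rfl : k = l := h
  have hab : a < b := (w.2 k).lt_iff_lt.1 (by
    change w.1 ⟨k, a⟩ < w.1 ⟨k, b⟩
    rw [ha, hb, Fin.lt_def]; simp)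
  have hab' : (a : ℕ) + 1 = b := by
    by_contra hne
    have h1 : w.1 ⟨k, a⟩ < w.1 ⟨k, ⟨a + 1, by omega⟩⟩ := w.2 k (by rw [Fin.lt_def]; simp)
    have h2 : w.1 ⟨k, ⟨a + 1, by omega⟩⟩ < w.1 ⟨k, b⟩ := w.2 k (by
      rw [Fin.lt_def] at hab ⊢; simp only; omega)
    rw [ha, Fin.lt_def] at h1
    rw [hb, Fin.lt_def] at h2
    simp only at h1 h2
    omega
  obtain ⟨b, hb'⟩ := b
  obtain rfl : (a : ℕ) + 1 = b := hab'
  exact ⟨k, a, hb', ha, hb⟩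

/-- A strictly increasing map is determined by its range, and the range of the k-th block is the set
of places with letter k. Hence a shuffle is determined by its word. -/
theorem ext_letter {w w' : Shuffle c n} (h : ∀ i, w.letter i = w'.letter i) : w = w' := by
  have hr : ∀ (v : Shuffle c n) k, Set.range (fun j => v.1 ⟨k, j⟩) = {i | v.letter i = k} := by
    intro v k
    ext i
    constructor
    · rintro ⟨j, rfl⟩
      exact letter_apply v _
    · intro hi
      obtain ⟨⟨l, j⟩, rfl⟩ := v.1.surjective i
      obtain rfl : l = k := by simpa [letter_apply] using hi
      exact ⟨j, rfl⟩
  refine Subtype.ext (Equiv.ext fun ⟨k, j⟩ => ?_)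
  refine congrFun (((w.2 k).range_inj (w'.2 k)).1 ?_) j
  rw [hr, hr]
  simp [h]

theorem adj_left (i : ℕ) (hi : i + 1 < n) : adj i hi (⟨i, by omega⟩ : Fin n) = ⟨i + 1, hi⟩ :=
  Equiv.swap_apply_left _ _

theorem adj_right (i : ℕ) (hi : i + 1 < n) : adj i hi (⟨i + 1, hi⟩ : Fin n) = ⟨i, by omega⟩ :=
  Equiv.swap_apply_right _ _

theorem adj_of_ne (i : ℕ) (hi : i + 1 < n) (j : Fin n) (h₀ : (j : ℕ) ≠ i) (h₁ : (j : ℕ) ≠ i + 1) :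
    adj i hi j = j :=
  Equiv.swap_apply_of_ne_of_ne (fun h => h₀ (congrArg Fin.val h)) (fun h => h₁ (congrArg Fin.val h))

theorem swap_swap (w : Shuffle c n) (i : ℕ) (hi : i + 1 < n)
    (h : w.letter ⟨i, by omega⟩ ≠ w.letter ⟨i + 1, hi⟩) (h') :
    (w.swap i hi h).swap i hi h' = w := by
  refine Subtype.ext (Equiv.ext fun p => ?_)
  simp [swap]

theorem letter_swap_ne (w : Shuffle c n) (i : ℕ) (hi : i + 1 < n)
    (h : w.letter ⟨i, by omega⟩ ≠ w.letter ⟨i + 1, hi⟩) :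
    (w.swap i hi h).letter ⟨i, by omega⟩ ≠ (w.swap i hi h).letter ⟨i + 1, hi⟩ := by
  rw [letter_swap, letter_swap, adj_left, adj_right]; exact h.symm

/-- The shuffle that puts the blocks next to each other. -/
def base (hc : ∑ k, c k = n) : Shuffle c n :=
  ⟨Equiv.ofBijective (basePlace hc) ((Fintype.bijective_iff_injective_and_card _).2 ⟨by
      rintro ⟨k, i⟩ ⟨l, j⟩ h
      have h := congrArg Fin.val h
      simp only [basePlace] at h
      rcases lt_trichotomy k l with hkl | rfl | hkl
      · have := offset_add_le_offset c hkl; omega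
      · rw [pos_ext_iff]; exact ⟨rfl, by simpa using h⟩
      · have := offset_add_le_offset c hkl; omega, by simp [hc]⟩),
    fun k i j h => by
      simp only [Equiv.ofBijective_apply, basePlace, Fin.lt_def] at h ⊢; omega⟩

theorem base_apply (hc : ∑ k, c k = n) (p : Pos c) : (base hc).1 p = basePlace hc p := rfl

theorem base_lt_iff (hc : ∑ k, c k = n) (p q : Pos c) :
    (base hc).1 p < (base hc).1 q ↔ p.1 < q.1 ∨ p.1 = q.1 ∧ (p.2 : ℕ) < q.2 := by
  obtain ⟨k, i⟩ := p
  obtain ⟨l, j⟩ := q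
  change offset c k + (i : ℕ) < offset c l + (j : ℕ) ↔ k < l ∨ k = l ∧ (i : ℕ) < j
  rcases lt_trichotomy k l with hkl | rfl | hkl
  · have := offset_add_le_offset c hkl
    simp only [hkl, true_or, iff_true]; omega
  · simp
  · have := offset_add_le_offset c hkl
    have h1 : ¬ k < l := not_lt.2 hkl.le
    have h2 : k ≠ l := hkl.ne'
    simp only [h1, h2, false_and, or_self, iff_false]; omega

/-- A weakly increasing word lists the positions in the same order as the base shuffle, and a
strictly increasing bijection of `Fin n` is the identity. -/
theorem eq_base (hc : ∑ k, c k = n) (w : Shuffle c n)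
    (h : ∀ i (hi : i + 1 < n), w.letter ⟨i, by omega⟩ ≤ w.letter ⟨i + 1, hi⟩) : w = base hc := by
  have hmono : Monotone w.letter := by
    obtain _ | n := n
    · intro i; exact i.elim0
    · exact Fin.monotone_iff_le_succ.2 fun i => h i (by omega)
  have hs : StrictMono fun i => w.1 ((base hc).1.symm i) := by
    intro i j hij
    obtain ⟨p, rfl⟩ := (base hc).1.surjective i
    obtain ⟨q, rfl⟩ := (base hc).1.surjective j
    simp only [Equiv.symm_apply_apply]
    rcases (base_lt_iff hc p q).1 hij with h1 | ⟨h1, h2⟩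
    · by_contra hcon
      have := hmono (not_lt.1 hcon)
      rw [letter_apply, letter_apply] at this
      exact absurd h1 (not_lt.2 this)
    · exact (lt_iff w h1).2 h2
  have hid : ∀ i, w.1 ((base hc).1.symm i) = i := by
    have h1 : (fun i => w.1 ((base hc).1.symm i)) = id := by
      refine (hs.range_inj strictMono_id).1 ?_
      rw [Set.range_id, Set.range_eq_univ]
      exact w.1.surjective.comp (base hc).1.symm.surjective
    exact fun i => congrFun h1 i
  refine Subtype.ext (Equiv.ext fun p => ?_)
  have := hid ((base hc).1 p)
  simpa using this

/-- All shuffles are obtained from the base shuffle by exchanging adjacent places of different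
blocks. -/
theorem induction (hc : ∑ k, c k = n) {p : Shuffle c n → Prop} (h0 : p (base hc))
    (hs : ∀ w i hi h, p w → p (swap w i hi h)) (w : Shuffle c n) : p w := by
  -- A weight that charges large letters more at early places, so that exchanging a descent lowers
  -- it. A word without descents is the base shuffle.
  let μ : Shuffle c n → ℕ := fun w => ∑ i : Fin n, (n - i) * (w.letter i : ℕ)
  induction hm : μ w using Nat.strong_induction_on generalizing w with
  | _ m ih =>
    by_cases h : ∀ i (hi : i + 1 < n), w.letter ⟨i, by omega⟩ ≤ w.letter ⟨i + 1, hi⟩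
    · rwa [eq_base hc w h]
    push Not at h
    obtain ⟨i, hi, hlt⟩ := h
    rw [← swap_swap w i hi hlt.ne' (letter_swap_ne _ _ _ _)]
    refine hs _ _ _ _ (ih _ ?_ _ rfl)
    rw [← hm]
    have hne : (⟨i, by omega⟩ : Fin n) ≠ ⟨i + 1, hi⟩ := by simp [Fin.ext_iff]
    simp only [μ, letter_swap]
    have hm : (⟨i + 1, hi⟩ : Fin n) ∈ Finset.univ.erase (⟨i, by omega⟩ : Fin n) :=
      Finset.mem_erase.2 ⟨hne.symm, Finset.mem_univ _⟩
    rw [← Finset.add_sum_erase _ _ (Finset.mem_univ (⟨i, by omega⟩ : Fin n)),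
      ← Finset.add_sum_erase _ _ hm,
      ← Finset.add_sum_erase _ (fun j : Fin n => (n - (j : ℕ)) * (w.letter j : ℕ))
        (Finset.mem_univ (⟨i, by omega⟩ : Fin n)),
      ← Finset.add_sum_erase _ (fun j : Fin n => (n - (j : ℕ)) * (w.letter j : ℕ)) hm,
      adj_left, adj_right, ← add_assoc, ← add_assoc]
    refine add_lt_add_of_lt_of_le ?_ (Finset.sum_le_sum fun j hj => ?_)
    · obtain ⟨d, hd⟩ := Nat.exists_eq_add_of_lt hi
      rw [Fin.lt_def] at hlt
      simp only [show n - i = d + 1 + 1 by omega, show n - (i + 1) = d + 1 by omega]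
      nlinarith
    · simp only [Finset.mem_erase, Finset.mem_univ, and_true, ne_eq, Fin.ext_iff] at hj
      rw [adj_of_ne i hi j hj.2 hj.1]

end Shuffle
end Shuffles

/-! ### The action of H_n(G) on functions from shuffles to E -/

section Model

variable {F : Type*} [Field F] {G : Type*} [Group G] [Fintype G] {r : ℕ} {c : Fin r → ℕ} {n : ℕ}
  {E : Type*} [AddCommGroup E] [Module F E] [Module (⨂[F] k, WHecke F G (c k)) E]
  [IsScalarTower F (⨂[F] k, WHecke F G (c k)) E]

variable (F G) in
/-- The simple reflection that exchanges a position with the next one, or `1` if there is no next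
position in the same block. -/
def sPos (p : Pos c) : ⨂[F] k, WHecke F G (c k) :=
  if h : (p.2 : ℕ) + 1 < c p.1 then sP F G p.1 p.2 h else 1

variable (F E) in
open Classical in
/-- The operators on functions from shuffles to `E` by which the generators of `H_n(G)` act. -/
def modelGen : Gen G n → Module.End F (Shuffle c n → E)
  | .g a => LinearMap.pi fun w => (Algebra.lsmul F F E (gP F (a ∘ w.1)) : Module.End F E) ∘ₗ
      LinearMap.proj w
  | .x i => LinearMap.pi fun w => (Algebra.lsmul F F E (xP F G (w.1.symm i)) : Module.End F E) ∘ₗ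
      LinearMap.proj w
  | .s i hi => LinearMap.pi fun w =>
      if h : w.letter ⟨i, by omega⟩ ≠ w.letter ⟨i + 1, hi⟩ then LinearMap.proj (w.swap i hi h)
      else (Algebra.lsmul F F E (sPos F G (w.1.symm ⟨i, by omega⟩)) : Module.End F E) ∘ₗ
        LinearMap.proj w

theorem modelGen_g (a : Fin n → G) (f : Shuffle c n → E) (w : Shuffle c n) :
    modelGen F E (.g a) f w = gP F (a ∘ w.1) • f w := rfl

theorem modelGen_x (i : Fin n) (f : Shuffle c n → E) (w : Shuffle c n) :
    modelGen F E (.x i : Gen G n) f w = xP F G (w.1.symm i) • f w := rfl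

theorem modelGen_s_of_ne (i : ℕ) (hi : i + 1 < n) (f : Shuffle c n → E) (w : Shuffle c n)
    (h : w.letter ⟨i, by omega⟩ ≠ w.letter ⟨i + 1, hi⟩) :
    modelGen F E (.s i hi : Gen G n) f w = f (w.swap i hi h) := by
  simp only [modelGen, LinearMap.pi_apply, dif_pos h, LinearMap.proj_apply]

theorem modelGen_s (i : ℕ) (hi : i + 1 < n) (f : Shuffle c n → E) (w : Shuffle c n) (k : Fin r)
    (j : ℕ) (hj : j + 1 < c k) (h₁ : w.1 ⟨k, ⟨j, by omega⟩⟩ = ⟨i, by omega⟩)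
    (h₂ : w.1 ⟨k, ⟨j + 1, hj⟩⟩ = ⟨i + 1, hi⟩) :
    modelGen F E (.s i hi : Gen G n) f w = sP F G k j hj • f w := by
  have h : ¬ w.letter ⟨i, by omega⟩ ≠ w.letter ⟨i + 1, hi⟩ := by
    rw [← h₁, ← h₂, Shuffle.letter_apply, Shuffle.letter_apply]; simp
  simp only [modelGen, LinearMap.pi_apply, dif_neg h, LinearMap.comp_apply, LinearMap.proj_apply,
    Algebra.lsmul_coe]
  rw [← h₁, Equiv.symm_apply_apply, sPos, dif_pos]

theorem Shuffle.symm_eq (w : Shuffle c n) {p : Pos c} {i : Fin n} (h : w.1 p = i) :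
    w.1.symm i = p := by rw [← h, Equiv.symm_apply_apply]

theorem Shuffle.comp_adj_comp (w : Shuffle c n) (i : ℕ) (hi : i + 1 < n) {p q : Pos c}
    (h₁ : w.1 p = ⟨i, by omega⟩) (h₂ : w.1 q = ⟨i + 1, hi⟩) (t : Pos c) :
    adj i hi (w.1 t) = w.1 (Equiv.swap p q t) := by
  simp only [adj]
  rw [← h₁, ← h₂]
  exact (w.1.injective.map_swap ..).symm

variable (G) in
-- The proof distinguishes coincidences among the letters at i, i + 1, i + 2. If all agree it is the
-- braid relation of the Young subalgebra, and if all differ it is the braid relation of place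
-- permutations. If exactly two agree, both sides consist of one reflection of that block and two
-- exchanges.
theorem modelGen_braid (i : ℕ) (hi : i + 1 < n) (hj : i + 1 + 1 < n) (f : Shuffle c n → E) :
    modelGen F E (.s i hi : Gen G n) (modelGen F E (.s (i + 1) hj : Gen G n)
      (modelGen F E (.s i hi : Gen G n) f)) = modelGen F E (.s (i + 1) hj : Gen G n)
      (modelGen F E (.s i hi : Gen G n) (modelGen F E (.s (i + 1) hj : Gen G n) f)) := by
  have e0 : adj i hi (⟨i, by omega⟩ : Fin n) = ⟨i + 1, hi⟩ := Shuffle.adj_left i hi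
  have e1 : adj i hi (⟨i + 1, hi⟩ : Fin n) = ⟨i, by omega⟩ := Shuffle.adj_right i hi
  have e2 : adj i hi (⟨i + 1 + 1, hj⟩ : Fin n) = ⟨i + 1 + 1, hj⟩ :=
    Shuffle.adj_of_ne i hi _ (by simp only; omega) (by simp)
  have d0 : adj (i + 1) hj (⟨i, by omega⟩ : Fin n) = ⟨i, by omega⟩ :=
    Shuffle.adj_of_ne (i + 1) hj _ (by simp) (by simp only; omega)
  have d1 : adj (i + 1) hj (⟨i + 1, hi⟩ : Fin n) = ⟨i + 1 + 1, hj⟩ := Shuffle.adj_left (i + 1) hj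
  have d2 : adj (i + 1) hj (⟨i + 1 + 1, hj⟩ : Fin n) = ⟨i + 1, hi⟩ := Shuffle.adj_right (i + 1) hj
  funext w
  by_cases hab : w.letter ⟨i, by omega⟩ = w.letter ⟨i + 1, hi⟩
  · obtain ⟨k, j, hjk, h₁, h₂⟩ := w.exists_of_letter_eq i hi hab
    by_cases hbc : w.letter ⟨i + 1, hi⟩ = w.letter ⟨i + 1 + 1, hj⟩
    · obtain ⟨k', j', hjk', h₁', h₂'⟩ := w.exists_of_letter_eq (i + 1) hj hbc
      have hp := w.1.injective (h₂.trans h₁'.symm)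
      rw [pos_ext_iff] at hp
      obtain ⟨rfl, hp⟩ := hp
      obtain rfl : j + 1 = j' := hp
      rw [modelGen_s i hi _ w k j hjk h₁ h₂, modelGen_s (i + 1) hj _ w k (j + 1) hjk' h₁' h₂',
        modelGen_s (i + 1) hj _ w k (j + 1) hjk' h₁' h₂', modelGen_s i hi _ w k j hjk h₁ h₂,
        modelGen_s i hi _ w k j hjk h₁ h₂, modelGen_s (i + 1) hj _ w k (j + 1) hjk' h₁' h₂',
        ← mul_smul, ← mul_smul, ← mul_smul, ← mul_smul]
      exact congrArg (· • f w) (sP_braid k j hjk hjk')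
    · have hac : w.letter ⟨i, by omega⟩ ≠ w.letter ⟨i + 1 + 1, hj⟩ := by rwa [hab]
      rw [modelGen_s i hi _ w k j hjk h₁ h₂, modelGen_s_of_ne (i + 1) hj _ w hbc,
        modelGen_s_of_ne (i + 1) hj _ w hbc,
        modelGen_s_of_ne i hi _ _ (by
          rw [Shuffle.letter_swap, Shuffle.letter_swap, d0, d1]; exact hac),
        modelGen_s_of_ne i hi _ _ (by
          rw [Shuffle.letter_swap, Shuffle.letter_swap, d0, d1]; exact hac),
        modelGen_s (i + 1) hj _ _ k j hjk]
      · change adj i hi (adj (i + 1) hj (w.1 _)) = _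
        rw [h₁, d0, e0]
      · change adj i hi (adj (i + 1) hj (w.1 _)) = _
        rw [h₂, d1, e2]
  · by_cases hbc : w.letter ⟨i + 1, hi⟩ = w.letter ⟨i + 1 + 1, hj⟩
    · obtain ⟨k, j, hjk, h₁, h₂⟩ := w.exists_of_letter_eq (i + 1) hj hbc
      have hac : w.letter ⟨i, by omega⟩ ≠ w.letter ⟨i + 1 + 1, hj⟩ := by rwa [← hbc]
      rw [modelGen_s_of_ne i hi _ w hab, modelGen_s (i + 1) hj _ w k j hjk h₁ h₂,
        modelGen_s_of_ne i hi _ w hab,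
        modelGen_s_of_ne (i + 1) hj _ _ (by
          rw [Shuffle.letter_swap, Shuffle.letter_swap, e1, e2]; exact hac),
        modelGen_s_of_ne (i + 1) hj _ _ (by
          rw [Shuffle.letter_swap, Shuffle.letter_swap, e1, e2]; exact hac),
        modelGen_s i hi _ _ k j hjk]
      · change adj (i + 1) hj (adj i hi (w.1 _)) = _
        rw [h₁, e1, d0]
      · change adj (i + 1) hj (adj i hi (w.1 _)) = _
        rw [h₂, e2, d2]
    -- The outer two letters may agree while the middle one differs. Each side then exchanges the
    -- middle letter with a neighbour, reflects the equal letters, which have become adjacent, and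
    -- exchanges back.
    · by_cases hac : w.letter ⟨i, by omega⟩ = w.letter ⟨i + 1 + 1, hj⟩
      · have hl : (w.swap i hi hab).letter ⟨i + 1, hi⟩
            = (w.swap i hi hab).letter ⟨i + 1 + 1, hj⟩ := by
          rw [Shuffle.letter_swap, Shuffle.letter_swap, e1, e2, hac]
        obtain ⟨k, j, hjk, h₁, h₂⟩ := Shuffle.exists_of_letter_eq _ (i + 1) hj hl
        change adj i hi (w.1 _) = _ at h₁
        change adj i hi (w.1 _) = _ at h₂
        rw [← e0, (adj i hi).apply_eq_iff_eq] at h₁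
        rw [← e2, (adj i hi).apply_eq_iff_eq] at h₂
        trans sP F G k j hjk • f w
        · rw [modelGen_s_of_ne i hi _ w hab,
            modelGen_s (i + 1) hj _ (w.swap i hi hab) k j hjk
              (by change adj i hi (w.1 _) = _; rw [h₁, e0])
              (by change adj i hi (w.1 _) = _; rw [h₂, e2]),
            modelGen_s_of_ne i hi _ _ (Shuffle.letter_swap_ne _ _ _ _), Shuffle.swap_swap]
        · rw [modelGen_s_of_ne (i + 1) hj _ w hbc,
            modelGen_s i hi _ (w.swap (i + 1) hj hbc) k j hjk
              (by change adj (i + 1) hj (w.1 _) = _; rw [h₁, d0])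
              (by change adj (i + 1) hj (w.1 _) = _; rw [h₂, d2]),
            modelGen_s_of_ne (i + 1) hj _ _ (Shuffle.letter_swap_ne _ _ _ _), Shuffle.swap_swap]
      · have p1 : (w.swap i hi hab).letter ⟨i + 1, by omega⟩
            ≠ (w.swap i hi hab).letter ⟨i + 1 + 1, hj⟩ := by
          rw [Shuffle.letter_swap, Shuffle.letter_swap, e1, e2]; exact hac
        have p2 : ((w.swap i hi hab).swap (i + 1) hj p1).letter ⟨i, by omega⟩
            ≠ ((w.swap i hi hab).swap (i + 1) hj p1).letter ⟨i + 1, hi⟩ := by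
          simp only [Shuffle.letter_swap, d0, d1, e0, e2]; exact hbc
        have q1 : (w.swap (i + 1) hj hbc).letter ⟨i, by omega⟩
            ≠ (w.swap (i + 1) hj hbc).letter ⟨i + 1, hi⟩ := by
          rw [Shuffle.letter_swap, Shuffle.letter_swap, d0, d1]; exact hac
        have q2 : ((w.swap (i + 1) hj hbc).swap i hi q1).letter ⟨i + 1, by omega⟩
            ≠ ((w.swap (i + 1) hj hbc).swap i hi q1).letter ⟨i + 1 + 1, hj⟩ := by
          simp only [Shuffle.letter_swap, d2, d0, e1, e2]; exact hab
        rw [modelGen_s_of_ne i hi _ w hab, modelGen_s_of_ne (i + 1) hj _ w hbc,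
          modelGen_s_of_ne (i + 1) hj _ _ p1, modelGen_s_of_ne i hi _ _ q1,
          modelGen_s_of_ne i hi _ _ p2, modelGen_s_of_ne (i + 1) hj _ _ q2]
        congr 1
        refine Subtype.ext (Equiv.ext fun p => ?_)
        change adj i hi (adj (i + 1) hj (adj i hi (w.1 p)))
          = adj (i + 1) hj (adj i hi (adj (i + 1) hj (w.1 p)))
        exact congrArg (fun σ : Equiv.Perm (Fin n) => σ (w.1 p)) (adj_braid i hi hj)

variable (G) in
theorem modelGen_s_s (i j : ℕ) (hi : i + 1 < n) (hj : j + 1 < n) (hij : i + 1 < j)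
    (f : Shuffle c n → E) :
    modelGen F E (.s i hi : Gen G n) (modelGen F E (.s j hj : Gen G n) f)
      = modelGen F E (.s j hj : Gen G n) (modelGen F E (.s i hi : Gen G n) f) := by
  have e0 : adj j hj (⟨i, by omega⟩ : Fin n) = ⟨i, by omega⟩ :=
    Shuffle.adj_of_ne j hj _ (by simp only; omega) (by simp only; omega)
  have e1 : adj j hj (⟨i + 1, hi⟩ : Fin n) = ⟨i + 1, hi⟩ :=
    Shuffle.adj_of_ne j hj _ (by simp only; omega) (by simp only; omega)
  have d0 : adj i hi (⟨j, by omega⟩ : Fin n) = ⟨j, by omega⟩ :=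
    Shuffle.adj_of_ne i hi _ (by simp only; omega) (by simp only; omega)
  have d1 : adj i hi (⟨j + 1, hj⟩ : Fin n) = ⟨j + 1, hj⟩ :=
    Shuffle.adj_of_ne i hi _ (by simp only; omega) (by simp only; omega)
  funext w
  by_cases ha : w.letter ⟨i, by omega⟩ = w.letter ⟨i + 1, hi⟩
  · obtain ⟨k, a, hak, h₁, h₂⟩ := w.exists_of_letter_eq i hi ha
    by_cases hb : w.letter ⟨j, by omega⟩ = w.letter ⟨j + 1, hj⟩
    · obtain ⟨l, b, hbl, h₁', h₂'⟩ := w.exists_of_letter_eq j hj hb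
      rw [modelGen_s i hi _ w k a hak h₁ h₂, modelGen_s j hj _ w l b hbl h₁' h₂',
        modelGen_s j hj _ w l b hbl h₁' h₂', modelGen_s i hi _ w k a hak h₁ h₂, ← mul_smul,
        ← mul_smul]
      congr 1
      by_cases hkl : k = l
      · subst hkl
        -- Shuffles increase on blocks, so positions at non-adjacent pairs of places are themselves
        -- far apart.
        have h1 : a + 1 < b := by
          have h3 : a + 1 < b + 1 := (w.lt_iff (p := ⟨k, ⟨a + 1, hak⟩⟩) (q := ⟨k, ⟨b + 1, hbl⟩⟩)
            rfl).1 (by rw [h₂, h₂', Fin.lt_def]; simp only; omega)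
          have h4 : a + 1 ≠ b := by
            rintro rfl
            have := congrArg Fin.val (h₂.symm.trans h₁')
            simp only at this
            omega
          omega
        exact sP_comm k a b hak hbl h1
      · exact sP_comm_of_ne hkl _ _ _ _
    · rw [modelGen_s i hi _ w k a hak h₁ h₂, modelGen_s_of_ne j hj _ w hb,
        modelGen_s_of_ne j hj _ w hb, modelGen_s i hi _ _ k a hak]
      · change adj j hj (w.1 _) = _
        rw [h₁, e0]
      · change adj j hj (w.1 _) = _
        rw [h₂, e1]
  · by_cases hb : w.letter ⟨j, by omega⟩ = w.letter ⟨j + 1, hj⟩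
    · obtain ⟨l, b, hbl, h₁', h₂'⟩ := w.exists_of_letter_eq j hj hb
      rw [modelGen_s_of_ne i hi _ w ha, modelGen_s j hj _ w l b hbl h₁' h₂',
        modelGen_s_of_ne i hi _ w ha, modelGen_s j hj _ _ l b hbl]
      · change adj i hi (w.1 _) = _
        rw [h₁', d0]
      · change adj i hi (w.1 _) = _
        rw [h₂', d1]
    · rw [modelGen_s_of_ne i hi _ w ha, modelGen_s_of_ne j hj _ w hb,
        modelGen_s_of_ne j hj _ _ (by rw [Shuffle.letter_swap, Shuffle.letter_swap, d0, d1]; exact hb),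
        modelGen_s_of_ne i hi _ _ (by rw [Shuffle.letter_swap, Shuffle.letter_swap, e0, e1]; exact ha)]
      congr 1
      refine Subtype.ext (Equiv.ext fun p => ?_)
      change adj j hj (adj i hi (w.1 p)) = adj i hi (adj j hj (w.1 p))
      exact congrArg (fun σ : Equiv.Perm (Fin n) => σ (w.1 p)) (adj_comm i j hi hj hij).symm

end Model

section Model

variable {F : Type*} [Field F] {G : Type*} [Group G] [Fintype G] {r : ℕ} {c : Fin r → ℕ} {n : ℕ}
  {E : Type*} [AddCommGroup E] [Module F E] [Module (⨂[F] k, WHecke F G (c k)) E]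
  [IsScalarTower F (⨂[F] k, WHecke F G (c k)) E] {ε : Fin r → G → F}

theorem mulSingle_comp_equiv {α β M : Type*} [DecidableEq α] [DecidableEq β] [MulOneClass M]
    (w : α ≃ β) (p : α) (h : M) :
    (Pi.mulSingle (w p) h : β → M) ∘ w = Pi.mulSingle p h := by
  funext q
  simp [Pi.mulSingle_apply]

theorem IsBlockIdempotent.sum_shuffle (hε : IsBlockIdempotent (c := c) E ε) (w : Shuffle c n)
    {i j : Fin n} (h : w.letter i ≠ w.letter j) (v : E) :
    ∑ g : G, gP F ((Pi.mulSingle i g * Pi.mulSingle j g⁻¹ : Fin n → G) ∘ w.1) • v = 0 := by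
  have h1 := hε.sum_cross (p := w.1.symm i) (q := w.1.symm j) h v
  rw [← h1]
  refine Finset.sum_congr rfl fun g _ => ?_
  rw [← mulSingle_comp_equiv w.1, ← mulSingle_comp_equiv w.1, Equiv.apply_symm_apply,
    Equiv.apply_symm_apply]
  rfl

/-- The action of `H_n(G)` on functions from shuffles to `E`. -/
def modelHom (hε : IsBlockIdempotent (c := c) E ε) :
    WHecke F G n →ₐ[F] Module.End F (Shuffle c n → E) :=
  WHecke.lift (modelGen F E) (by
    intro p q h
    cases h <;> simp only [map_mul, map_one, map_sub, map_sum, FreeAlgebra.lift_ι_apply] <;>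
      refine LinearMap.ext fun f => ?_ <;> simp only [Module.End.mul_apply, Module.End.one_apply]
    case g_one =>
      funext w
      rw [modelGen_g]
      exact (congrArg (· • f w) gP_one).trans (one_smul _ _)
    case g_mul a b =>
      funext w
      rw [modelGen_g, modelGen_g, modelGen_g, ← mul_smul, ← gP_mul]
      rfl
    case x_x i j =>
      funext w
      simp only [modelGen_x, ← mul_smul]
      rw [xP_mul_xP]
    case x_g i a =>
      funext w
      simp only [modelGen_x, modelGen_g, ← mul_smul]
      rw [xP_mul_gP]
    case s_sq i hi =>
      funext w
      by_cases h : w.letter ⟨i, by omega⟩ = w.letter ⟨i + 1, hi⟩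
      · obtain ⟨k, j, hj, h₁, h₂⟩ := w.exists_of_letter_eq i hi h
        rw [modelGen_s i hi _ w k j hj h₁ h₂, modelGen_s i hi _ w k j hj h₁ h₂, ← mul_smul,
          sP_mul_self, one_smul]
      · rw [modelGen_s_of_ne i hi _ w h,
          modelGen_s_of_ne i hi _ _ (Shuffle.letter_swap_ne _ _ _ _), Shuffle.swap_swap]
    case s_s i j hi hj hij => exact modelGen_s_s G i j hi hj hij f
    case braid i hi hj => exact modelGen_braid G i hi hj f
    case s_x i hi =>
      funext w
      simp only [LinearMap.sub_apply, LinearMap.sum_apply, Pi.sub_apply, Finset.sum_apply,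
        modelGen_g, Module.End.mul_apply]
      by_cases h : w.letter ⟨i, by omega⟩ = w.letter ⟨i + 1, hi⟩
      · obtain ⟨k, j, hj, h₁, h₂⟩ := w.exists_of_letter_eq i hi h
        rw [modelGen_s i hi _ w k j hj h₁ h₂, modelGen_x, modelGen_x,
          modelGen_s i hi _ w k j hj h₁ h₂, w.symm_eq h₁, w.symm_eq h₂, ← mul_smul, sP_mul_xP,
          sub_smul, mul_smul, Finset.sum_smul]
        congr 1
        refine Finset.sum_congr rfl fun g _ => ?_
        rw [← mulSingle_comp_equiv w.1, ← mulSingle_comp_equiv w.1, h₁, h₂]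
        rfl
      -- For different letters the model satisfies the relation without a correction term; it holds
      -- in H_n(G) because the cross sum acts as zero on E.
      · rw [modelGen_s_of_ne i hi _ w h, modelGen_x, modelGen_x, modelGen_s_of_ne i hi _ w h,
          Shuffle.symm_swap, Shuffle.adj_left, hε.sum_shuffle w h, sub_zero]
    case s_x_of_ne i hi j h₀ h₁ =>
      funext w
      by_cases h : w.letter ⟨i, by omega⟩ = w.letter ⟨i + 1, hi⟩
      · obtain ⟨k, l, hl, h₁', h₂'⟩ := w.exists_of_letter_eq i hi h
        rw [modelGen_s i hi _ w k l hl h₁' h₂', modelGen_x, modelGen_x,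
          modelGen_s i hi _ w k l hl h₁' h₂', ← mul_smul, ← mul_smul, sP_mul_xP_of_ne]
        · rw [← w.symm_eq h₁']
          exact fun h' => h₀ (congrArg Fin.val (w.1.symm.injective h'))
        · rw [← w.symm_eq h₂']
          exact fun h' => h₁ (congrArg Fin.val (w.1.symm.injective h'))
      · rw [modelGen_s_of_ne i hi _ w h, modelGen_x, modelGen_x, modelGen_s_of_ne i hi _ w h,
          Shuffle.symm_swap, Shuffle.adj_of_ne i hi j h₀ h₁]
    case s_g i hi a =>
      funext w
      by_cases h : w.letter ⟨i, by omega⟩ = w.letter ⟨i + 1, hi⟩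
      · obtain ⟨k, j, hj, h₁, h₂⟩ := w.exists_of_letter_eq i hi h
        rw [modelGen_s i hi _ w k j hj h₁ h₂, modelGen_g, modelGen_g,
          modelGen_s i hi _ w k j hj h₁ h₂, ← mul_smul, ← mul_smul, sP_mul_gP]
        congr 3
        funext p
        simp only [Function.comp_apply, Equiv.swap_inv]
        rw [w.comp_adj_comp i hi h₁ h₂]
      · rw [modelGen_s_of_ne i hi _ w h, modelGen_g, modelGen_g, modelGen_s_of_ne i hi _ w h]
        congr 2)

variable (hε : IsBlockIdempotent (c := c) E ε)

theorem modelHom_gen (a : Gen G n) : modelHom hε (WHecke.gen F a) = modelGen F E a := by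
  simp [modelHom]

theorem modelHom_g_single (a : Fin n → G) (w : Shuffle c n) (v : E) :
    modelHom hε (WHecke.gen F (.g a)) (Pi.single w v) = Pi.single w (gP F (a ∘ w.1) • v) := by
  funext w'
  rw [modelHom_gen, modelGen_g]
  by_cases h : w' = w
  · subst h; simp
  · simp [h]

theorem modelHom_x_single (i : Fin n) (w : Shuffle c n) (v : E) :
    modelHom hε (WHecke.gen F (.x i)) (Pi.single w v)
      = Pi.single w (xP F G (w.1.symm i) • v) := by
  funext w'
  rw [modelHom_gen, modelGen_x]
  by_cases h : w' = w
  · subst h; simp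
  · simp [h]

theorem modelHom_s_single_of_ne (i : ℕ) (hi : i + 1 < n) (w : Shuffle c n)
    (h : w.letter ⟨i, by omega⟩ ≠ w.letter ⟨i + 1, hi⟩) (v : E) :
    modelHom hε (WHecke.gen F (.s i hi)) (Pi.single w v) = Pi.single (w.swap i hi h) v := by
  funext w'
  rw [modelHom_gen]
  by_cases h' : w'.letter ⟨i, by omega⟩ = w'.letter ⟨i + 1, hi⟩
  · obtain ⟨k, j, hj, h₁, h₂⟩ := w'.exists_of_letter_eq i hi h'
    rw [modelGen_s i hi _ w' k j hj h₁ h₂]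
    have h1 : w' ≠ w := fun e => h (e ▸ h')
    have h2 : w' ≠ w.swap i hi h := fun e => (w.letter_swap_ne i hi h) (e ▸ h')
    rw [Pi.single_eq_of_ne h1, Pi.single_eq_of_ne h2, smul_zero]
  · rw [modelGen_s_of_ne i hi _ w' h']
    by_cases e : w' = w.swap i hi h
    · subst e
      rw [Shuffle.swap_swap, Pi.single_eq_same, Pi.single_eq_same]
    · rw [Pi.single_eq_of_ne e, Pi.single_eq_of_ne]
      intro e'
      apply e
      subst e'
      rw [Shuffle.swap_swap]

theorem modelHom_s_single (i : ℕ) (hi : i + 1 < n) (w : Shuffle c n) (k : Fin r) (j : ℕ)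
    (hj : j + 1 < c k) (h₁ : w.1 ⟨k, ⟨j, by omega⟩⟩ = ⟨i, by omega⟩)
    (h₂ : w.1 ⟨k, ⟨j + 1, hj⟩⟩ = ⟨i + 1, hi⟩) (v : E) :
    modelHom hε (WHecke.gen F (.s i hi)) (Pi.single w v) = Pi.single w (sP F G k j hj • v) := by
  have h : w.letter ⟨i, by omega⟩ = w.letter ⟨i + 1, hi⟩ := by
    rw [← h₁, ← h₂, Shuffle.letter_apply, Shuffle.letter_apply]
  funext w'
  rw [modelHom_gen]
  by_cases e : w' = w
  · subst e
    rw [modelGen_s i hi _ w' k j hj h₁ h₂, Pi.single_eq_same, Pi.single_eq_same]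
  rw [Pi.single_eq_of_ne e]
  by_cases h' : w'.letter ⟨i, by omega⟩ = w'.letter ⟨i + 1, hi⟩
  · obtain ⟨k, j, hj, h₁, h₂⟩ := w'.exists_of_letter_eq i hi h'
    rw [modelGen_s i hi _ w' k j hj h₁ h₂, Pi.single_eq_of_ne e, smul_zero]
  · rw [modelGen_s_of_ne i hi _ w' h', Pi.single_eq_of_ne]
    intro e'
    exact w'.letter_swap_ne i hi h' (e' ▸ h)

/-- The projection of functions on shuffles to the component of `w` is an action of an element of
`H_n(G)`. -/
theorem exists_modelHom_eq_single (w : Shuffle c n) :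
    ∃ a ∈ parabolic F G n ∅, ∀ f : Shuffle c n → E, modelHom hε a f = Pi.single w (f w) := by
  have hgen : ∀ i g, (WHecke.gen F (.g (Pi.mulSingle i g)) : WHecke F G n) ∈ parabolic F G n ∅ :=
    fun i g => Algebra.subset_adjoin (Or.inl ⟨_, rfl⟩)
  -- Multiplying the block idempotents of the letters of w, one place at a time, kills all other
  -- words. No s_i enters, so the projection is available even after restriction to H_{n-1,1}(G).
  have h1 : ∀ s : Finset (Fin n), ∃ a ∈ parabolic F G n ∅, ∀ (f : Shuffle c n → E) w',
      modelHom hε a f w' = if ∀ i ∈ s, w'.letter i = w.letter i then f w' else 0 := by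
    intro s
    induction s using Finset.induction_on with
    | empty => exact ⟨1, Subalgebra.one_mem _, fun f w' => by simp⟩
    | insert i s hi ih =>
      obtain ⟨a, ha', ha⟩ := ih
      refine ⟨(∑ g, ε (w.letter i) g • WHecke.gen F (.g (Pi.mulSingle i g))) * a,
        mul_mem (sum_mem fun g _ => Subalgebra.smul_mem _ (hgen i g) _) ha', fun f w' => ?_⟩
      have h2 := hε (w.letter i) (w'.1.symm i) (modelHom hε a f w')
      simp only [map_mul, map_sum, map_smul, Module.End.mul_apply, LinearMap.sum_apply,
        LinearMap.smul_apply, Finset.sum_apply, Pi.smul_apply, modelHom_gen, modelGen_g] at h2 ⊢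
      have h3 : ∀ g : G, (Pi.mulSingle i g : Fin n → G) ∘ w'.1 = Pi.mulSingle (w'.1.symm i) g := by
        intro g
        rw [← mulSingle_comp_equiv w'.1, Equiv.apply_symm_apply]
      simp only [h3]
      rw [h2, ha]
      by_cases h4 : w'.letter i = w.letter i
      · have h5 : (w'.1.symm i).1 = w.letter i := h4
        simp [h4, h5]
      · have h5 : ¬ (w'.1.symm i).1 = w.letter i := h4
        simp [h4, h5]
  obtain ⟨a, ha', ha⟩ := h1 Finset.univ
  refine ⟨a, ha', fun f => funext fun w' => ?_⟩
  rw [ha]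
  by_cases h : w' = w
  · subst h; simp
  · rw [Pi.single_eq_of_ne h, if_neg]
    intro h'
    exact h (Shuffle.ext_letter fun i => h' i (Finset.mem_univ i))

end Model

/-! ### Frobenius reciprocity and the comparison of induced modules with the model -/

section Induction

set_option linter.unusedSectionVars false

variable {F A B : Type*} [Field F] [Ring A] [Algebra F A] [Ring B] [Algebra F B]
  (φ : B →ₐ[F] A) {E : Type*} [AddCommGroup E] [Module F E] [Module B E] [IsScalarTower F B E]

/-- The element `a ⊗ e` of an induced module. -/
def indMk : A →ₗ[F] E →ₗ[F] Ind φ E :=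
  (TensorProduct.mk F A E).compr₂ ((balancing φ E).mkQ.restrictScalars F)

theorem smul_indMk (a b : A) (e : E) : a • indMk φ b e = indMk φ (a * b) e := rfl

theorem indMk_mul (a : A) (b : B) (e : E) : indMk φ (a * φ b) e = indMk φ a (b • e) := by
  refine (Submodule.Quotient.eq (balancing φ E)).2 (Submodule.subset_span ⟨a, b, e, rfl⟩)

variable {φ} in
omit [IsScalarTower F B E] in
theorem Ind.induction {p : Ind φ E → Prop} (h0 : p 0) (hadd : ∀ x y, p x → p y → p (x + y))
    (h : ∀ a e, p (indMk φ a e)) (z : Ind φ E) : p z := by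
  obtain ⟨z, rfl⟩ := Submodule.Quotient.mk_surjective (balancing φ E) z
  induction z using TensorProduct.induction_on with
  | zero => exact h0
  | tmul a e => exact h a e
  | add x y hx hy => exact hadd _ _ hx hy

variable {φ} {M : Type*} [AddCommGroup M] [Module F M]

/-- Frobenius reciprocity, for an action of `A` given by a representation. -/
theorem exists_ind_lift (θ : A →ₐ[F] Module.End F M) (f : E →ₗ[F] M)
    (hf : ∀ b e, f (b • e) = θ (φ b) (f e)) :
    ∃ g : Ind φ E →ₗ[F] M, (∀ a z, g (a • z) = θ a (g z)) ∧ ∀ a e, g (indMk φ a e) = θ a (f e) := by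
  let g₀ : A ⊗[F] E →ₗ[F] M := TensorProduct.lift
    (LinearMap.mk₂ F (fun a e => θ a (f e)) (by simp) (by simp) (by simp) (by simp))
  have hg₀ : ∀ a e, g₀ (a ⊗ₜ e) = θ a (f e) := fun a e => by simp [g₀]
  have hsm : ∀ a z, g₀ (a • z) = θ a (g₀ z) := by
    intro a z
    induction z using TensorProduct.induction_on with
    | zero => simp
    | tmul b e => rw [TensorProduct.smul_tmul', hg₀, hg₀, smul_eq_mul, map_mul]; rfl
    | add x y hx hy => rw [smul_add, map_add, hx, hy, map_add, map_add]
  have hker : (balancing φ E).restrictScalars F ≤ LinearMap.ker g₀ := by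
    intro z hz
    have hz' : z ∈ balancing φ E := hz
    rw [LinearMap.mem_ker]
    induction hz' using Submodule.span_induction with
    | mem z h =>
      obtain ⟨a, b, e, rfl⟩ := h
      rw [map_sub, hg₀, hg₀, hf, map_mul]; simp
    | zero => simp
    | add x y hx hy h1 h2 => rw [map_add, h1 hx, h2 hy, add_zero]
    | smul a x hx h1 => rw [hsm, h1 hx, map_zero]
  let q₀ : (A ⊗[F] E ⧸ balancing φ E) →ₗ[F] M :=
    ((balancing φ E).restrictScalars F).liftQ g₀ hker ∘ₗ
      (Submodule.Quotient.restrictScalarsEquiv F (balancing φ E)).symm.toLinearMap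
  let q : Ind φ E →ₗ[F] M := q₀
  have hq : ∀ z, q (Submodule.Quotient.mk z) = g₀ z := fun z => rfl
  have hqm : ∀ a e, q (indMk φ a e) = θ a (f e) := fun a e => (hq _).trans (hg₀ a e)
  refine ⟨q, fun a z => ?_, hqm⟩
  induction z using Ind.induction with
  | h0 => simp
  | hadd x y hx hy => rw [smul_add, map_add, hx, hy, map_add, map_add]
  | h b e => rw [smul_indMk, hqm, hqm, map_mul]; rfl

end Induction

namespace WHecke

variable (F : Type*) [Field F] (G : Type*) [Group G] [Fintype G] (n : ℕ)

theorem exists_permHom : ∃ T : Equiv.Perm (Fin n) →* WHecke F G n,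
    ∀ i hi, T (adj i hi) = gen F (.s i hi) :=
  exists_perm_hom_monoid (fun i hi => gen F (.s i hi)) gen_s_sq
    (fun i j hi hj hij => gen_s_s i j hi hj hij) gen_braid

/-- The embedding of the symmetric group. -/
def permHom : Equiv.Perm (Fin n) →* WHecke F G n := (exists_permHom F G n).choose

variable {F G n}

theorem permHom_adj (i : ℕ) (hi : i + 1 < n) : permHom F G n (adj i hi) = gen F (.s i hi) :=
  (exists_permHom F G n).choose_spec i hi

theorem gen_g_mul_permHom (σ : Equiv.Perm (Fin n)) (a : Fin n → G) :
    gen F (.g a) * permHom F G n σ = permHom F G n σ * gen F (.g (a ∘ σ)) := by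
  induction σ using perm_induction generalizing a with
  | h1 => rw [map_one, mul_one, one_mul]; rfl
  | hs i hi w ih =>
    have h1 : gen F (.g a) * gen F (.s i hi) = gen F (.s i hi) * gen F (.g (a ∘ adj i hi)) := by
      rw [gen_s_g]
      congr 3
      funext j
      simp
    rw [map_mul, permHom_adj, ← mul_assoc, h1, mul_assoc, ih, ← mul_assoc]
    rfl

end WHecke

theorem youngHom_gP {F : Type*} [Field F] {G : Type*} [Group G] [Fintype G] {r : ℕ}
    {c : Fin r → ℕ} {n : ℕ} (hc : ∑ k, c k = n) (b : Pos c → G) :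
    youngHom F G c hc (gP F b) = WHecke.gen F (.g (b ∘ (Shuffle.base hc).1.symm)) := by
  let X : Submonoid (Pos c → G) :=
    { carrier := {b | youngHom F G c hc (gP F b)
        = WHecke.gen F (.g (b ∘ (Shuffle.base hc).1.symm))}
      one_mem' := by
        rw [Set.mem_ofPred_eq, gP_one, map_one]; exact WHecke.gen_g_one.symm
      mul_mem' := fun {a b} ha hb => by
        rw [Set.mem_ofPred_eq, gP_mul, map_mul, ha, hb, ← WHecke.gen_g_mul]; rfl }
  have hX : b ∈ X := Submonoid.pi_mem_of_mulSingle_mem b fun p => by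
    change _ = _
    rw [youngHom_gP_mulSingle, ← Shuffle.base_apply]
    congr 2
    rw [← mulSingle_comp_equiv (Shuffle.base hc).1.symm, Equiv.symm_apply_apply]
  exact hX

section IndModel

variable {F : Type*} [Field F] {G : Type*} [Group G] [Fintype G] {r : ℕ} {c : Fin r → ℕ} {n : ℕ}
  {E : Type*} [AddCommGroup E] [Module F E] [Module (⨂[F] k, WHecke F G (c k)) E]
  [IsScalarTower F (⨂[F] k, WHecke F G (c k)) E] {ε : Fin r → G → F}
  (hε : IsBlockIdempotent (c := c) E ε) (hc : ∑ k, c k = n)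

/-- The functions supported at the base shuffle form a copy of E as a module over the Young
subalgebra. This is the input to Frobenius reciprocity that produces the map from the induced module
to the model. -/
theorem single_base_smul (b : ⨂[F] k, WHecke F G (c k)) (e : E) :
    (Pi.single (Shuffle.base hc) (b • e) : Shuffle c n → E)
      = modelHom hε (youngHom F G c hc b) (Pi.single (Shuffle.base hc) e) := by
  induction b using pos_induction generalizing e with
  | hg q h =>
    rw [youngHom_gP, modelHom_g_single]
    congr 3
    funext p
    simp
  | hx q => rw [youngHom_xP, modelHom_x_single, ← Shuffle.base_apply, Equiv.symm_apply_apply]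
  | hs k j hj => rw [youngHom_sP, modelHom_s_single hε _ _ _ k j hj rfl rfl]
  | hc t => simp [Algebra.algebraMap_eq_smul_one, Pi.single_smul]
  | hadd a b ha hb => rw [add_smul, Pi.single_add, ha, hb, map_add, map_add]; rfl
  | hmul a b ha hb => rw [mul_smul, ha, hb, map_mul, map_mul]; rfl

variable (F G) in
/-- The elements of the induced module that correspond to functions supported at a shuffle. -/
def indSingle (w : Shuffle c n) : E →ₗ[F] Ind (youngHom F G c hc) E :=
  indMk _ (WHecke.permHom F G n ((Shuffle.base hc).1.symm.trans w.1))

theorem gen_g_smul_indSingle (a : Fin n → G) (w : Shuffle c n) (e : E) :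
    WHecke.gen F (.g a) • indSingle F G hc w e = indSingle F G hc w (gP F (a ∘ w.1) • e) := by
  rw [indSingle, smul_indMk, WHecke.gen_g_mul_permHom, ← indMk_mul, youngHom_gP]
  rfl

theorem gen_s_smul_indSingle_of_ne (i : ℕ) (hi : i + 1 < n) (w : Shuffle c n)
    (h : w.letter ⟨i, by omega⟩ ≠ w.letter ⟨i + 1, hi⟩) (e : E) :
    (WHecke.gen F (.s i hi) : WHecke F G n) • indSingle F G hc w e = indSingle F G hc (w.swap i hi h) e := by
  rw [indSingle, indSingle, smul_indMk, ← WHecke.permHom_adj, ← map_mul]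
  rfl

theorem gen_s_smul_indSingle (i : ℕ) (hi : i + 1 < n) (w : Shuffle c n) (k : Fin r) (j : ℕ)
    (hj : j + 1 < c k) (h₁ : w.1 ⟨k, ⟨j, by omega⟩⟩ = ⟨i, by omega⟩)
    (h₂ : w.1 ⟨k, ⟨j + 1, hj⟩⟩ = ⟨i + 1, hi⟩) (e : E) :
    (WHecke.gen F (.s i hi) : WHecke F G n) • indSingle F G hc w e = indSingle F G hc w (sP F G k j hj • e) := by
  rw [indSingle, smul_indMk, ← WHecke.permHom_adj, ← map_mul, ← indMk_mul, youngHom_sP,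
    ← WHecke.permHom_adj, ← map_mul]
  congr 2
  refine congrArg _ (Equiv.ext fun q => ?_)
  obtain ⟨p, rfl⟩ := (Shuffle.base hc).1.surjective q
  have h3 : adj (offset c k + j) (by have := offset_add_le c hc k; omega)
      ((Shuffle.base hc).1 p) = (Shuffle.base hc).1 _ :=
    (Shuffle.base hc).comp_adj_comp _ _ (p := ⟨k, ⟨j, by omega⟩⟩) (q := ⟨k, ⟨j + 1, hj⟩⟩) rfl rfl p
  simp only [Equiv.Perm.mul_apply, h3, Equiv.trans_apply, Equiv.symm_apply_apply]
  exact w.comp_adj_comp i hi h₁ h₂ p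

include hε in
theorem sum_cross_smul_indSingle (w : Shuffle c n) {i j : Fin n} (h : w.letter i ≠ w.letter j)
    (e : E) : (∑ g : G, WHecke.gen F (.g (Pi.mulSingle i g * Pi.mulSingle j g⁻¹ : Fin n → G)))
      • indSingle F G hc w e = 0 := by
  rw [Finset.sum_smul]
  simp only [gen_g_smul_indSingle, ← map_sum]
  rw [hε.sum_shuffle w h, map_zero]

include hε in
-- At the base shuffle x_i comes from the Young subalgebra. Every other shuffle is reached by
-- exchanging different letters, and there s_j carries x across without correction because the cross
-- sum acts as zero.
theorem gen_x_smul_indSingle (i : Fin n) (w : Shuffle c n) (e : E) :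
    (WHecke.gen F (.x i) : WHecke F G n) • indSingle F G hc w e = indSingle F G hc w (xP F G (w.1.symm i) • e) := by
  induction w using Shuffle.induction hc generalizing i with
  | h0 =>
    have h1 : WHecke.permHom F G n ((Shuffle.base hc).1.symm.trans (Shuffle.base hc).1) = 1 := by
      rw [Equiv.symm_trans_self]; exact map_one _
    rw [indSingle, h1, smul_indMk, mul_one, ← indMk_mul, one_mul, youngHom_xP, ← Shuffle.base_apply,
      Equiv.apply_symm_apply]
  | hs w j hj h ih =>
    have hw : ∀ i, indSingle F G hc (w.swap j hj h) (xP F G ((w.swap j hj h).1.symm i) • e)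
        = (WHecke.gen F (.s j hj) : WHecke F G n) • (WHecke.gen F (.x (adj j hj i)) : WHecke F G n) • indSingle F G hc w e := by
      intro i
      rw [ih, gen_s_smul_indSingle_of_ne hc j hj w h, Shuffle.symm_swap]
    rw [hw, ← gen_s_smul_indSingle_of_ne hc j hj w h]
    by_cases h₁ : i = ⟨j + 1, hj⟩
    · subst h₁
      rw [Shuffle.adj_right, ← mul_smul, ← mul_smul, WHecke.gen_s_x, sub_smul,
        sum_cross_smul_indSingle hε hc w h, sub_zero]
    by_cases h₀ : i = ⟨j, by omega⟩
    · subst h₀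
      rw [Shuffle.adj_left]
      have h2 := congrArg (fun z => (WHecke.gen F (.s j hj) : WHecke F G n) • z • indSingle F G (E := E) hc (w.swap j hj h) e)
        (WHecke.gen_s_x (F := F) (G := G) j hj)
      simp only [sub_smul] at h2
      rw [sum_cross_smul_indSingle hε hc _ (w.letter_swap_ne j hj h), sub_zero, ← mul_smul,
        ← mul_assoc, WHecke.gen_s_sq, one_mul, ← gen_s_smul_indSingle_of_ne hc j hj w h, mul_smul,
        ← mul_smul (WHecke.gen F (.s j hj)) (WHecke.gen F (.s j hj)), WHecke.gen_s_sq,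
        one_smul] at h2
      exact h2
    · have h₀' : (i : ℕ) ≠ j := fun h => h₀ (Fin.ext h)
      have h₁' : (i : ℕ) ≠ j + 1 := fun h => h₁ (Fin.ext h)
      rw [Shuffle.adj_of_ne j hj i h₀' h₁', ← mul_smul, ← mul_smul,
        WHecke.gen_s_x_of_ne j hj i h₀' h₁']

/-- An induced module consists of the functions from shuffles to the module that is induced. -/
theorem exists_indEquiv : ∃ Ψ : Ind (youngHom F G c hc) E ≃ₗ[F] (Shuffle c n → E),
    (∀ a z, Ψ (a • z) = modelHom hε a (Ψ z)) ∧
    ∀ e, Ψ (indMk _ 1 e) = Pi.single (Shuffle.base hc) e := by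
  classical
  have := Fintype.ofFinite (Shuffle c n)
  obtain ⟨Ψ, h1, h2⟩ := exists_ind_lift (φ := youngHom F G c hc) (modelHom (n := n) hε)
    (LinearMap.single F (fun _ => E) (Shuffle.base hc)) (single_base_smul hε hc)
  -- The candidate for the inverse sends a value at w to the corresponding permutation ⊗ that value.
  -- It commutes with H_n(G), so one composite is checked on the generators 1 ⊗ e, while the other
  -- is checked shuffle by shuffle.
  let Λ : (Shuffle c n → E) →ₗ[F] Ind (youngHom F G c hc) E :=
    ∑ w, indSingle F G hc w ∘ₗ LinearMap.proj w
  have hΛ : ∀ w v, Λ (Pi.single w v) = indSingle F G hc w v := by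
    intro w v
    simp only [Λ, LinearMap.sum_apply, LinearMap.comp_apply, LinearMap.proj_apply]
    rw [Finset.sum_eq_single w]
    · simp
    · intro w' _ h; rw [Pi.single_eq_of_ne h, map_zero]
    · simp
  have hcomm : ∀ a f, Λ (modelHom hε a f) = a • Λ f := by
    intro a f
    have ha : a ∈ Algebra.adjoin F (Set.range (WHecke.gen F (G := G) (n := n))) := by
      rw [WHecke.adjoin_gen]; trivial
    induction ha using Algebra.adjoin_induction generalizing f with
    | mem a ha =>
      obtain ⟨a, rfl⟩ := ha
      have key : Λ ∘ₗ modelHom hε (WHecke.gen F a)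
          = (Algebra.lsmul F F _ (WHecke.gen F a) : Module.End F (Ind (youngHom F G c hc) E)) ∘ₗ Λ := by
        refine LinearMap.pi_ext fun w v => ?_
        simp only [LinearMap.comp_apply, Algebra.lsmul_coe, hΛ]
        cases a with
        | g a => rw [modelHom_g_single, hΛ, gen_g_smul_indSingle]
        | x i => rw [modelHom_x_single, hΛ, gen_x_smul_indSingle hε]
        | s i hi =>
          by_cases h : w.letter ⟨i, by omega⟩ = w.letter ⟨i + 1, hi⟩
          · obtain ⟨k, j, hj, h₁, h₂⟩ := w.exists_of_letter_eq i hi h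
            rw [modelHom_s_single hε i hi w k j hj h₁ h₂, hΛ,
              gen_s_smul_indSingle hc i hi w k j hj h₁ h₂]
          · rw [modelHom_s_single_of_ne hε i hi w h, hΛ, gen_s_smul_indSingle_of_ne hc i hi w h]
      exact LinearMap.congr_fun key f
    | algebraMap t => simp [Algebra.algebraMap_eq_smul_one]
    | add a b _ _ ha hb => rw [map_add, LinearMap.add_apply, map_add, ha, hb, add_smul]
    | mul a b _ _ ha hb => rw [map_mul, Module.End.mul_apply, ha, hb, mul_smul]
  have hbase : ∀ e, Λ (Pi.single (Shuffle.base hc) e) = indMk _ 1 e := by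
    intro e
    rw [hΛ, indSingle, Equiv.symm_trans_self]
    congr 1
    exact congrArg _ (map_one _)
  have hΨ : ∀ w v, Ψ (indSingle F G hc w v) = Pi.single w v := by
    intro w v
    induction w using Shuffle.induction hc with
    | h0 => rw [← hΛ, hbase, h2, map_one]; rfl
    | hs w i hi h ih =>
      rw [← gen_s_smul_indSingle_of_ne hc i hi w h, h1, ih, modelHom_s_single_of_ne hε i hi w h]
  refine ⟨LinearEquiv.ofLinearMap Ψ Λ ?_ ?_, h1, fun e => ?_⟩
  · refine LinearMap.pi_ext fun w v => ?_
    rw [LinearMap.comp_apply, hΛ, hΨ]; rfl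
  · refine LinearMap.ext fun z => ?_
    induction z using Ind.induction with
    | h0 => simp
    | hadd x y hx hy => rw [map_add, hx, hy, map_add]
    | h a e =>
      rw [LinearMap.comp_apply, h2, hcomm, LinearMap.single_apply, hbase, smul_indMk, mul_one]; rfl
  · change Ψ _ = _
    rw [h2, map_one]; rfl

end IndModel

/-! ### Submodules of an induced module -/

section IndLattice

variable {F : Type*} [Field F] {G : Type*} [Group G] [Fintype G] {r : ℕ} {c : Fin r → ℕ} {n : ℕ}
  {E : Type*} [AddCommGroup E] [Module F E] [Module (⨂[F] k, WHecke F G (c k)) E]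
  [IsScalarTower F (⨂[F] k, WHecke F G (c k)) E] {ε : Fin r → G → F}
  (hε : IsBlockIdempotent (c := c) E ε) (hc : ∑ k, c k = n)

/-- The isomorphism of `exists_indEquiv`. -/
def indEquiv : Ind (youngHom F G c hc) E ≃ₗ[F] (Shuffle c n → E) := (exists_indEquiv hε hc).choose

theorem indEquiv_smul (a : WHecke F G n) (z : Ind (youngHom F G c hc) E) :
    indEquiv hε hc (a • z) = modelHom hε a (indEquiv hε hc z) :=
  (exists_indEquiv hε hc).choose_spec.1 a z

theorem indEquiv_symm_modelHom (a : WHecke F G n) (f : Shuffle c n → E) :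
    (indEquiv hε hc).symm (modelHom hε a f) = a • (indEquiv hε hc).symm f := by
  rw [LinearEquiv.symm_apply_eq, indEquiv_smul, LinearEquiv.apply_symm_apply]

theorem indEquiv_indMk_one (e : E) :
    indEquiv hε hc (indMk _ 1 e) = Pi.single (Shuffle.base hc) e :=
  (exists_indEquiv hε hc).choose_spec.2 e

theorem modelHom_mem (K : Submodule (⨂[F] k, WHecke F G (c k)) E) (a : WHecke F G n)
    (f : Shuffle c n → E) (hf : ∀ w, f w ∈ K) (w : Shuffle c n) : modelHom hε a f w ∈ K := by
  have ha : a ∈ Algebra.adjoin F (Set.range (WHecke.gen F (G := G) (n := n))) := by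
    rw [WHecke.adjoin_gen]; trivial
  have hK : ∀ (t : F) (v : E), v ∈ K → t • v ∈ K := fun t v hv => by
    rw [← algebraMap_smul (⨂[F] k, WHecke F G (c k)) t v]; exact K.smul_mem _ hv
  induction ha using Algebra.adjoin_induction generalizing f w with
  | mem a ha =>
    obtain ⟨a, rfl⟩ := ha
    rw [modelHom_gen]
    cases a with
    | g a => exact K.smul_mem _ (hf w)
    | x i => exact K.smul_mem _ (hf w)
    | s i hi =>
      by_cases h : w.letter ⟨i, by omega⟩ = w.letter ⟨i + 1, hi⟩
      · obtain ⟨k, j, hj, h₁, h₂⟩ := w.exists_of_letter_eq i hi h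
        rw [modelGen_s i hi _ w k j hj h₁ h₂]
        exact K.smul_mem _ (hf w)
      · rw [modelGen_s_of_ne i hi _ w h]
        exact hf _
  | algebraMap t =>
    rw [AlgHom.commutes]
    exact hK t _ (hf w)
  | add a b _ _ ha hb => rw [map_add]; exact K.add_mem (ha f hf w) (hb f hf w)
  | mul a b _ _ ha hb =>
    rw [map_mul, Module.End.mul_apply]
    exact ha _ (hb f hf) w

/-- An exchange of different letters is an involution that carries functions supported at w to
functions supported at the exchanged shuffle with the same value. So a submodule has the same
component at every shuffle. -/
theorem symm_single_mem_iff (Y : Submodule (WHecke F G n) (Ind (youngHom F G c hc) E))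
    (w : Shuffle c n) (v : E) :
    (indEquiv hε hc).symm (Pi.single w v) ∈ Y
      ↔ indMk (youngHom F G c hc) 1 v ∈ Y := by
  induction w using Shuffle.induction hc with
  | h0 => rw [← indEquiv_indMk_one hε hc, LinearEquiv.symm_apply_apply]
  | hs w i hi h ih =>
    rw [← ih]
    constructor
    · intro h1
      have h2 := Y.smul_mem (WHecke.gen F (.s i hi)) h1
      rwa [← indEquiv_symm_modelHom, modelHom_s_single_of_ne hε i hi _ (w.letter_swap_ne i hi h),
        Shuffle.swap_swap] at h2
    · intro h1
      have h2 := Y.smul_mem (WHecke.gen F (.s i hi)) h1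
      rwa [← indEquiv_symm_modelHom, modelHom_s_single_of_ne hε i hi _ h] at h2

/-- The projection to a shuffle is the action of an element of the algebra, so submodules contain
the components of their elements. -/
theorem symm_single_apply_mem (Y : Submodule (WHecke F G n) (Ind (youngHom F G c hc) E))
    (w : Shuffle c n) {z} (hz : z ∈ Y) :
    (indEquiv hε hc).symm (Pi.single w (indEquiv hε hc z w)) ∈ Y := by
  obtain ⟨a, -, ha⟩ := exists_modelHom_eq_single hε w
  rw [← ha, indEquiv_symm_modelHom, LinearEquiv.symm_apply_apply]
  exact Y.smul_mem a hz

theorem mem_of_symm_single_mem {S : Type*} [SetLike S (Ind (youngHom F G c hc) E)]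
    [AddSubmonoidClass S (Ind (youngHom F G c hc) E)] (Y : S) {z : Ind (youngHom F G c hc) E}
    (h : ∀ w, (indEquiv hε hc).symm (Pi.single w (indEquiv hε hc z w)) ∈ Y) : z ∈ Y := by
  classical
  have := Fintype.ofFinite (Shuffle c n)
  have h1 : z = ∑ w, (indEquiv hε hc).symm (Pi.single w (indEquiv hε hc z w)) := by
    rw [← map_sum]
    refine (indEquiv hε hc).injective ?_
    rw [LinearEquiv.apply_symm_apply]
    exact (Finset.univ_sum_single _).symm
  rw [h1]
  exact sum_mem fun w _ => h w

include hε in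
/-- The lattice of submodules of an induced module. -/
theorem exists_ind_orderIso :
    ∃ e : Submodule (WHecke F G n) (Ind (youngHom F G c hc) E)
        ≃o Submodule (⨂[F] k, WHecke F G (c k)) E,
      ∀ Y v, v ∈ e Y ↔ indMk _ 1 v ∈ Y := by
  let f : Submodule (⨂[F] k, WHecke F G (c k)) E
      → Submodule (WHecke F G n) (Ind (youngHom F G c hc) E) := fun K =>
    { carrier := {z | ∀ w, indEquiv hε hc z w ∈ K}
      add_mem' := fun h1 h2 w => by rw [map_add]; exact K.add_mem (h1 w) (h2 w)
      zero_mem' := fun w => by rw [map_zero]; exact K.zero_mem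
      smul_mem' := fun a z hz w => by rw [indEquiv_smul]; exact modelHom_mem hε K a _ hz w }
  have hf : ∀ K z, z ∈ f K ↔ ∀ w, indEquiv hε hc z w ∈ K := fun K z => Iff.rfl
  have hf1 : ∀ K v, indMk _ 1 v ∈ f K ↔ v ∈ K := by
    intro K v
    rw [hf, indEquiv_indMk_one]
    refine ⟨fun h => by simpa using h (Shuffle.base hc), fun h w => ?_⟩
    by_cases e : w = Shuffle.base hc
    · subst e; simpa using h
    · rw [Pi.single_eq_of_ne e]; exact K.zero_mem
  let g : Submodule (WHecke F G n) (Ind (youngHom F G c hc) E)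
      → Submodule (⨂[F] k, WHecke F G (c k)) E := fun Y =>
    { carrier := {v | indMk _ 1 v ∈ Y}
      add_mem' := fun {a b} h1 h2 => by
        rw [Set.mem_ofPred_eq, map_add]; exact Y.add_mem h1 h2
      zero_mem' := by rw [Set.mem_ofPred_eq, map_zero]; exact Y.zero_mem
      smul_mem' := fun b v hv => by
        rw [Set.mem_ofPred_eq, ← indMk_mul, one_mul, ← mul_one (youngHom F G c hc b), ← smul_indMk]
        exact Y.smul_mem _ hv }
  have hg : ∀ Y v, v ∈ g Y ↔ indMk _ 1 v ∈ Y := fun Y v => Iff.rfl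
  have hfg : ∀ Y, f (g Y) = Y := by
    intro Y
    ext z
    rw [hf]
    refine ⟨fun h => mem_of_symm_single_mem hε hc Y fun w => ?_, fun h w => ?_⟩
    · rw [symm_single_mem_iff]; exact h w
    · rw [hg, ← symm_single_mem_iff hε hc Y w]; exact symm_single_apply_mem hε hc Y w h
  refine ⟨{ toFun := g, invFun := f, left_inv := hfg, right_inv := fun K => ?_,
            map_rel_iff' := fun {Y Y'} => ?_ }, hg⟩
  · ext v; rw [hg, hf1]
  · refine ⟨fun h z hz => ?_, fun h v hv => h hv⟩
    refine mem_of_symm_single_mem hε hc Y' fun w => ?_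
    rw [symm_single_mem_iff]
    exact h ((symm_single_mem_iff hε hc Y w _).1 (symm_single_apply_mem hε hc Y w hz))

end IndLattice

/-! ### Appending a last letter to a shuffle -/

namespace Shuffle

variable {r : ℕ} {c c' : Fin r → ℕ} {n : ℕ} {k : Fin r} (hk : c' k + 1 = c k)
  (hc' : ∀ j, j ≠ k → c' j = c j) (hc : ∑ j, c j = n + 1)

include hk hc' in
theorem eq_of_le_of_lt {j : Fin r} {i : ℕ} (h : c' j ≤ i) (hi : i < c j) : j = k ∧ i = c' k := by
  by_cases hj : j = k
  · subst hj; exact ⟨rfl, by omega⟩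
  · have := hc' j hj; omega

include hk hc' hc in
theorem sum_pred : ∑ j, c' j = n := by
  have h1 := Finset.add_sum_erase Finset.univ c (Finset.mem_univ k)
  have h2 := Finset.add_sum_erase Finset.univ c' (Finset.mem_univ k)
  have h3 : ∑ j ∈ Finset.univ.erase k, c' j = ∑ j ∈ Finset.univ.erase k, c j :=
    Finset.sum_congr rfl fun j hj => hc' j (Finset.ne_of_mem_erase hj)
  omega

/-- Extend a shuffle by one place at the end, which is occupied by the last position of the
`k`-th block. -/
def ext (w : Shuffle c' n) : Shuffle c (n + 1) :=
  ⟨Equiv.ofBijective (fun p : Pos c => if h : (p.2 : ℕ) < c' p.1 then (w.1 ⟨p.1, ⟨p.2, h⟩⟩).castSucc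
      else Fin.last n) ((Fintype.bijective_iff_injective_and_card _).2 ⟨by
      rintro ⟨j, i⟩ ⟨j', i'⟩ h
      rw [pos_ext_iff]
      simp only at h ⊢
      split_ifs at h with h1 h2 h2
      · have h3 := w.1.injective (Fin.castSucc_injective _ h)
        rw [pos_ext_iff] at h3
        exact h3
      · exact absurd h (Fin.castSucc_lt_last _).ne
      · exact absurd h (Fin.castSucc_lt_last _).ne'
      · obtain ⟨rfl, h3⟩ := eq_of_le_of_lt hk hc' (not_lt.1 h1) i.2
        obtain ⟨rfl, h4⟩ := eq_of_le_of_lt hk hc' (not_lt.1 h2) i'.2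
        exact ⟨rfl, by omega⟩, by simp [hc]⟩),
    fun j a b hab => by
      simp only [Equiv.ofBijective_apply]
      rw [Fin.lt_def] at hab
      split_ifs with h1 h2 h2
      · exact w.2 j (Fin.lt_def.2 hab)
      · exact Fin.castSucc_lt_last _
      · omega
      · have := eq_of_le_of_lt hk hc' (not_lt.1 h1) a.2
        have := eq_of_le_of_lt hk hc' (not_lt.1 h2) b.2
        omega⟩

theorem ext_apply_of_lt (w : Shuffle c' n) (j : Fin r) (i : ℕ) (hi : i < c' j) (hi' : i < c j) :
    (ext hk hc' hc w).1 ⟨j, ⟨i, hi'⟩⟩ = (w.1 ⟨j, ⟨i, hi⟩⟩).castSucc := by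
  simp only [ext, Equiv.ofBijective_apply, dif_pos hi]

theorem ext_apply_last (w : Shuffle c' n) (hi' : c' k < c k) :
    (ext hk hc' hc w).1 ⟨k, ⟨c' k, hi'⟩⟩ = Fin.last n := by
  simp [ext]

include hk hc' in
theorem le_of_pred (j : Fin r) : c' j ≤ c j := by
  by_cases h : j = k
  · subst h; omega
  · exact (hc' j h).le

theorem letter_ext_castSucc (w : Shuffle c' n) (i : Fin n) :
    (ext hk hc' hc w).letter i.castSucc = w.letter i := by
  obtain ⟨⟨j, a⟩, rfl⟩ := w.1.surjective i
  have := le_of_pred hk hc' j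
  rw [← ext_apply_of_lt hk hc' hc w j a a.2 (by omega), letter_apply, letter_apply]

theorem letter_ext_last (w : Shuffle c' n) : (ext hk hc' hc w).letter (Fin.last n) = k := by
  rw [← ext_apply_last hk hc' hc w (by omega), letter_apply]

theorem adj_castSucc (i : ℕ) (hi : i + 1 < n) (j : Fin n) :
    adj i (Nat.lt_succ_of_lt hi) j.castSucc = (adj i hi j).castSucc :=
  ((Fin.castSucc_injective n).map_swap ⟨i, by omega⟩ ⟨i + 1, hi⟩ j).symm

theorem adj_last (i : ℕ) (hi : i + 1 < n) :
    adj i (Nat.lt_succ_of_lt hi) (Fin.last n) = Fin.last n :=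
  adj_of_ne _ _ _ (by simp; omega) (by simp; omega)

theorem ext_swap (w : Shuffle c' n) (i : ℕ) (hi : i + 1 < n)
    (h : w.letter ⟨i, by omega⟩ ≠ w.letter ⟨i + 1, hi⟩)
    (h' : (ext hk hc' hc w).letter ⟨i, by omega⟩ ≠ (ext hk hc' hc w).letter ⟨i + 1, by omega⟩) :
    ext hk hc' hc (w.swap i hi h) = (ext hk hc' hc w).swap i (by omega) h' := by
  refine ext_letter fun j => ?_
  induction j using Fin.lastCases with
  | last => rw [letter_ext_last hk hc' hc, letter_swap _ i _ h', adj_last i hi,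
      letter_ext_last hk hc' hc]
  | cast j => rw [letter_ext_castSucc hk hc' hc, letter_swap, letter_swap _ i _ h',
      adj_castSucc i hi, letter_ext_castSucc hk hc' hc]

/-- A shuffle increases on each block, so if its last letter is k, the last place holds the last
position of the k-th block. Deleting that position leaves a shuffle of the smaller composition. -/
theorem exists_ext (w : Shuffle c (n + 1)) (hw : w.letter (Fin.last n) = k) :
    ∃ w' : Shuffle c' n, ext hk hc' hc w' = w := by
  have hlast : w.1 ⟨k, ⟨c' k, by omega⟩⟩ = Fin.last n := by
    obtain ⟨⟨l, a⟩, ha⟩ := w.1.surjective (Fin.last n)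
    rw [← ha, letter_apply] at hw
    obtain rfl : l = k := hw
    refine le_antisymm (Fin.le_last _) ?_
    rw [← ha]
    exact (w.2 l).monotone (Fin.le_def.2 (by simp only; omega))
  have hlt : ∀ p : Pos c', (w.1 ⟨p.1, ⟨p.2, by have := le_of_pred hk hc' p.1; omega⟩⟩ : ℕ) < n := by
    rintro ⟨j, a⟩
    refine Fin.val_lt_last fun h => ?_
    rw [← hlast] at h
    have h1 := w.1.injective h
    rw [pos_ext_iff] at h1
    simp only at h1
    obtain ⟨rfl, h1⟩ := h1
    omega
  refine ⟨⟨Equiv.ofBijective (fun p : Pos c' => (⟨_, hlt p⟩ : Fin n))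
    ((Fintype.bijective_iff_injective_and_card _).2 ⟨fun p q h => ?_, ?_⟩), fun j a b hab => ?_⟩, ?_⟩
  · have h0 := congrArg Fin.val h
    simp only at h0
    have h1 := w.1.injective (Fin.ext h0)
    rw [pos_ext_iff] at h1 ⊢
    exact h1
  · simp [sum_pred hk hc' hc]
  · exact w.2 j (Fin.lt_def.2 (Fin.lt_def.1 hab))
  · refine Subtype.ext (Equiv.ext fun ⟨j, a⟩ => ?_)
    by_cases h : (a : ℕ) < c' j
    · exact ext_apply_of_lt hk hc' hc _ j a h a.2
    · obtain ⟨rfl, h1⟩ := eq_of_le_of_lt hk hc' (not_lt.1 h) a.2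
      have h2 : a = ⟨c' j, by omega⟩ := Fin.ext h1
      rw [h2, ext_apply_last, hlast]

end Shuffle

/-! ### Submodules of an outer tensor product with one factor not assumed simple -/

section PiOuterLattice

variable {F : Type*} [Field F] {r : ℕ} {A : Fin r → Type*} [∀ k, Ring (A k)] [∀ k, Algebra F (A k)]
  {M : Fin r → Type*} [∀ k, AddCommGroup (M k)] [∀ k, Module F (M k)] [∀ k, Module (A k) (M k)]
  [∀ k, IsScalarTower F (A k) (M k)]

variable (F) in
/-- A pure tensor in an outer tensor product. -/
def otprod (m : ∀ k, M k) : PiOuter F M := PiTensorProduct.tprod F m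

theorem tprod_smul_tprod (a : ∀ k, A k) (m : ∀ k, M k) :
    (PiTensorProduct.tprod F a • otprod F m)
      = otprod F fun k => a k • m k := by
  change piOuterHom F A M (PiTensorProduct.tprod F a) (PiTensorProduct.tprod F m) = _
  simp [piOuterHom, PiTensorProduct.mapMultilinear, otprod]

theorem single_smul_tprod (k : Fin r) (u : A k) (m : ∀ k, M k) :
    (PiTensorProduct.singleAlgHom (R := F) (A := A) k u
      • otprod F m)
      = otprod F (Function.update m k (u • m k)) := by
  rw [PiTensorProduct.singleAlgHom_apply, MonoidHom.mulSingle_apply, tprod_smul_tprod]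
  refine congrArg (PiTensorProduct.tprod F) (funext fun j => ?_)
  by_cases h : j = k
  · subst h; simp
  · simp [h]

omit [∀ k, Ring (A k)] [∀ k, Algebra F (A k)] [∀ k, Module (A k) (M k)]
  [∀ k, IsScalarTower F (A k) (M k)] in
theorem PiOuter.induction {p : PiOuter F M → Prop}
    (hadd : ∀ x y, p x → p y → p (x + y))
    (h : ∀ (t : F) (m : ∀ k, M k), p (t • otprod F m))
    (z : PiOuter F M) : p z :=
  PiTensorProduct.induction_on (R := F) (s := M) z (fun {t m} => h t m) (fun {x y} => hadd x y)

variable (F M) in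
/-- The tensor product of the factors different from the `k`-th one. -/
abbrev Rest (k : Fin r) : Type _ := ⨂[F] j : ({k}ᶜ : Set (Fin r)), M j

variable (F M) in
/-- Split off the `k`-th factor. -/
def splitEquiv (k : Fin r) : PiOuter F M ≃ₗ[F] Rest F M k ⊗[F] M k :=
  PiTensorProduct.equivPiTensorComplSingletonTensor F M k

theorem splitEquiv_tprod (k : Fin r) (m : ∀ k, M k) :
    splitEquiv F M k (otprod F m)
      = (PiTensorProduct.tprod F fun j : ({k}ᶜ : Set (Fin r)) => m j) ⊗ₜ[F] m k :=
  PiTensorProduct.equivPiTensorComplSingletonTensor_tprod (R := F) (M := M) k m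

theorem splitEquiv_tprod_smul (k : Fin r) (a : ∀ k, A k) (z : PiOuter F M) :
    splitEquiv F M k (PiTensorProduct.tprod F a • z)
      = TensorProduct.map (PiTensorProduct.map fun j : ({k}ᶜ : Set (Fin r)) =>
          (Algebra.lsmul F F (M j) (a j) : Module.End F (M j)))
          (Algebra.lsmul F F (M k) (a k) : Module.End F (M k)) (splitEquiv F M k z) := by
  induction z using PiOuter.induction with
  | hadd x y hx hy => simp only [smul_add, map_add, hx, hy]
  | h t m =>
    rw [smul_comm, tprod_smul_tprod, map_smul, map_smul, map_smul, splitEquiv_tprod,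
      splitEquiv_tprod, TensorProduct.map_tmul,
      PiTensorProduct.map_tprod]
    rfl

theorem tprod_ne_zero {ι : Type*} [Finite ι] {N : ι → Type*}
    [∀ i, AddCommGroup (N i)] [∀ i, Module F (N i)] (m : ∀ i, N i) (hm : ∀ i, m i ≠ 0) :
    PiTensorProduct.tprod F m ≠ 0 := by
  have := Fintype.ofFinite ι
  choose φ hφ using fun i => Module.Projective.exists_dual_eq_one F (hm i)
  intro h
  have h1 := congrArg (PiTensorProduct.lift
    ((MultilinearMap.mkPiRing F ι (1 : F)).compLinearMap φ)) h
  simp [hφ] at h1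

theorem nontrivial_piTensorProduct {ι : Type*} [Finite ι] {N : ι → Type*}
    [∀ i, AddCommGroup (N i)] [∀ i, Module F (N i)] [∀ i, Nontrivial (N i)] :
    Nontrivial (⨂[F] i, N i) := by
  choose m hm using fun i => exists_ne (0 : N i)
  exact ⟨_, 0, tprod_ne_zero m hm⟩

theorem finite_piTensorProduct {ι : Type*} [Finite ι] {N : ι → Type*}
    [∀ i, AddCommGroup (N i)] [∀ i, Module F (N i)] [∀ i, FiniteDimensional F (N i)] :
    FiniteDimensional F (⨂[F] i, N i) := by
  have := Fintype.ofFinite ι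
  exact Module.Finite.of_basis (Basis.piTensorProduct fun i => Module.finBasis F (N i))

section Simple

variable [IsAlgClosed F] (k : Fin r) [∀ j, FiniteDimensional F (M j)]
  (hM : ∀ j, j ≠ k → IsSimpleModule (A j) (M j))

include hM in
/-- A subspace that is stable under the algebras `A_j` with `j ≠ k` is stable under all
endomorphisms of the complement of the `k`-th factor. -/
theorem rTensor_mem_of_single_smul_mem (Y : Submodule F (PiOuter F M))
    (hY : ∀ a : ∀ j, A j, a k = 1 → ∀ z ∈ Y, PiTensorProduct.tprod F a • z ∈ Y)
    (T : Module.End F (Rest F M k)) (z : PiOuter F M) (hz : z ∈ Y) :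
    (splitEquiv F M k).symm (T.rTensor (M k) (splitEquiv F M k z)) ∈ Y := by
  have hT : T ∈ Submodule.span F (Set.range (PiTensorProduct.map (R := F)
      (s := fun j : ({k}ᶜ : Set (Fin r)) => M j) (t := fun j : ({k}ᶜ : Set (Fin r)) => M j))) := by
    rw [span_piTensorProduct_map]; trivial
  induction hT using Submodule.span_induction with
  | mem T hT =>
    obtain ⟨f, rfl⟩ := hT
    -- Burnside's theorem realizes each f_j with j ≠ k by an element of A_j; the entry at k is 1, so
    -- the k-th factor is left alone.
    have h1 : ∀ j : Fin r, ∃ a : A j, (j = k → a = 1) ∧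
        ∀ h : j ≠ k, ∀ m : M j, a • m = f ⟨j, h⟩ m := by
      intro j
      by_cases h : j = k
      · exact ⟨1, fun _ => rfl, fun h' => absurd h h'⟩
      · have := hM j h
        obtain ⟨a, ha⟩ := exists_smul_eq_end (A := A j) (f ⟨j, h⟩)
        exact ⟨a, fun h' => absurd h' h, fun _ => ha⟩
    choose a ha1 ha2 using h1
    have h2 := splitEquiv_tprod_smul k a z
    have h3 : (fun j : ({k}ᶜ : Set (Fin r)) => (Algebra.lsmul F F (M j) (a j) : Module.End F (M j)))
        = f := funext fun j => LinearMap.ext fun m => ha2 j j.2 m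
    rw [h3, ha1 k rfl, map_one] at h2
    change (splitEquiv F M k).symm (TensorProduct.map _ 1 _) ∈ Y
    rw [← h2, LinearEquiv.symm_apply_apply]
    exact hY a (ha1 k rfl) z hz
  | zero => simp
  | add S T _ _ hS hT =>
    rw [LinearMap.rTensor_add, LinearMap.add_apply, map_add]; exact Y.add_mem hS hT
  | smul t T _ hT =>
    rw [LinearMap.rTensor_smul, LinearMap.smul_apply, map_smul]; exact Y.smul_mem t hT

omit [IsAlgClosed F] [∀ j, FiniteDimensional F (M j)] in
theorem splitEquiv_symm_smul (u : A k) (w : Rest F M k) (x : M k) :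
    (splitEquiv F M k).symm (w ⊗ₜ (u • x))
      = PiTensorProduct.singleAlgHom (R := F) (A := A) k u • (splitEquiv F M k).symm (w ⊗ₜ x) := by
  rw [LinearEquiv.symm_apply_eq, PiTensorProduct.singleAlgHom_apply, splitEquiv_tprod_smul,
    LinearEquiv.apply_symm_apply, TensorProduct.map_tmul]
  have h : (fun j : ({k}ᶜ : Set (Fin r)) => (Algebra.lsmul F F (M j)
      (MonoidHom.mulSingle A k u j) : Module.End F (M j))) = fun _ => 1 :=
    funext fun j => by
      have : MonoidHom.mulSingle A k u j = 1 := Pi.mulSingle_eq_of_ne j.2 u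
      rw [this, map_one]
  rw [h, PiTensorProduct.map_one]
  simp

include hM in
/-- The lattice of submodules of an outer tensor product in which all factors but the `k`-th one are
simple. -/
theorem exists_piOuter_orderIso :
    ∃ e : Submodule (⨂[F] j, A j) (PiOuter F M) ≃o Submodule (A k) (M k),
      ∀ Y x, x ∈ e Y ↔ ∀ w, (splitEquiv F M k).symm (w ⊗ₜ x) ∈ Y := by
  have hnt : ∀ j : ({k}ᶜ : Set (Fin r)), Nontrivial (M j) := fun j => by
    have := hM j j.2
    exact IsSimpleModule.nontrivial (A j) (M j)
  have : Nontrivial (Rest F M k) := nontrivial_piTensorProduct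
  have : FiniteDimensional F (Rest F M k) := finite_piTensorProduct
  refine exists_orderIso_tens (splitEquiv F M k) (fun K a z hz => ?_) (fun Y T z hz => ?_)
    (fun Y x hx b w => ?_)
  · induction a using PiTensorProduct.induction_on with
    | smul_tprod t a =>
      rw [smul_assoc, map_smul]
      refine Submodule.smul_mem _ t ?_
      rw [splitEquiv_tprod_smul]
      refine tens_induction (p := fun y => TensorProduct.map _ _ y ∈ _) ?_ ?_ ?_ hz
      · rw [map_zero]; exact Submodule.zero_mem _
      · intro x y hx hy; rw [map_add]; exact Submodule.add_mem _ hx hy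
      · intro w x hx
        rw [TensorProduct.map_tmul]
        exact tmul_mem_tens _ (K.smul_mem _ hx)
    | add a b ha hb =>
      rw [add_smul, map_add]; exact Submodule.add_mem _ ha hb
  · exact rTensor_mem_of_single_smul_mem k hM (Y.restrictScalars F)
      (fun a _ z hz => Y.smul_mem _ hz) T z hz
  · rw [splitEquiv_symm_smul]
    exact Y.smul_mem _ (hx w)

end Simple

section Map

variable {A' : Fin r → Type*} [∀ k, Ring (A' k)] [∀ k, Algebra F (A' k)]
  {M' : Fin r → Type*} [∀ k, AddCommGroup (M' k)] [∀ k, Module F (M' k)] [∀ k, Module (A' k) (M' k)]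
  [∀ k, IsScalarTower F (A' k) (M' k)]

/-- The tensor product of linear maps, as a map of outer tensor products. -/
def outerMap (θ : ∀ j, M' j →ₗ[F] M j) : PiOuter F M' →ₗ[F] PiOuter F M := PiTensorProduct.map θ

omit [∀ k, Ring (A k)] [∀ k, Algebra F (A k)] [∀ k, Module (A k) (M k)]
  [∀ k, IsScalarTower F (A k) (M k)] [∀ k, Ring (A' k)] [∀ k, Algebra F (A' k)]
  [∀ k, Module (A' k) (M' k)] [∀ k, IsScalarTower F (A' k) (M' k)] in
theorem outerMap_otprod (θ : ∀ j, M' j →ₗ[F] M j) (m : ∀ j, M' j) :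
    outerMap θ (otprod F m) = otprod F fun j => θ j (m j) := PiTensorProduct.map_tprod θ m

theorem outerMap_tprod_smul (θ : ∀ j, M' j →ₗ[F] M j) (a' : ∀ j, A' j) (a : ∀ j, A j)
    (h : ∀ j m, θ j (a' j • m) = a j • θ j m) (z : PiOuter F M') :
    outerMap θ (PiTensorProduct.tprod F a' • z) = PiTensorProduct.tprod F a • outerMap θ z := by
  induction z using PiOuter.induction with
  | hadd x y hx hy => simp only [smul_add, map_add, hx, hy]
  | h t m =>
    rw [smul_comm, tprod_smul_tprod, map_smul, map_smul, smul_comm _ t, outerMap_otprod,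
      outerMap_otprod, tprod_smul_tprod]
    simp only [h]

theorem piTensorProduct_map_injective {ι : Type*} {N N' : ι → Type*} [∀ i, AddCommGroup (N i)]
    [∀ i, Module F (N i)] [∀ i, AddCommGroup (N' i)] [∀ i, Module F (N' i)]
    (θ : ∀ i, N' i →ₗ[F] N i) (hθ : ∀ i, Function.Injective (θ i)) :
    Function.Injective (PiTensorProduct.map θ) := by
  choose g hg using fun i => (θ i).exists_leftInverse_of_injective (LinearMap.ker_eq_bot.2 (hθ i))
  have h := PiTensorProduct.map_comp g θ
  simp only [hg, PiTensorProduct.map_id] at h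
  exact Function.LeftInverse.injective (g := PiTensorProduct.map g) fun z =>
    (LinearMap.congr_fun h z).symm

end Map

end PiOuterLattice

/-! ### Submodules of V^{⊗m} ⊗ L -/

section FactorLattice

set_option linter.unusedSectionVars false

variable {F : Type*} [Field F] [IsAlgClosed F] {G : Type*} [Group G] [Fintype G]
  {V : Type*} [AddCommGroup V] [Module F V] [FiniteDimensional F V] (ρ : Representation F G V)
  [ρ.IsIrreducible] (m : ℕ)

theorem scale_ne_zero (c : F) : scale c ≠ 0 := by
  by_cases h : c = 0 <;> simp [scale, h]

omit [IsAlgClosed F] [FiniteDimensional F V] [ρ.IsIrreducible] in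
theorem sum_smul_tensorPow_mulSingle (i : Fin m) (e : G → F) (T : Module.End F V)
    (h : ∀ v, ∑ g, e g • ρ g v = T v) :
    ∑ g, e g • tensorPow ρ (Pi.mulSingle i g : Fin m → G)
      = PiTensorProduct.map (Pi.mulSingle i T : Fin m → Module.End F V) := by
  ext v
  have h1 : ∀ S : Module.End F V,
      (fun j => (Pi.mulSingle i S : Fin m → Module.End F V) j (v j)) = Function.update v i (S (v i)) := by
    intro S
    funext j
    by_cases hj : j = i
    · subst hj; simp
    · simp [hj]
  have h2 : ∀ g, (fun j => ρ ((Pi.mulSingle i g : Fin m → G) j) (v j))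
      = Function.update v i (ρ g (v i)) := by
    intro g
    funext j
    by_cases hj : j = i
    · subst hj; simp
    · simp [hj]
  simp only [LinearMap.compMultilinearMap_apply, LinearMap.sum_apply, LinearMap.smul_apply,
    tensorPow_tprod, PiTensorProduct.map_tprod, h1, h2]
  rw [← h, MultilinearMap.map_update_sum]
  exact Finset.sum_congr rfl fun g _ => (MultilinearMap.map_update_smul _ _ _ _ _).symm

/-- The group algebra maps onto End(V) because V is irreducible. Used at one tensor factor at a
time, this lets G^m generate all tensor products of endomorphisms, and these span End(V^{⊗m}). -/
theorem rTensor_mem_of_tensorPow {L : Type*} [AddCommGroup L] [Module F L]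
    (Y : Submodule F ((⨂[F] _ : Fin m, V) ⊗[F] L))
    (hY : ∀ a : Fin m → G, ∀ z ∈ Y, (tensorPow ρ a).rTensor L z ∈ Y)
    (T : Module.End F (⨂[F] _ : Fin m, V)) (z) (hz : z ∈ Y) : T.rTensor L z ∈ Y := by
  have hT : T ∈ Submodule.span F (Set.range (PiTensorProduct.map (R := F)
      (s := fun _ : Fin m => V) (t := fun _ : Fin m => V))) := by
    rw [span_piTensorProduct_map]; trivial
  induction hT using Submodule.span_induction with
  | mem T hT =>
    obtain ⟨f, rfl⟩ := hT
    let X : Submonoid (Fin m → Module.End F V) :=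
      { carrier := {f | ∀ z ∈ Y, (PiTensorProduct.map f).rTensor L z ∈ Y}
        one_mem' := fun z hz => by
          have h : PiTensorProduct.map (1 : Fin m → Module.End F V) = 1 := PiTensorProduct.map_one
          rw [h]
          change (LinearMap.id.rTensor L) z ∈ Y
          rwa [LinearMap.rTensor_id]
        mul_mem' := fun {f g} hf hg z hz => by
          have h : PiTensorProduct.map (f * g) = PiTensorProduct.map f * PiTensorProduct.map g :=
            PiTensorProduct.map_mul f g
          rw [h, LinearMap.rTensor_mul]
          exact hf _ (hg z hz) }
    have hX : f ∈ X := Submonoid.pi_mem_of_mulSingle_mem f fun i z hz => by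
      obtain ⟨e, he⟩ := exists_coeff_single ρ (f i)
      rw [← sum_smul_tensorPow_mulSingle ρ m i e (f i) fun v => by
        simpa [LinearMap.sum_apply] using LinearMap.congr_fun he v]
      have h : (∑ g, e g • tensorPow ρ (Pi.mulSingle i g : Fin m → G)).rTensor L z
          = ∑ g, e g • (tensorPow ρ (Pi.mulSingle i g : Fin m → G)).rTensor L z := by
        simp only [← LinearMap.coe_rTensorHom, map_sum, map_smul, LinearMap.sum_apply,
          LinearMap.smul_apply]
      rw [h]
      exact Submodule.sum_mem _ fun g _ => Y.smul_mem _ (hY _ z hz)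
    exact hX z hz
  | zero => simp
  | add S T _ _ hS hT => rw [LinearMap.rTensor_add, LinearMap.add_apply]; exact Y.add_mem hS hT
  | smul t T _ hT => rw [LinearMap.rTensor_smul, LinearMap.smul_apply]; exact Y.smul_mem t hT

omit [IsAlgClosed F] [ρ.IsIrreducible] in
theorem nontrivial_of_isIrreducible [ρ.IsIrreducible] : Nontrivial V := by
  by_contra h
  rw [not_nontrivial_iff_subsingleton] at h
  have h1 : (⊥ : Subrepresentation ρ) ≠ ⊤ := bot_ne_top
  apply h1
  ext w
  simp [Subsingleton.elim w 0]

variable (L : Type*) [AddCommGroup L] [Module F L] [Module (DHecke F (twist (flipScalar ρ)) m) L]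
  [IsScalarTower F (DHecke F (twist (flipScalar ρ)) m) L]

/-- The space underlying `V^{⊗ m} ⊗ L`. -/
def factorEquiv : Factor ρ m L ≃ₗ[F] (⨂[F] _ : Fin m, V) ⊗[F] L := LinearEquiv.refl F _

theorem factorEquiv_gen_smul (a : Gen G m) (z : Factor ρ m L) :
    factorEquiv ρ m L (WHecke.gen F a • z) = factorGen ρ m L a (factorEquiv ρ m L z) := by
  change factorHom ρ m L (WHecke.gen F a) z = _
  rw [factorHom, WHecke.lift_gen]
  rfl

/-- The element `v ⊗ z` of `V^{⊗ m} ⊗ L`. -/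
def factorMk (v : ⨂[F] _ : Fin m, V) (z : L) : Factor ρ m L := v ⊗ₜ[F] z

variable {m L}

theorem gen_g_smul_factorMk (a : Fin m → G) (v : ⨂[F] _ : Fin m, V) (z : L) :
    WHecke.gen F (.g a) • factorMk ρ m L v z = factorMk ρ m L (tensorPow ρ a v) z :=
  factorEquiv_gen_smul ρ m L _ _

theorem gen_x_smul_factorMk (i : Fin m) (v : ⨂[F] _ : Fin m, V) (z : L) :
    (WHecke.gen F (.x i) : WHecke F G m) • factorMk ρ m L v z
      = scale (flipScalar ρ) • factorMk ρ m L v (DHecke.gen F (twist (flipScalar ρ)) (.y i) • z) :=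
  (factorEquiv_gen_smul ρ m L _ _).trans (TensorProduct.tmul_smul _ _ _)

theorem gen_s_smul_factorMk (i : ℕ) (hi : i + 1 < m) (v : ⨂[F] _ : Fin m, V) (z : L) :
    (WHecke.gen F (.s i hi) : WHecke F G m) • factorMk ρ m L v z = factorMk ρ m L (permute F V (adj i hi) v)
      (DHecke.gen F (twist (flipScalar ρ)) (.s i hi) • z) :=
  factorEquiv_gen_smul ρ m L _ _

variable (m)

theorem permute_adj_permute_adj (i : ℕ) (hi : i + 1 < m) (v : ⨂[F] _ : Fin m, V) :
    permute F V (adj i hi) (permute F V (adj i hi) v) = v := by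
  rw [← Module.End.mul_apply, ← permute_mul, Equiv.swap_mul_self, permute_one]; rfl

/-- The factor between x_i and y_i is never zero, also when c = 0, so y_i can be recovered from x_i.
-/
theorem y_mem_of_x_smul_mem {Y : Submodule F (Factor ρ m L)} {i : Fin m}
    (hY : ∀ z ∈ Y, (WHecke.gen F (.x i) : WHecke F G m) • z ∈ Y) {x : L} (hx : ∀ w, factorMk ρ m L w x ∈ Y)
    (w : ⨂[F] _ : Fin m, V) :
    factorMk ρ m L w (DHecke.gen F (twist (flipScalar ρ)) (.y i) • x) ∈ Y := by
  have h := hY _ (hx w)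
  rw [gen_x_smul_factorMk] at h
  exact (Y.smul_mem_iff (scale_ne_zero _)).1 h

/-- The reflection acts on both factors at once. As w runs through all of V^{⊗m}, starting from the
permuted tensor undoes the effect on the first factor. -/
theorem s_mem_of_s_smul_mem {Y : Submodule F (Factor ρ m L)} {i : ℕ} {hi : i + 1 < m}
    (hY : ∀ z ∈ Y, (WHecke.gen F (.s i hi) : WHecke F G m) • z ∈ Y) {x : L} (hx : ∀ w, factorMk ρ m L w x ∈ Y)
    (w : ⨂[F] _ : Fin m, V) :
    factorMk ρ m L w (DHecke.gen F (twist (flipScalar ρ)) (.s i hi) • x) ∈ Y := by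
  have h := hY _ (hx (permute F V (adj i hi) w))
  rwa [gen_s_smul_factorMk, permute_adj_permute_adj] at h

variable (L) in
/-- The lattice of submodules of `V^{⊗ m} ⊗ L`. -/
theorem exists_factor_orderIso :
    ∃ e : Submodule (WHecke F G m) (Factor ρ m L)
        ≃o Submodule (DHecke F (twist (flipScalar ρ)) m) L,
      ∀ Y x, x ∈ e Y ↔ ∀ w, factorMk ρ m L w x ∈ Y := by
  have := nontrivial_of_isIrreducible ρ
  have : Nontrivial (⨂[F] _ : Fin m, V) := nontrivial_piTensorProduct
  have : FiniteDimensional F (⨂[F] _ : Fin m, V) := finite_piTensorProduct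
  refine exists_orderIso_tens (factorEquiv ρ m L) (fun K a z hz => ?_) (fun Y T z hz => ?_)
    (fun Y x hx b w => ?_)
  · have ha : a ∈ Algebra.adjoin F (Set.range (WHecke.gen F (G := G) (n := m))) := by
      rw [WHecke.adjoin_gen]; trivial
    induction ha using Algebra.adjoin_induction generalizing z with
    | mem a ha =>
      obtain ⟨a, rfl⟩ := ha
      rw [factorEquiv_gen_smul]
      refine tens_induction (p := fun y => factorGen ρ m L a y ∈ _) ?_ ?_ ?_ hz
      · rw [map_zero]; exact Submodule.zero_mem _
      · intro x y hx hy; rw [map_add]; exact Submodule.add_mem _ hx hy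
      · intro w x hx
        cases a with
        | g a => exact tmul_mem_tens _ hx
        | x i => exact tmul_mem_tens _ (Submodule.smul_mem _ _ (K.smul_mem _ hx))
        | s i hi => exact tmul_mem_tens _ (K.smul_mem _ hx)
    | algebraMap t =>
      rw [algebraMap_smul, map_smul]; exact Submodule.smul_mem _ _ hz
    | add a b _ _ ha hb => rw [add_smul, map_add]; exact Submodule.add_mem _ (ha z hz) (hb z hz)
    | mul a b _ _ ha hb => rw [mul_smul]; exact ha _ (hb z hz)
  · exact rTensor_mem_of_tensorPow ρ m (Y.restrictScalars F)
      (fun a z hz => (congrArg (· ∈ Y) (factorEquiv_gen_smul ρ m L (.g a) z)).mp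
        (Y.smul_mem (WHecke.gen F (.g a)) hz)) T z hz
  · change ∀ w, factorMk ρ m L w x ∈ Y at hx
    change factorMk ρ m L w (b • x) ∈ Y
    have hb : b ∈ Algebra.adjoin F (Set.range (DHecke.gen F (twist (flipScalar ρ)) (n := m))) := by
      rw [DHecke.adjoin_gen]; trivial
    induction hb using Algebra.adjoin_induction generalizing x w with
    | mem b hb =>
      obtain ⟨b, rfl⟩ := hb
      cases b with
      | y i =>
        exact y_mem_of_x_smul_mem ρ m (Y := Y.restrictScalars F)
          (fun z hz => Y.smul_mem _ hz) hx w
      | s i hi =>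
        exact s_mem_of_s_smul_mem ρ m (Y := Y.restrictScalars F)
          (fun z hz => Y.smul_mem _ hz) hx w
    | algebraMap t =>
      rw [algebraMap_smul]
      have h : factorMk ρ m L w (t • x) = t • factorMk ρ m L w x := TensorProduct.tmul_smul _ _ _
      rw [h]
      exact (Y.restrictScalars F).smul_mem t (hx w)
    | add a b _ _ ha hb =>
      rw [add_smul]
      have h : factorMk ρ m L w (a • x + b • x) = factorMk ρ m L w (a • x) + factorMk ρ m L w (b • x) :=
        TensorProduct.tmul_add _ _ _
      rw [h]
      exact Y.add_mem (ha x w hx) (hb x w hx)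
    | mul a b _ _ ha hb => rw [mul_smul]; exact ha (b • x) w fun w => hb x w hx

end FactorLattice

/-! ### Elements of the group algebra that separate the V_k -/

section Blocks

set_option linter.unusedSectionVars false

variable {F : Type*} [Field F] [IsAlgClosed F] {G : Type*} [Group G] [Fintype G]

section

variable {V : Type*} [AddCommGroup V] [Module F V] [FiniteDimensional F V] (ρ : Representation F G V)
  [ρ.IsIrreducible] {m : ℕ} {L : Type*} [AddCommGroup L] [Module F L]
  [Module (DHecke F (twist (flipScalar ρ)) m) L]
  [IsScalarTower F (DHecke F (twist (flipScalar ρ)) m) L]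

theorem sum_smul_gen_g_mulSingle (i : Fin m) (e : G → F) (T : Module.End F V)
    (h : ∀ v, ∑ g, e g • ρ g v = T v) (z : Factor ρ m L) :
    factorEquiv ρ m L (∑ g, e g • WHecke.gen F (.g (Pi.mulSingle i g : Fin m → G)) • z)
      = (PiTensorProduct.map (Pi.mulSingle i T : Fin m → Module.End F V)).rTensor L
          (factorEquiv ρ m L z) := by
  rw [← sum_smul_tensorPow_mulSingle ρ m i e T h]
  simp only [map_sum, map_smul, factorEquiv_gen_smul, ← LinearMap.coe_rTensorHom,
    LinearMap.sum_apply, LinearMap.smul_apply]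
  rfl

theorem sum_smul_gen_g_of_one (i : Fin m) (e : G → F) (h : ∀ v, ∑ g, e g • ρ g v = v)
    (z : Factor ρ m L) : ∑ g, e g • WHecke.gen F (.g (Pi.mulSingle i g : Fin m → G)) • z = z := by
  refine (factorEquiv ρ m L).injective ?_
  rw [sum_smul_gen_g_mulSingle ρ i e 1 h, Pi.mulSingle_one]
  have h1 : PiTensorProduct.map (1 : Fin m → Module.End F V) = LinearMap.id :=
    PiTensorProduct.map_one
  rw [h1, LinearMap.rTensor_id]; rfl

theorem sum_smul_gen_g_of_zero (i : Fin m) (e : G → F) (h : ∀ v, ∑ g, e g • ρ g v = 0)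
    (z : Factor ρ m L) : ∑ g, e g • WHecke.gen F (.g (Pi.mulSingle i g : Fin m → G)) • z = 0 := by
  refine (factorEquiv ρ m L).injective ?_
  rw [sum_smul_gen_g_mulSingle ρ i e 0 h]
  have h1 : PiTensorProduct.map (Pi.mulSingle i 0 : Fin m → Module.End F V) = 0 :=
    (PiTensorProduct.mapMultilinear F (fun _ : Fin m => V) (fun _ : Fin m => V)).map_coord_zero i
      (by simp)
  rw [h1, LinearMap.rTensor_zero]; simp

theorem isSimpleModule_factor [IsSimpleModule (DHecke F (twist (flipScalar ρ)) m) L] :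
    IsSimpleModule (WHecke F G m) (Factor ρ m L) :=
  isSimpleModule_of_orderIso (exists_factor_orderIso ρ m L).choose

theorem isSemisimpleModule_factor [IsSemisimpleModule (DHecke F (twist (flipScalar ρ)) m) L] :
    IsSemisimpleModule (WHecke F G m) (Factor ρ m L) :=
  isSemisimpleModule_of_orderIso (exists_factor_orderIso ρ m L).choose

theorem finite_factor [FiniteDimensional F L] : FiniteDimensional F (Factor ρ m L) := by
  have : FiniteDimensional F (⨂[F] _ : Fin m, V) := finite_piTensorProduct
  exact inferInstanceAs (FiniteDimensional F ((⨂[F] _ : Fin m, V) ⊗[F] L))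

end

variable {r : ℕ} {V : Fin r → Type*} [∀ k, AddCommGroup (V k)] [∀ k, Module F (V k)]
  [∀ k, FiniteDimensional F (V k)] {ρ : ∀ k, Representation F G (V k)} [∀ k, (ρ k).IsIrreducible]

/-- Coefficients of elements of the group algebra that act on `V_l` as the identity and on the
other `V_k` as zero. -/
def IsSeparating (ρ : ∀ k, Representation F G (V k)) (ε : Fin r → G → F) : Prop :=
  ∀ l k v, ∑ g, ε l g • ρ k g v = if k = l then v else 0

theorem exists_isSeparating (hρ : ∀ j k, j ≠ k → IsEmpty ((ρ j).Equiv (ρ k))) :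
    ∃ ε : Fin r → G → F, IsSeparating ρ ε := by
  choose ε hε using fun l => exists_coeff ρ hρ fun k => if k = l then 1 else 0
  refine ⟨ε, fun l k v => ?_⟩
  rw [hε]
  split_ifs <;> rfl

theorem IsSeparating.sum_smul {ε : Fin r → G → F} (hε : IsSeparating ρ ε) (l k : Fin r) {m : ℕ}
    {L : Type*} [AddCommGroup L] [Module F L] [Module (DHecke F (twist (flipScalar (ρ k))) m) L]
    [IsScalarTower F (DHecke F (twist (flipScalar (ρ k))) m) L] (i : Fin m) (z : Factor (ρ k) m L) :
    ∑ g, ε l g • WHecke.gen F (.g (Pi.mulSingle i g : Fin m → G)) • z = if k = l then z else 0 := by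
  by_cases h : k = l
  · rw [if_pos h]
    exact sum_smul_gen_g_of_one (ρ k) i (ε l) (fun v => by rw [hε, if_pos h]) z
  · rw [if_neg h]
    exact sum_smul_gen_g_of_zero (ρ k) i (ε l) (fun v => by rw [hε, if_neg h]) z

theorem IsSeparating.isBlockIdempotent {ε : Fin r → G → F} (hε : IsSeparating ρ ε)
    (L : Family ρ) : IsBlockIdempotent (c := fun k => (L k).rank)
      (PiOuter F fun k => Factor (ρ k) (L k).rank (L k).carrier) ε := by
  intro l p v
  induction v using PiOuter.induction with
  | hadd x y hx hy =>
    simp only [smul_add, Finset.sum_add_distrib, hx, hy]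
    split_ifs <;> simp
  | h t m =>
    have h1 : ∀ g, ε l g • gP F (Pi.mulSingle p g) • t • otprod F m
        = t • ε l g • otprod F (Function.update m p.1
            (WHecke.gen F (.g (Pi.mulSingle p.2 g)) • m p.1)) := by
      intro g
      rw [gP_mulSingle, smul_comm _ t, smul_comm _ t, single_smul_tprod]
    have h2 : ∑ g, ε l g • otprod F (Function.update m p.1
          (WHecke.gen F (.g (Pi.mulSingle p.2 g)) • m p.1))
        = otprod F (Function.update m p.1
          (∑ g, ε l g • WHecke.gen F (.g (Pi.mulSingle p.2 g)) • m p.1)) := by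
      refine Eq.trans ?_ ((PiTensorProduct.tprod F).map_update_sum _ _ _ _).symm
      exact Finset.sum_congr rfl fun g _ =>
        ((PiTensorProduct.tprod F).map_update_smul m p.1 (ε l g) _).symm
    rw [Finset.sum_congr rfl fun g _ => h1 g, ← Finset.smul_sum, h2, hε.sum_smul]
    by_cases h : p.1 = l
    · rw [if_pos h, if_pos h, Function.update_eq_self]
    · rw [if_neg h, if_neg h]
      have h3 : otprod F (Function.update m p.1 0) = 0 :=
        (PiTensorProduct.tprod F).map_coord_zero p.1 (by simp)
      rw [h3, smul_zero]

end Blocks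

/-! ### The module ẽ_a N and the last polynomial generator -/

section ETilde

set_option linter.unusedSectionVars false

variable {F : Type*} [Field F] [IsAlgClosed F] {u : F} {n : ℕ}

theorem isSemisimpleModule_socle (A M : Type*) [Ring A] [AddCommGroup M] [Module A M] :
    IsSemisimpleModule A (socle A M) := by
  have h : ∀ N ∈ {N : Submodule A M | IsSimpleModule A N}, IsSemisimpleModule A N := fun N hN => by
    have : IsSimpleModule A N := hN
    infer_instance
  rw [socle, sSup_eq_iSup]
  exact isSemisimpleModule_biSup_of_isSemisimpleModule_submodule h

theorem le_socle_of_isSimpleModule {A M : Type*} [Ring A] [AddCommGroup M] [Module A M]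
    (N : Submodule A M) [h : IsSimpleModule A N] : N ≤ socle A M := le_sSup h

namespace DHecke

variable (N : Type*) [AddCommGroup N] [Module F N] [Module (DHecke F u (n + 1)) N]
  [IsScalarTower F (DHecke F u (n + 1)) N]

theorem ySum_succ : ySum F u (n + 1) = toSucc F u n (ySum F u n) + gen F u (.y (Fin.last n)) := by
  rw [ySum, ySum, Fin.sum_univ_castSucc, map_sum]
  congr 1
  exact Finset.sum_congr rfl fun i _ => (toSucc_gen (.y i)).symm

variable {N}

/-- The sums of the polynomial generators are central in the algebras of rank n + 1 and n, so by
Schur's lemma they are scalars on N and on S. Their difference is the last generator. -/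
theorem exists_last_eq_smul [IsSimpleModule (DHecke F u (n + 1)) N]
    {S : Type*} [AddCommGroup S] [Module F S] [Module (DHecke F u n) S]
    [IsScalarTower F (DHecke F u n) S] [IsSimpleModule (DHecke F u n) S]
    (i : S →ₗ[F] N) (hi : ∀ (a : DHecke F u n) x, i (a • x) = toSucc F u n a • i x) :
    ∃ b : F, ∀ x : S, gen F u (.y (Fin.last n)) • i x = b • i x := by
  have := finite_of_isSimpleModule (F := F) (u := u) (n := n) S
  have := finite_of_isSimpleModule (F := F) (u := u) (n := n + 1) N
  obtain ⟨b₁, h₁⟩ := exists_scalar_of_commute (F := F) (L := S) (ySum F u n) commute_ySum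
  obtain ⟨b₂, h₂⟩ := exists_scalar_of_commute (F := F) (L := N) (ySum F u (n + 1)) commute_ySum
  refine ⟨b₂ - b₁, fun x => ?_⟩
  have h := h₂ (i x)
  rw [ySum_succ, add_smul, ← hi, h₁, map_smul] at h
  rw [sub_smul, ← h, add_sub_cancel_left]

variable (N) in
/-- The inclusion of `ẽ_a N` into `N`. -/
def socleIncl (a : F) : socle (DHecke F u n) (eMod (u := u) (n := n) N a) →ₗ[F] N where
  toFun z := z.1.1
  map_add' _ _ := rfl
  map_smul' _ _ := rfl

theorem socleIncl_injective (a : F) : Function.Injective (socleIncl (u := u) (n := n) N a) :=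
  fun _ _ h => Subtype.ext (Subtype.ext h)

theorem eq_of_mem_maxGenEigenspace {f : Module.End F N} {a b : F} {x : N} (hx : x ≠ 0)
    (hb : f x = b • x) (ha : x ∈ f.maxGenEigenspace a) : b = a := by
  have h1 : x ∈ f.maxGenEigenspace b :=
    (Module.End.mem_maxGenEigenspace f b x).2 ⟨1, by simp [hb]⟩
  by_contra h
  have h2 := (Module.End.disjoint_genEigenspace f h ⊤ ⊤).le_bot ⟨h1, ha⟩
  exact hx h2

/-- On a simple submodule of e_a N the last generator is a scalar, and this scalar is a because the
submodule lies in the generalized a-eigenspace. So the socle consists of true eigenvectors, as the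
tensor factor L(a) requires. -/
theorem last_smul_socleIncl [IsSimpleModule (DHecke F u (n + 1)) N] (a : F)
    (z : socle (DHecke F u n) (eMod (u := u) (n := n) N a)) :
    gen F u (.y (Fin.last n)) • socleIncl N a z = a • socleIncl N a z := by
  let X : Submodule (DHecke F u n) (eMod (u := u) (n := n) N a) :=
    { carrier := {x | gen F u (.y (Fin.last n)) • (show N from x.1) = a • (show N from x.1)}
      add_mem' := fun {x y} hx hy => by
        change gen F u (.y (Fin.last n)) • ((show N from x.1) + (show N from y.1)) = _
        rw [smul_add, hx, hy, ← smul_add]; rfl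
      zero_mem' := by
        change gen F u (.y (Fin.last n)) • (0 : N) = a • (0 : N)
        rw [smul_zero, smul_zero]
      smul_mem' := fun h x hx => by
        change gen F u (.y (Fin.last n)) • toSucc F u n h • (show N from x.1)
          = a • toSucc F u n h • (show N from x.1)
        rw [← mul_smul, (commute_last h).eq, mul_smul, hx, smul_comm] }
  have hX : socle (DHecke F u n) (eMod (u := u) (n := n) N a) ≤ X := by
    refine sSup_le fun S hS => ?_
    have : IsSimpleModule (DHecke F u n) S := hS
    let i : S →ₗ[F] N :=
      { toFun := fun x => x.1.1, map_add' := fun _ _ => rfl, map_smul' := fun _ _ => rfl }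
    obtain ⟨b, hb⟩ := exists_last_eq_smul (u := u) (n := n) i fun _ _ => rfl
    intro x hx
    change gen F u (.y (Fin.last n)) • (show N from x.1) = a • (show N from x.1)
    by_cases h0 : (show N from x.1) = 0
    · rw [h0, smul_zero, smul_zero]
    · have h1 : gen F u (.y (Fin.last n)) • (show N from x.1) = b • (show N from x.1) :=
        hb ⟨x, hx⟩
      rw [h1, eq_of_mem_maxGenEigenspace h0 h1 x.2]
  exact hX z.2

/-- By finite dimension K contains a simple module for the algebra of rank n. The last generator
acts on it by some scalar a, so it lies in e_a N and therefore in its socle. K need not be stable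
under the last generator. -/
theorem exists_socleIncl_mem [IsSimpleModule (DHecke F u (n + 1)) N] (K : Submodule F N)
    (hK : K ≠ ⊥) (hs : ∀ a : DGen n, ∀ z ∈ K, gen F u (succGen a) • z ∈ K) :
    ∃ a z, z ≠ 0 ∧ socleIncl (u := u) (n := n) N a z ∈ K := by
  have hfin := finite_of_isSimpleModule (F := F) (u := u) (n := n + 1) N
  let K' : Submodule (DHecke F u n) (Res (toSucc F u n) N) :=
    { K with
      smul_mem' := fun h z hz => by
        change toSucc F u n h • (show N from z) ∈ K
        have hh : h ∈ Algebra.adjoin F (Set.range (gen F u (n := n))) := by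
          rw [adjoin_gen]; trivial
        induction hh using Algebra.adjoin_induction generalizing z with
        | mem h hh => obtain ⟨a, rfl⟩ := hh; rw [toSucc_gen]; exact hs a _ hz
        | algebraMap t => rw [AlgHom.commutes, algebraMap_smul]; exact K.smul_mem t hz
        | add v w _ _ hv hw => rw [map_add, add_smul]; exact K.add_mem (hv z hz) (hw z hz)
        | mul v w _ _ hv hw => rw [map_mul, mul_smul]; exact hv _ (hw z hz) }
  have hK' : K' ≠ ⊥ := fun h => hK (by
    refine (Submodule.eq_bot_iff K).2 fun x hx => ?_
    have h1 : (show Res (toSucc F u n) N from x) ∈ K' := hx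
    rw [h] at h1
    exact h1)
  have : IsArtinian (DHecke F u n) (Res (toSucc F u n) N) :=
    isArtinian_of_tower F (inferInstanceAs (IsArtinian F N))
  obtain ⟨S, hS, hSK⟩ := (eq_bot_or_exists_atom_le K').resolve_left hK'
  have hsimp : IsSimpleModule (DHecke F u n) S := isSimpleModule_iff_isAtom.2 hS
  let i : S →ₗ[F] N :=
    { toFun := fun x => x.1, map_add' := fun _ _ => rfl, map_smul' := fun _ _ => rfl }
  obtain ⟨a, ha⟩ := exists_last_eq_smul (u := u) (n := n) i fun _ _ => rfl
  have hle : S ≤ eMod (u := u) (n := n) N a := fun x hx =>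
    (Module.End.mem_maxGenEigenspace _ _ _).2 ⟨1, by
      have h1 : gen F u (.y (Fin.last n)) • (show N from x) = a • (show N from x) := ha ⟨x, hx⟩
      simp only [pow_one]
      exact sub_eq_zero.2 h1⟩
  let j : S →ₗ[DHecke F u n] eMod (u := u) (n := n) N a := Submodule.inclusion hle
  have hj : Function.Injective j := Submodule.inclusion_injective hle
  have h2 : IsSimpleModule (DHecke F u n) (LinearMap.range j) :=
    IsSimpleModule.congr (LinearEquiv.ofInjective j hj).symm
  obtain ⟨x, hx⟩ : ∃ x : S, x ≠ 0 := by
    have := IsSimpleModule.nontrivial (DHecke F u n) S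
    exact exists_ne 0
  have h3 : j x ∈ socle (DHecke F u n) (eMod (u := u) (n := n) N a) :=
    le_socle_of_isSimpleModule (LinearMap.range j) ⟨x, rfl⟩
  refine ⟨a, ⟨j x, h3⟩, fun h => hx (hj ?_), hSK x.2⟩
  rw [map_zero]
  exact congrArg Subtype.val h

end DHecke

namespace DMod

/-- The inclusion of `ẽ_a M` into `M`. -/
def eTildeIncl (a : F) : (M : DMod F u) → (M.eTilde a).carrier →ₗ[F] M.carrier
  | @DMod.mk _ _ _ 0 _ _ _ _ _ => 0
  | @DMod.mk _ _ _ (_ + 1) N _ _ _ _ => DHecke.socleIncl N a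

variable (M : DMod F u) (hM : 0 < M.rank)

include hM

theorem eTildeIncl_injective (a : F) : Function.Injective (M.eTildeIncl a) := by
  obtain ⟨n, N⟩ := M
  obtain _ | n := n
  · exact absurd hM (lt_irrefl 0)
  · exact DHecke.socleIncl_injective a

theorem eTildeIncl_y (a : F) (i : ℕ) (hi : i < (M.eTilde a).rank) (hi' : i < M.rank)
    (z : (M.eTilde a).carrier) : M.eTildeIncl a (DHecke.gen F u (.y ⟨i, hi⟩) • z)
      = DHecke.gen F u (.y ⟨i, hi'⟩) • M.eTildeIncl a z := by
  obtain ⟨n, N⟩ := M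
  obtain _ | n := n
  · exact absurd hM (lt_irrefl 0)
  · exact congrArg (fun h : DHecke F u (n + 1) => h • DHecke.socleIncl N a z)
      (DHecke.toSucc_gen (n := n) (.y ⟨i, hi⟩))

theorem eTildeIncl_s (a : F) (i : ℕ) (hi : i + 1 < (M.eTilde a).rank) (hi' : i + 1 < M.rank)
    (z : (M.eTilde a).carrier) : M.eTildeIncl a (DHecke.gen F u (.s i hi) • z)
      = DHecke.gen F u (.s i hi') • M.eTildeIncl a z := by
  obtain ⟨n, N⟩ := M
  obtain _ | n := n
  · exact absurd hM (lt_irrefl 0)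
  · exact congrArg (fun h : DHecke F u (n + 1) => h • DHecke.socleIncl N a z)
      (DHecke.toSucc_gen (n := n) (.s i hi))

theorem last_smul_eTildeIncl [IsSimpleModule (DHecke F u M.rank) M.carrier] (a : F) (i : ℕ)
    (hi : i + 1 = M.rank) (z : (M.eTilde a).carrier) :
    (DHecke.gen F u (.y ⟨i, by omega⟩) : DHecke F u M.rank) • M.eTildeIncl a z = a • M.eTildeIncl a z := by
  obtain ⟨n, N⟩ := M
  obtain _ | n := n
  · exact absurd hM (lt_irrefl 0)
  · obtain rfl : i = n := by simpa using hi
    exact DHecke.last_smul_socleIncl a z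

theorem exists_eTildeIncl_mem [IsSimpleModule (DHecke F u M.rank) M.carrier]
    (K : Submodule F M.carrier) (hK : K ≠ ⊥)
    (hy : ∀ i, ∀ z ∈ K, (DHecke.gen F u (.y i) : DHecke F u M.rank) • z ∈ K)
    (hs : ∀ i (hi : i + 1 < M.rank), i + 1 + 1 < M.rank →
      ∀ z ∈ K, DHecke.gen F u (.s i hi) • z ∈ K) :
    ∃ a z, z ≠ 0 ∧ M.eTildeIncl a z ∈ K := by
  obtain ⟨n, N⟩ := M
  obtain _ | n := n
  · exact absurd hM (lt_irrefl 0)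
  · refine DHecke.exists_socleIncl_mem (u := u) (n := n) K hK fun a z hz => ?_
    cases a with
    | y i => exact hy _ z hz
    | s i hi => exact hs i _ (Nat.succ_lt_succ hi) z hz

omit hM in
theorem isSemisimpleModule_eTilde (a : F) :
    IsSemisimpleModule (DHecke F u (M.eTilde a).rank) (M.eTilde a).carrier := by
  obtain ⟨n, N⟩ := M
  obtain _ | n := n
  · exact (isSemisimpleModule_iff _ _).2 ⟨fun p => ⟨⊥, disjoint_bot_right,
      codisjoint_iff.2 ((Submodule.eq_top_iff').2 fun x => by
        rw [show x = 0 from Subsingleton.elim (α := PUnit) _ _]; exact zero_mem _)⟩⟩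
  · exact isSemisimpleModule_socle (DHecke F u n) (DHecke.eMod (u := u) (n := n) N a)

end DMod

end ETilde

/-! ### Joining a last tensor factor to V^{⊗m'} -/

section Join

variable (F V : Type*) [Field F] [AddCommGroup V] [Module F V] {m' m : ℕ} (hm : m' + 1 = m)

/-- `{0, ..., m' - 1} ⊕ {0} ≃ {0, ..., m'}`. -/
def joinIdx : Fin m' ⊕ Fin 1 ≃ Fin m := finSumFinEquiv.trans (finCongr hm)

theorem joinIdx_inl (i : Fin m') : joinIdx hm (.inl i) = ⟨i, by omega⟩ := by
  simp [joinIdx, Fin.ext_iff]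

theorem joinIdx_inr (i : Fin 1) : joinIdx hm (.inr i) = ⟨m', by omega⟩ := by
  simp [joinIdx, Fin.ext_iff]

/-- `V^{⊗ m'} ⊗ V ≅ V^{⊗ (m' + 1)}`. -/
def joinEquiv : (⨂[F] _ : Fin m', V) ⊗[F] (⨂[F] _ : Fin 1, V) ≃ₗ[F] ⨂[F] _ : Fin m, V :=
  (PiTensorProduct.tmulEquiv F V).trans (PiTensorProduct.reindex F (fun _ => V) (joinIdx hm))

theorem joinEquiv_tprod (v : Fin m' → V) (w : Fin 1 → V) :
    joinEquiv F V hm (PiTensorProduct.tprod F v ⊗ₜ PiTensorProduct.tprod F w)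
      = PiTensorProduct.tprod F fun i => Sum.elim v w ((joinIdx hm).symm i) := by
  simp [joinEquiv]

variable {F V}

theorem joinEquiv_map (f' : Fin m' → Module.End F V) (t : Fin 1 → Module.End F V)
    (f : Fin m → Module.End F V) (h₁ : ∀ i, f (joinIdx hm (.inl i)) = f' i)
    (h₂ : ∀ i, f (joinIdx hm (.inr i)) = t i) (v : ⨂[F] _ : Fin m', V) (w : ⨂[F] _ : Fin 1, V) :
    joinEquiv F V hm (PiTensorProduct.map f' v ⊗ₜ PiTensorProduct.map t w)
      = PiTensorProduct.map f (joinEquiv F V hm (v ⊗ₜ w)) := by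
  have h : (joinEquiv F V hm).toLinearMap ∘ₗ
        TensorProduct.map (PiTensorProduct.map f') (PiTensorProduct.map t)
      = PiTensorProduct.map f ∘ₗ (joinEquiv F V hm).toLinearMap := by
    ext v w
    simp only [LinearMap.compMultilinearMap_apply, TensorProduct.AlgebraTensorModule.curry_apply,
      LinearMap.restrictScalars_self, TensorProduct.curry_apply, LinearMap.comp_apply,
      TensorProduct.map_tmul, PiTensorProduct.map_tprod, LinearEquiv.coe_coe, joinEquiv_tprod]
    congr 1
    funext i
    obtain ⟨i, rfl⟩ := (joinIdx hm).surjective i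
    rw [Equiv.symm_apply_apply]
    cases i with
    | inl i => simp [h₁]
    | inr i => simp [h₂]
  exact LinearMap.congr_fun h (v ⊗ₜ w)

theorem joinEquiv_permute (σ' : Equiv.Perm (Fin m')) (σ : Equiv.Perm (Fin m))
    (h₁ : ∀ i, σ⁻¹ (joinIdx hm (.inl i)) = joinIdx hm (.inl (σ'⁻¹ i)))
    (h₂ : ∀ i, σ⁻¹ (joinIdx hm (.inr i)) = joinIdx hm (.inr i))
    (v : ⨂[F] _ : Fin m', V) (w : ⨂[F] _ : Fin 1, V) :
    joinEquiv F V hm (permute F V σ' v ⊗ₜ w) = permute F V σ (joinEquiv F V hm (v ⊗ₜ w)) := by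
  have h : (joinEquiv F V hm).toLinearMap ∘ₗ (permute F V σ').rTensor _
      = permute F V σ ∘ₗ (joinEquiv F V hm).toLinearMap := by
    ext v w
    simp only [LinearMap.compMultilinearMap_apply, TensorProduct.AlgebraTensorModule.curry_apply,
      LinearMap.restrictScalars_self, TensorProduct.curry_apply, LinearMap.comp_apply,
      LinearMap.rTensor_tmul, permute_tprod, LinearEquiv.coe_coe, joinEquiv_tprod]
    congr 1
    funext i
    obtain ⟨i, rfl⟩ := (joinIdx hm).surjective i
    rw [Equiv.symm_apply_apply]
    cases i with
    | inl i => rw [h₁, Equiv.symm_apply_apply]; rfl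
    | inr i => rw [h₂, Equiv.symm_apply_apply]; rfl
  exact LinearMap.congr_fun h (v ⊗ₜ w)

end Join

/-! ### The maps (V^{⊗m'} ⊗ L') ⊗ (V ⊗ L(a)) → V^{⊗m} ⊗ L -/

section Kappa

set_option linter.unusedSectionVars false

variable {F : Type*} [Field F] [IsAlgClosed F] {G : Type*} [Group G] [Fintype G]

/-- A linear map that intertwines the generators of `H_{m'}(G)` with those of `H_m(G)`. -/
structure IsGenCompat {m' m : ℕ} (hm : m' ≤ m) {M' M : Type*} [AddCommGroup M'] [Module F M']
    [Module (WHecke F G m') M'] [AddCommGroup M] [Module F M] [Module (WHecke F G m) M]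
    (θ : M' →ₗ[F] M) : Prop where
  g : ∀ i (h : G) z, θ ((WHecke.gen F (.g (Pi.mulSingle i h)) : WHecke F G m') • z)
    = (WHecke.gen F (.g (Pi.mulSingle (Fin.castLE hm i) h)) : WHecke F G m) • θ z
  x : ∀ i z, θ ((WHecke.gen F (.x i) : WHecke F G m') • z)
    = (WHecke.gen F (.x (Fin.castLE hm i)) : WHecke F G m) • θ z
  s : ∀ i hi z, θ ((WHecke.gen F (.s i hi) : WHecke F G m') • z)
    = (WHecke.gen F (.s i (by omega)) : WHecke F G m) • θ z

variable {V : Type*} [AddCommGroup V] [Module F V] [FiniteDimensional F V] (ρ : Representation F G V)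
  [ρ.IsIrreducible]

/-- The map `(V^{⊗ m'} ⊗ L') ⊗ (V ⊗ L(a)) → V^{⊗ m} ⊗ L` given by a map `L' → L`. -/
def kappa (a : F) {m' m : ℕ} (hm : m' + 1 = m) {L' L : Type*} [AddCommGroup L'] [Module F L']
    [AddCommGroup L] [Module F L] (i : L' →ₗ[F] L) :
    Factor ρ 1 (DHecke.LOne F (twist (flipScalar ρ)) a) →ₗ[F] Factor ρ m' L' →ₗ[F] Factor ρ m L :=
  (TensorProduct.curry (TensorProduct.map (joinEquiv F V hm).toLinearMap
    (i ∘ₗ (TensorProduct.rid F L').toLinearMap) ∘ₗ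
    (TensorProduct.tensorTensorTensorComm F (⨂[F] _ : Fin m', V) L' (⨂[F] _ : Fin 1, V)
      F).toLinearMap)).flip

/-- An element of the one-dimensional module `L(a)`, as a scalar. -/
def lOneVal {u a : F} (t : DHecke.LOne F u a) : F := t

theorem kappa_factorMk (a : F) {m' m : ℕ} (hm : m' + 1 = m) {L' L : Type*} [AddCommGroup L']
    [Module F L'] [AddCommGroup L] [Module F L] (i : L' →ₗ[F] L) (v w z)
    (t : DHecke.LOne F (twist (flipScalar ρ)) a) :
    kappa ρ a hm i (factorMk ρ 1 (DHecke.LOne F (twist (flipScalar ρ)) a) w t)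
      (factorMk ρ m' L' v z) = lOneVal t • factorMk ρ m L (joinEquiv F V hm (v ⊗ₜ w)) (i z) := by
  have h : i (lOneVal t • z) = lOneVal t • i z := map_smul _ _ _
  have h2 : factorMk ρ m L (joinEquiv F V hm (v ⊗ₜ w)) (lOneVal t • i z) = lOneVal t • factorMk ρ m L (joinEquiv F V hm (v ⊗ₜ w)) (i z) := TensorProduct.tmul_smul _ _ _
  rw [← h2, ← h]
  rfl

theorem Factor.induction {m : ℕ} {L : Type*} [AddCommGroup L] [Module F L]
    {p : Factor ρ m L → Prop} (hadd : ∀ x y, p x → p y → p (x + y))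
    (h : ∀ v z, p (factorMk ρ m L v z)) (z : Factor ρ m L) : p z := by
  have h0 : factorMk ρ m L 0 0 = 0 := TensorProduct.zero_tmul (⨂[F] _ : Fin m, V) (0 : L)
  exact TensorProduct.induction_on (motive := p) z (h0 ▸ h 0 0) h hadd

section

variable {a : F} {m' m : ℕ} (hm : m' + 1 = m) {L' L : Type*} [AddCommGroup L'] [Module F L']
  [AddCommGroup L] [Module F L] [Module (DHecke F (twist (flipScalar ρ)) m') L']
  [IsScalarTower F (DHecke F (twist (flipScalar ρ)) m') L']
  [Module (DHecke F (twist (flipScalar ρ)) m) L]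
  [IsScalarTower F (DHecke F (twist (flipScalar ρ)) m) L] {i : L' →ₗ[F] L}

/-- To compare linear expressions in a value of `kappa` it suffices to treat pure tensors. -/
theorem kappa_induction {p : Factor ρ 1 (DHecke.LOne F (twist (flipScalar ρ)) a) →
      Factor ρ m' L' → Prop}
    (h₁ : ∀ f f' z, p f z → p f' z → p (f + f') z) (h₂ : ∀ f z z', p f z → p f z' → p f (z + z'))
    (h : ∀ w t v z, p
      (factorMk ρ 1 (DHecke.LOne F (twist (flipScalar ρ)) a) w t) (factorMk ρ m' L' v z)) (f z) : p f z := by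
  induction f using Factor.induction with
  | hadd f f' hf hf' => exact h₁ _ _ _ hf hf'
  | h w t =>
    induction z using Factor.induction with
    | hadd z z' hz hz' => exact h₂ _ _ _ hz hz'
    | h v z => exact h w t v z

theorem isGenCompat_kappa (hy : ∀ (j : Fin m') z, i ((DHecke.gen F (twist (flipScalar ρ)) (.y j) :
        DHecke F (twist (flipScalar ρ)) m') • z)
      = (DHecke.gen F (twist (flipScalar ρ)) (.y (Fin.castLE (by omega) j)) :
          DHecke F (twist (flipScalar ρ)) m) • i z)
    (hs : ∀ j (hj : j + 1 < m') z, i (DHecke.gen F (twist (flipScalar ρ)) (.s j hj) • z)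
      = (DHecke.gen F (twist (flipScalar ρ)) (.s j (by omega)) :
          DHecke F (twist (flipScalar ρ)) m) • i z)
    (f : Factor ρ 1 (DHecke.LOne F (twist (flipScalar ρ)) a)) :
    IsGenCompat (G := G) (by omega : m' ≤ m) (kappa ρ a hm i f) where
  g j h z := by
    refine kappa_induction ρ (p := fun f z => kappa ρ a hm i f (_ • z) = _ • kappa ρ a hm i f z)
      (fun f f' z h h' => by simp only [map_add, LinearMap.add_apply, smul_add, h, h'])
      (fun f z z' h h' => by simp only [map_add, smul_add, h, h']) (fun w t v z => ?_) f z
    rw [gen_g_smul_factorMk, kappa_factorMk, kappa_factorMk, smul_comm _ (lOneVal t), gen_g_smul_factorMk,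
      tensorPow, tensorPow, ← joinEquiv_map hm _ 1 _ _ _ v w]
    · congr 4
      exact (LinearMap.congr_fun PiTensorProduct.map_one w).symm
    · intro i
      congr 1
      simp [joinIdx_inl, Pi.mulSingle_apply, Fin.ext_iff]
    · intro i
      have h1 : (Pi.mulSingle (Fin.castLE (by omega) j) h : Fin m → G) ⟨m', by omega⟩ = 1 :=
        Pi.mulSingle_eq_of_ne (by simp [Fin.ext_iff]; omega) _
      rw [joinIdx_inr, h1, map_one]; rfl
  x j z := by
    refine kappa_induction ρ (p := fun f z => kappa ρ a hm i f (_ • z) = _ • kappa ρ a hm i f z)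
      (fun f f' z h h' => by simp only [map_add, LinearMap.add_apply, smul_add, h, h'])
      (fun f z z' h h' => by simp only [map_add, smul_add, h, h']) (fun w t v z => ?_) f z
    rw [gen_x_smul_factorMk, map_smul, kappa_factorMk, kappa_factorMk,
      smul_comm (WHecke.gen F (.x (Fin.castLE _ j)) : WHecke F G m) (lOneVal t),
      gen_x_smul_factorMk, hy, smul_comm (lOneVal t)]
  s j hj z := by
    refine kappa_induction ρ (p := fun f z => kappa ρ a hm i f (_ • z) = _ • kappa ρ a hm i f z)
      (fun f f' z h h' => by simp only [map_add, LinearMap.add_apply, smul_add, h, h'])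
      (fun f z z' h h' => by simp only [map_add, smul_add, h, h']) (fun w t v z => ?_) f z
    rw [gen_s_smul_factorMk, kappa_factorMk, kappa_factorMk, smul_comm _ (lOneVal t), gen_s_smul_factorMk,
      hs, ← joinEquiv_permute hm (adj j hj)]
    · intro i
      rw [joinIdx_inl, joinIdx_inl]
      simp only [Equiv.swap_inv, Equiv.swap_apply_def, Fin.ext_iff]
      grind
    · intro i
      rw [joinIdx_inr]
      simp only [Equiv.swap_inv, Equiv.swap_apply_def, Fin.ext_iff]
      grind

theorem kappa_gen_g_smul (t : Fin 1 → G) (f z) :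
    kappa ρ a hm i ((WHecke.gen F (.g t) : WHecke F G 1) • f) z
      = (WHecke.gen F (.g (Pi.mulSingle ⟨m', by omega⟩ (t 0))) : WHecke F G m) •
        kappa ρ a hm i f z := by
  refine kappa_induction ρ (p := fun f z => kappa ρ a hm i (_ • f) z = _ • kappa ρ a hm i f z)
    (fun f f' z h h' => by simp only [map_add, LinearMap.add_apply, smul_add, h, h'])
    (fun f z z' h h' => by simp only [map_add, smul_add, h, h']) (fun w b v z => ?_) f z
  rw [gen_g_smul_factorMk, kappa_factorMk, kappa_factorMk, smul_comm _ (lOneVal b), gen_g_smul_factorMk,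
    tensorPow, tensorPow, ← joinEquiv_map hm 1 _ _ _ _ v w]
  · congr 4
    exact (LinearMap.congr_fun PiTensorProduct.map_one v).symm
  · intro i
    have h1 : (Pi.mulSingle ⟨m', by omega⟩ (t 0) : Fin m → G) ⟨i, by omega⟩ = 1 :=
      Pi.mulSingle_eq_of_ne (by simp [Fin.ext_iff]; omega) _
    rw [joinIdx_inl, h1, map_one]; rfl
  · intro i
    rw [joinIdx_inr, Pi.mulSingle_eq_same, Subsingleton.elim i 0]

/-- This scalar later tells apart the summands that belong to the same k and different a. -/
theorem gen_x_smul_factor_one (j : Fin 1) (f : Factor ρ 1 (DHecke.LOne F (twist (flipScalar ρ)) a)) :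
    (WHecke.gen F (.x j) : WHecke F G 1) • f = (scale (flipScalar ρ) * a) • f := by
  induction f using Factor.induction with
  | hadd f f' hf hf' => rw [smul_add, smul_add, hf, hf']
  | h w t =>
    rw [gen_x_smul_factorMk, mul_smul]
    congr 1
    have h1 : DHecke.gen F (twist (flipScalar ρ)) (.y j) • t = a • t := by
      change DHecke.lOneHom (twist (flipScalar ρ)) a (DHecke.gen F _ (.y j)) t = _
      rw [DHecke.lOneHom, DHecke.lift_gen]; rfl
    rw [h1]
    exact TensorProduct.tmul_smul _ _ _

/-- On the left the generator of H_1(G) acts through L(a), on the right x_m acts through the last y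
on L. The two agree exactly because the image of i consists of true eigenvectors for a, which is the
hypothesis `hl`. -/
theorem kappa_gen_x_smul (hl : ∀ z, (DHecke.gen F (twist (flipScalar ρ)) (.y ⟨m', by omega⟩) :
      DHecke F (twist (flipScalar ρ)) m) • i z = a • i z) (j : Fin 1) (f z) :
    kappa ρ a hm i ((WHecke.gen F (.x j) : WHecke F G 1) • f) z
      = (WHecke.gen F (.x ⟨m', by omega⟩) : WHecke F G m) • kappa ρ a hm i f z := by
  rw [gen_x_smul_factor_one]
  refine kappa_induction ρ (p := fun f z => kappa ρ a hm i (_ • f) z = _ • kappa ρ a hm i f z)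
    (fun f f' z h h' => by simp only [map_add, LinearMap.add_apply, smul_add, h, h'])
    (fun f z z' h h' => by simp only [map_add, smul_add, h, h']) (fun w b v z => ?_) f z
  rw [map_smul, LinearMap.smul_apply, kappa_factorMk, smul_comm _ (lOneVal b), smul_comm _ (lOneVal b),
    gen_x_smul_factorMk, hl, mul_smul]
  congr 2
  exact (TensorProduct.tmul_smul _ _ _).symm

theorem kappa_injective (hi : Function.Injective i)
    {f : Factor ρ 1 (DHecke.LOne F (twist (flipScalar ρ)) a)} (hf : f ≠ 0) :
    Function.Injective (kappa ρ a hm i f) := by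
  -- L(a) is one-dimensional, so f is a pure tensor w ⊗ 1, and the map is the tensor product of the
  -- injections v ↦ v ⊗ w and i.
  let w : ⨂[F] _ : Fin 1, V := TensorProduct.rid F _ f
  have hw : w ≠ 0 := fun h => hf ((TensorProduct.rid F (⨂[F] _ : Fin 1, V)).map_eq_zero_iff.1 h)
  obtain ⟨o, ho, hfw⟩ : ∃ o, lOneVal o = 1 ∧
      f = factorMk ρ 1 (DHecke.LOne F (twist (flipScalar ρ)) a) w o := ⟨(1 : F), rfl,
    ((TensorProduct.rid F (⨂[F] _ : Fin 1, V)).symm_apply_apply f).symm⟩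
  obtain ⟨φ, hφ⟩ := Module.Projective.exists_dual_eq_one F hw
  let T : (⨂[F] _ : Fin m', V) →ₗ[F] ⨂[F] _ : Fin m, V :=
    (joinEquiv F V hm).toLinearMap ∘ₗ (TensorProduct.mk F _ _).flip w
  have hT : Function.Injective T := by
    refine (joinEquiv F V hm).injective.comp ?_
    refine Function.LeftInverse.injective
      (g := fun z => TensorProduct.rid F _ (φ.lTensor (⨂[F] _ : Fin m', V) z)) fun v => ?_
    simp [hφ]
  have h : ∀ z, kappa ρ a hm i f z = TensorProduct.map T i z := by
    intro z
    induction z using Factor.induction with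
    | hadd x y hx hy => rw [map_add, hx, hy]; exact (map_add (TensorProduct.map T i) _ _).symm
    | h v z => rw [hfw, kappa_factorMk, ho, one_smul]; rfl
  intro z z' hz
  rw [h, h] at hz
  exact TensorProduct.map_injective_of_flat_flat T i hT hi hz

end

/-- A nonzero subspace of `V^{⊗ m} ⊗ L` that is stable under all generators of `H_m(G)` but the last
simple reflection contains a nonzero subspace `V^{⊗ m} ⊗ K`, where `K` is stable likewise. -/
theorem exists_untens_factor {m : ℕ} {L : Type*} [AddCommGroup L]
    [Module F L] [Module (DHecke F (twist (flipScalar ρ)) m) L]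
    [IsScalarTower F (DHecke F (twist (flipScalar ρ)) m) L] (Y : Submodule F (Factor ρ m L))
    (hY : Y ≠ ⊥) (hg : ∀ b, ∀ z ∈ Y, (WHecke.gen F (.g b) : WHecke F G m) • z ∈ Y)
    (hx : ∀ i, ∀ z ∈ Y, (WHecke.gen F (.x i) : WHecke F G m) • z ∈ Y)
    (hs : ∀ i hi, i + 1 + 1 < m → ∀ z ∈ Y, (WHecke.gen F (.s i hi) : WHecke F G m) • z ∈ Y) :
    ∃ K : Submodule F L, K ≠ ⊥ ∧ (∀ x ∈ K, ∀ w, factorMk ρ m L w x ∈ Y) ∧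
      (∀ i, ∀ z ∈ K, (DHecke.gen F (twist (flipScalar ρ)) (.y i) :
        DHecke F (twist (flipScalar ρ)) m) • z ∈ K) ∧
      (∀ i (hi : i + 1 < m), i + 1 + 1 < m →
        ∀ z ∈ K, DHecke.gen F (twist (flipScalar ρ)) (.s i hi) • z ∈ K) := by
  have : FiniteDimensional F (⨂[F] _ : Fin m, V) := finite_piTensorProduct
  let Y' : Submodule F ((⨂[F] _ : Fin m, V) ⊗[F] L) := Y
  have h := tens_untens Y' fun T z hz => rTensor_mem_of_tensorPow ρ m Y'
    (fun a z hz => (congrArg (· ∈ Y) (factorEquiv_gen_smul ρ m L (.g a) z)).mp (hg a z hz)) T z hz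
  refine ⟨untens Y', fun h0 => hY ?_, fun x hx => hx, fun i z hz w => ?_, fun i hi hi' z hz w => ?_⟩
  · rw [h0] at h
    have h1 : tens (⨂[F] _ : Fin m, V) (⊥ : Submodule F L) = ⊥ :=
      le_bot_iff.1 (tens_le_iff.2 fun w x hx => by
        rw [(Submodule.mem_bot F).1 hx, TensorProduct.tmul_zero]; exact zero_mem _)
    exact h.symm.trans h1
  · exact y_mem_of_x_smul_mem ρ m (Y := Y) (hx i) hz w
  · exact s_mem_of_s_smul_mem ρ m (Y := Y) (hs i hi hi') hz w

end Kappa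

/-! ### Removing one position from a block -/

section RemoveMap

set_option linter.unusedSectionVars false

universe v₁ v₂

variable {F : Type v₁} [Field F] [IsAlgClosed F] {G : Type*} [Group G] [Fintype G]
  {V : Type*} [AddCommGroup V] [Module F V] [FiniteDimensional F V] (ρ : Representation F G V)
  [ρ.IsIrreducible] {M N : DMod.{v₁, v₂} F (twist (flipScalar ρ))}

/-- The identification of `V^{⊗ m} ⊗ L` for equal pairs `(m, L)`. -/
def factorCast (h : N = M) : Factor ρ N.rank N.carrier →ₗ[F] Factor ρ M.rank M.carrier := by
  subst h; exact LinearMap.id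

theorem isGenCompat_factorCast (h : N = M) (hm : N.rank ≤ M.rank) :
    IsGenCompat (G := G) hm (factorCast ρ h) := by
  subst h
  exact ⟨fun _ _ _ => rfl, fun _ _ => rfl, fun _ _ _ => rfl⟩

theorem factorCast_injective (h : N = M) : Function.Injective (factorCast ρ h) := by
  subst h; exact fun _ _ h => h

variable {a : F} (hN : N = M.eTilde a) (hM : 0 < M.rank)

include hN hM in
-- N is a variable equal to ẽ_a M because it will be a value of an updated family, where this holds
-- only as a proved equality.
theorem rank_add_one : N.rank + 1 = M.rank := by
  rw [hN, DMod.eTilde_rank]; omega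

/-- The map `(V^{⊗ (m - 1)} ⊗ ẽ_a L) ⊗ (V ⊗ L(a)) → V^{⊗ m} ⊗ L`. -/
def removeMap : Factor ρ 1 (DHecke.LOne F (twist (flipScalar ρ)) a) →ₗ[F]
    Factor ρ N.rank N.carrier →ₗ[F] Factor ρ M.rank M.carrier :=
  kappa ρ a (rank_add_one ρ hN hM) (by subst hN; exact M.eTildeIncl a)

theorem isGenCompat_removeMap (hm : N.rank ≤ M.rank) (f) :
    IsGenCompat (G := G) hm (removeMap ρ hN hM f) := by
  subst hN
  exact isGenCompat_kappa ρ _ (fun j z => DMod.eTildeIncl_y M hM a j _ _ z)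
    (fun j hj z => DMod.eTildeIncl_s M hM a j hj _ z) f

theorem removeMap_gen_g_smul (t : Fin 1 → G) (f z) :
    removeMap ρ hN hM ((WHecke.gen F (.g t) : WHecke F G 1) • f) z
      = (WHecke.gen F (.g (Pi.mulSingle ⟨N.rank, by have := rank_add_one ρ hN hM; omega⟩ (t 0))) :
        WHecke F G M.rank) • removeMap ρ hN hM f z := by
  subst hN
  exact kappa_gen_g_smul ρ _ t f z

theorem removeMap_gen_x_smul [IsSimpleModule (DHecke F (twist (flipScalar ρ)) M.rank) M.carrier]
    (j : Fin 1) (f z) : removeMap ρ hN hM ((WHecke.gen F (.x j) : WHecke F G 1) • f) z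
      = (WHecke.gen F (.x ⟨N.rank, by have := rank_add_one ρ hN hM; omega⟩) :
        WHecke F G M.rank) • removeMap ρ hN hM f z := by
  subst hN
  exact kappa_gen_x_smul ρ _
    (fun z => DMod.last_smul_eTildeIncl M hM a _ (rank_add_one ρ rfl hM) z) j f z

theorem removeMap_injective {f} (hf : f ≠ 0) : Function.Injective (removeMap ρ hN hM f) := by
  subst hN
  exact kappa_injective ρ _ (DMod.eTildeIncl_injective M hM a) hf

/-- Strip V^{⊗m} off Y and take a nonzero socle vector in the remaining subspace of L. Any nonzero
tensor in V^{⊗(m-1)} completes it, since the stripped subspace accepts every tensor of V^{⊗m}. -/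
theorem exists_removeMap_mem [IsSimpleModule (DHecke F (twist (flipScalar ρ)) M.rank) M.carrier]
    (hM : 0 < M.rank) (Y : Submodule F (Factor ρ M.rank M.carrier)) (hY : Y ≠ ⊥)
    (hg : ∀ b, ∀ z ∈ Y, (WHecke.gen F (.g b) : WHecke F G M.rank) • z ∈ Y)
    (hx : ∀ i, ∀ z ∈ Y, (WHecke.gen F (.x i) : WHecke F G M.rank) • z ∈ Y)
    (hs : ∀ i hi, i + 1 + 1 < M.rank →
      ∀ z ∈ Y, (WHecke.gen F (.s i hi) : WHecke F G M.rank) • z ∈ Y) :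
    ∃ a : F, ∀ {N : DMod.{v₁, v₂} F (twist (flipScalar ρ))} (hN : N = M.eTilde a),
      ∃ z : Factor ρ N.rank N.carrier, z ≠ 0 ∧ ∀ f, removeMap ρ hN hM f z ∈ Y := by
  obtain ⟨K, hK, hKY, hy, hs⟩ := exists_untens_factor ρ Y hY hg hx hs
  obtain ⟨a, z, hz, hzK⟩ := DMod.exists_eTildeIncl_mem M hM K hK hy hs
  refine ⟨a, fun hN => ?_⟩
  subst hN
  have := nontrivial_of_isIrreducible ρ
  have : Nontrivial (⨂[F] _ : Fin (M.eTilde a).rank, V) := nontrivial_piTensorProduct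
  obtain ⟨v, hv⟩ := exists_ne (0 : ⨂[F] _ : Fin (M.eTilde a).rank, V)
  refine ⟨factorMk ρ _ _ v z, ?_, fun f => ?_⟩
  · obtain ⟨φ, hφ⟩ := Module.Projective.exists_dual_eq_one F hv
    intro h
    refine hz ?_
    have h1 := congrArg (fun y => TensorProduct.lid F _ (φ.rTensor _ y)) h
    change TensorProduct.lid F _ (φ.rTensor _ (v ⊗ₜ z)) = TensorProduct.lid F _ (φ.rTensor _ 0) at h1
    simpa [hφ] using h1
  · induction f using Factor.induction with
    | hadd f f' hf hf' => rw [map_add, LinearMap.add_apply]; exact Y.add_mem hf hf'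
    | h w t =>
      change kappa ρ a _ (M.eTildeIncl a) _ _ ∈ Y
      rw [kappa_factorMk]
      exact Y.smul_mem _ (hKY _ hzK _)

end RemoveMap

/-! ### Outer tensor products with a simple module -/

section OuterLattice

set_option linter.unusedSectionVars false

variable {F A B M W : Type*} [Field F] [Ring A] [Algebra F A] [Ring B] [Algebra F B]
  [AddCommGroup M] [Module F M] [Module A M] [IsScalarTower F A M]
  [AddCommGroup W] [Module F W] [Module B W] [IsScalarTower F B W]

variable (F M W) in
/-- The pure tensor `m ⊗ w`. -/
def outerMk : M →ₗ[F] W →ₗ[F] Outer F M W := TensorProduct.mk F M W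

theorem tmul_smul_outerMk (a : A) (b : B) (m : M) (w : W) :
    (a ⊗ₜ[F] b) • outerMk F M W m w = outerMk F M W (a • m) (b • w) := by
  change outerHom F A B M W (a ⊗ₜ b) (m ⊗ₜ w) = _
  simp [outerHom]; rfl

omit [Module A M] [IsScalarTower F A M] [Module B W] [IsScalarTower F B W] in
theorem Outer.induction {p : Outer F M W → Prop} (h0 : p 0) (hadd : ∀ x y, p x → p y → p (x + y))
    (h : ∀ m w, p (outerMk F M W m w)) (z : Outer F M W) : p z :=
  TensorProduct.induction_on (motive := p) z h0 h hadd

variable (A B M W) in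
/-- The lattice of submodules of an outer tensor product with a simple module. -/
theorem exists_outer_orderIso [IsAlgClosed F] [FiniteDimensional F W] [IsSimpleModule B W] :
    ∃ e : Submodule (A ⊗[F] B) (Outer F M W) ≃o Submodule A M,
      ∀ Y m, m ∈ e Y ↔ ∀ w, outerMk F M W m w ∈ Y := by
  have := IsSimpleModule.nontrivial B W
  let Φ : Outer F M W ≃ₗ[F] W ⊗[F] M := TensorProduct.comm F M W
  have hΦ : ∀ m w, Φ (outerMk F M W m w) = w ⊗ₜ m := fun m w => TensorProduct.comm_tmul F M W m w
  have hΦ' : ∀ m w, Φ.symm (w ⊗ₜ m) = outerMk F M W m w := fun m w => by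
    rw [← hΦ, LinearEquiv.symm_apply_apply]
  refine (exists_orderIso_tens (A := A ⊗[F] B) (B := A) Φ (fun K a z hz => ?_)
    (fun Y T z hz => ?_) (fun Y x hx a w => ?_)).imp fun e he Y m => by simp only [he, hΦ']
  · obtain ⟨z, rfl⟩ := Φ.symm.surjective z
    rw [LinearEquiv.apply_symm_apply] at hz
    induction a using TensorProduct.induction_on with
    | zero => rw [zero_smul, map_zero]; exact zero_mem _
    | add a b ha hb => rw [add_smul, map_add]; exact add_mem ha hb
    | tmul a b =>
      refine tens_induction (p := fun y => Φ ((a ⊗ₜ[F] b) • Φ.symm y) ∈ _) ?_ ?_ ?_ hz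
      · rw [map_zero, smul_zero, map_zero]; exact zero_mem _
      · intro x y hx hy; rw [map_add, smul_add, map_add]; exact add_mem hx hy
      · intro w x hx
        rw [hΦ', tmul_smul_outerMk, hΦ]
        exact tmul_mem_tens _ (K.smul_mem a hx)
  -- Burnside's theorem for W realizes every endomorphism of W by some 1 ⊗ b.
  · obtain ⟨b, hb⟩ := exists_smul_eq_end (F := F) (A := B) T
    have h : ∀ z, Φ.symm (T.rTensor M (Φ z)) = ((1 : A) ⊗ₜ[F] b) • z := by
      intro z
      induction z using Outer.induction with
      | h0 => simp
      | hadd x y hx hy => simp only [map_add, smul_add, hx, hy]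
      | h m w => rw [hΦ, LinearMap.rTensor_tmul, hΦ', tmul_smul_outerMk, one_smul, hb]
    rw [h]
    exact Y.smul_mem _ hz
  · rw [hΦ', ← one_smul B w, ← tmul_smul_outerMk, ← hΦ']
    exact Y.smul_mem _ (hx w)

variable {A' N : Type*} [Ring A'] [Algebra F A'] [AddCommGroup N] [Module F N] [Module A' N]
  [IsScalarTower F A' N] (φ : A ⊗[F] B →ₐ[F] A')

theorem exists_outer_lift (g : M →ₗ[F] W →ₗ[F] N)
    (h₁ : ∀ a m w, g (a • m) w = φ (a ⊗ₜ 1) • g m w)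
    (h₂ : ∀ b m w, g m (b • w) = φ (1 ⊗ₜ b) • g m w) :
    ∃ Θ : Outer F M W →ₗ[A ⊗[F] B] Res φ N, ∀ m w, Θ (outerMk F M W m w) = g m w := by
  let Θ : Outer F M W →ₗ[F] N := TensorProduct.lift g
  have hΘ : ∀ m w, Θ (outerMk F M W m w) = g m w := fun m w => TensorProduct.lift.tmul m w
  refine ⟨{ toFun := Θ, map_add' := map_add Θ, map_smul' := fun q z => ?_ }, hΘ⟩
  change Θ (q • z) = φ q • Θ z
  induction q using TensorProduct.induction_on with
  | zero => rw [zero_smul, map_zero, map_zero, zero_smul]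
  | add a b ha hb => rw [add_smul, map_add, map_add, add_smul, ha, hb]
  | tmul a b =>
    induction z using Outer.induction with
    | h0 => rw [smul_zero, map_zero, smul_zero]
    | hadd x y hx hy => rw [smul_add, map_add, map_add, smul_add, hx, hy]
    | h m w =>
      rw [tmul_smul_outerMk, hΘ, hΘ, h₁, h₂, ← mul_smul, ← map_mul]
      simp

/-- The kernel is a submodule of M ⊗ W, so it is determined by the submodule of those m for which Θ
vanishes on all m ⊗ w. -/
theorem outer_lift_injective [IsAlgClosed F] [FiniteDimensional F W] [IsSimpleModule B W]
    {N : Type*} [AddCommGroup N] [Module (A ⊗[F] B) N]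
    (Θ : Outer F M W →ₗ[A ⊗[F] B] N)
    (h : ∀ K : Submodule A M, (∀ m ∈ K, ∀ w, Θ (outerMk F M W m w) = 0) → K = ⊥) :
    Function.Injective Θ := by
  obtain ⟨e, he⟩ := exists_outer_orderIso (F := F) A B M W
  rw [← LinearMap.ker_eq_bot]
  refine e.injective (Eq.trans ?_ (map_bot e).symm)
  exact h _ fun m hm w => (he _ m).1 hm w

/-- If an element acts by a scalar on the second factor, then it acts by this scalar on the outer
tensor product. -/
theorem one_tmul_smul (b : B) (t : F) (h : ∀ w : W, b • w = t • w) (z : Outer F M W) :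
    ((1 : A) ⊗ₜ[F] b) • z = t • z := by
  induction z using Outer.induction with
  | h0 => rw [smul_zero, smul_zero]
  | hadd x y hx hy => rw [smul_add, smul_add, hx, hy]
  | h m w => rw [tmul_smul_outerMk, one_smul, h, map_smul]

end OuterLattice

/-! ### Recognizing a socle as a direct sum -/

section Independence

set_option linter.unusedSectionVars false

variable {F Q ι N : Type*} [Field F] [Ring Q] [Algebra F Q] [AddCommGroup N] [Module F N]
  [Module Q N] [IsScalarTower F Q N] {M : ι → Type*} [∀ i, AddCommGroup (M i)] [∀ i, Module F (M i)]
  [∀ i, Module Q (M i)] [∀ i, IsScalarTower F Q (M i)]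

/-- A direct sum of injective maps is injective if the summands are separated by elements of the
algebra that act on them by scalars. -/
theorem toModule_injective [DecidableEq ι] (Θ : ∀ i, M i →ₗ[Q] N)
    (hΘ : ∀ i, Function.Injective (Θ i))
    (hsep : ∀ i j, i ≠ j → ∃ (q : Q) (χ : ι → F), (∀ k (z : M k), q • z = χ k • z) ∧ χ i ≠ χ j) :
    Function.Injective (DirectSum.toModule Q ι N Θ) := by
  -- As in Lagrange interpolation, a product of elements q' - χ'(j) over j in s kills the summands
  -- in s and acts on the i-th one by a nonzero scalar.
  have key : ∀ (i : ι) (s : Finset ι), i ∉ s → ∃ (q : Q) (χ : ι → F),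
      (∀ k (z : M k), q • z = χ k • z) ∧ χ i ≠ 0 ∧ ∀ j ∈ s, χ j = 0 := by
    intro i s hi
    induction s using Finset.induction_on with
    | empty => exact ⟨1, fun _ => 1, fun k z => by simp, one_ne_zero, by simp⟩
    | insert j s hj ih =>
      rw [Finset.mem_insert, not_or] at hi
      obtain ⟨q, χ, hq, hχ, hs⟩ := ih hi.2
      obtain ⟨q', χ', hq', hχ'⟩ := hsep i j hi.1
      refine ⟨(q' - algebraMap F Q (χ' j)) * q, fun k => (χ' k - χ' j) * χ k, fun k z => ?_,
        mul_ne_zero (sub_ne_zero.2 hχ') hχ, fun k hk => ?_⟩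
      · rw [mul_smul, hq, sub_smul, algebraMap_smul, smul_comm, hq', smul_smul, smul_smul,
          mul_comm (χ k), ← sub_smul, ← sub_mul]
      · rcases Finset.mem_insert.1 hk with rfl | hk
        · simp
        · simp [hs k hk]
  rw [injective_iff_map_eq_zero]
  intro x hx
  by_contra hne
  obtain ⟨i, hi⟩ : ∃ i, x i ≠ 0 := by
    by_contra! h
    exact hne (DFinsupp.ext h)
  classical
  obtain ⟨q, χ, hq, hχ, hs⟩ := key i (DFinsupp.support x |>.erase i) (by simp)
  have h1 : q • x = DirectSum.lof Q ι M i (χ i • x i) := by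
    refine DFinsupp.ext fun j => ?_
    change q • x j = _
    rw [hq]
    by_cases h : j = i
    · subst h
      exact (DirectSum.lof_apply Q j _).symm
    · have h2 : DirectSum.lof Q ι M i (χ i • x i) j = 0 := DirectSum.of_eq_of_ne i j _ h
      rw [h2]
      by_cases h' : x j = 0
      · rw [h', smul_zero]
      · rw [hs j (by simp [h, h']), zero_smul]
  have h2 : Θ i (χ i • x i) = 0 := by
    rw [← DirectSum.toModule_lof Q i, ← h1, map_smul, hx, smul_zero]
  have h3 : χ i • x i = 0 := hΘ i (h2.trans (map_zero _).symm)
  exact (smul_ne_zero hχ hi) h3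

/-- A direct sum of injective maps whose ranges together contain all simple submodules, and which
are separated by elements that act by scalars, is an isomorphism onto the socle. -/
theorem exists_socle_equiv [DecidableEq ι] (Θ : ∀ i, M i →ₗ[Q] N)
    (hΘ : ∀ i, Function.Injective (Θ i)) (hss : ∀ i, IsSemisimpleModule Q (M i))
    (hsep : ∀ i j, i ≠ j → ∃ (q : Q) (χ : ι → F), (∀ k (z : M k), q • z = χ k • z) ∧ χ i ≠ χ j)
    (hN : ∀ S : Submodule Q N, IsSimpleModule Q S → ∃ i z, z ≠ 0 ∧ Θ i z ∈ S) :
    Nonempty (socle Q N ≃ₗ[Q] ⨁ i, M i) := by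
  have hr : LinearMap.range (DirectSum.toModule Q ι N Θ) = socle Q N := by
    refine le_antisymm ?_ (sSup_le fun S hS => ?_)
    · rintro _ ⟨x, rfl⟩
      induction x using DirectSum.induction_on with
      | zero => rw [map_zero]; exact zero_mem _
      | add x y hx hy => rw [map_add]; exact add_mem hx hy
      | of i z =>
        have h := DirectSum.toModule_lof Q i z (φ := Θ)
        change DirectSum.toModule Q ι N Θ (DirectSum.lof Q ι M i z) ∈ _
        rw [h]
        have := hss i
        -- A semisimple summand is the sum of its simple submodules, and an injective map carries
        -- these to simple submodules of N.
        have h2 : (⊤ : Submodule Q (M i)) ≤ (socle Q N).comap (Θ i) := by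
          rw [← IsSemisimpleModule.sSup_simples_eq_top Q (M i)]
          refine sSup_le fun S hS => Submodule.map_le_iff_le_comap.1 ?_
          have : IsSimpleModule Q S := hS
          have := IsSimpleModule.congr (Submodule.equivMapOfInjective (Θ i) (hΘ i) S).symm
          exact le_socle_of_isSimpleModule _
        exact h2 Submodule.mem_top
    · have : IsSimpleModule Q S := hS
      obtain ⟨i, z, hz, hzS⟩ := hN S hS
      have hm : Θ i z ∈ S ⊓ LinearMap.range (DirectSum.toModule Q ι N Θ) :=
        ⟨hzS, DirectSum.lof Q ι M i z, DirectSum.toModule_lof Q i z⟩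
      -- S is simple and meets the range in the nonzero element Θ_i(z), so it is contained in the
      -- range.
      have hS' : IsAtom S := IsSimpleModule.isAtom
      rcases hS'.le_iff.1 (inf_le_left (a := S) (b := LinearMap.range (DirectSum.toModule Q ι N Θ)))
        with h | h
      · rw [h, Submodule.mem_bot] at hm
        exact absurd (hΘ i (hm.trans (map_zero _).symm)) hz
      · exact inf_eq_left.1 h
  exact ⟨(LinearEquiv.ofEq _ _ hr.symm).trans
    (LinearEquiv.ofInjective _ (toModule_injective Θ hΘ hsep)).symm⟩

end Independence

/-! ### Maps of outer tensor products that vary in one factor -/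

section OuterMapPos

set_option linter.unusedSectionVars false

variable {F : Type*} [Field F] {r : ℕ}

section

variable {A A' : Fin r → Type*} [∀ k, Ring (A k)] [∀ k, Algebra F (A k)] [∀ k, Ring (A' k)]
  [∀ k, Algebra F (A' k)] {M M' : Fin r → Type*} [∀ k, AddCommGroup (M k)] [∀ k, Module F (M k)]
  [∀ k, Module (A k) (M k)] [∀ k, IsScalarTower F (A k) (M k)] [∀ k, AddCommGroup (M' k)]
  [∀ k, Module F (M' k)] [∀ k, Module (A' k) (M' k)] [∀ k, IsScalarTower F (A' k) (M' k)]

theorem outerMap_single_smul (θ : ∀ j, M' j →ₗ[F] M j) (j : Fin r) (u' : A' j) (u : A j)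
    (h : ∀ m, θ j (u' • m) = u • θ j m) (z : PiOuter F M') :
    outerMap θ (PiTensorProduct.singleAlgHom (R := F) (A := A') j u' • z)
      = PiTensorProduct.singleAlgHom (R := F) (A := A) j u • outerMap θ z := by
  refine outerMap_tprod_smul θ (Pi.mulSingle j u') (Pi.mulSingle j u) (fun i m => ?_) z
  by_cases hi : i = j
  · subst hi; simpa using h m
  · simp [hi]

variable {W : Type*} [AddCommGroup W] [Module F W] (k : Fin r)

/-- The family of maps between outer tensor products that is obtained from maps between the factors,
where the map between the `k`-th factors runs through a family. -/
def outerFamily (θ : ∀ j, M' j →ₗ[F] M j) (κ : W →ₗ[F] M' k →ₗ[F] M k) :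
    W →ₗ[F] PiOuter F M' →ₗ[F] PiOuter F M :=
  ((PiTensorProduct.mapMultilinear F M' M).toLinearMap θ k) ∘ₗ κ

variable {k} (θ : ∀ j, M' j →ₗ[F] M j) (κ : W →ₗ[F] M' k →ₗ[F] M k)

theorem outerFamily_apply (w : W) :
    outerFamily k θ κ w = outerMap (Function.update θ k (κ w)) := rfl

theorem outerFamily_of_eq {w w' : W} (u : A k) (h : ∀ z, κ w' z = u • κ w z) (z : PiOuter F M') :
    outerFamily k θ κ w' z
      = PiTensorProduct.singleAlgHom (R := F) (A := A) k u • outerFamily k θ κ w z := by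
  induction z using PiOuter.induction with
  | hadd x y hx hy => simp only [smul_add, map_add, hx, hy]
  | h t m =>
    rw [map_smul, map_smul, smul_comm _ t, outerFamily_apply, outerFamily_apply, outerMap_otprod,
      outerMap_otprod, single_smul_tprod]
    congr 2
    funext j
    by_cases hj : j = k
    · subst hj; simp [h]
    · simp [hj]

end

variable {G : Type*} [Group G] [Fintype G] {c c' : Fin r → ℕ} (hcc : ∀ j, c' j ≤ c j)
  {M M' : Fin r → Type*} [∀ k, AddCommGroup (M k)] [∀ k, Module F (M k)]
  [∀ k, Module (WHecke F G (c k)) (M k)] [∀ k, IsScalarTower F (WHecke F G (c k)) (M k)]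
  [∀ k, AddCommGroup (M' k)] [∀ k, Module F (M' k)] [∀ k, Module (WHecke F G (c' k)) (M' k)]
  [∀ k, IsScalarTower F (WHecke F G (c' k)) (M' k)]

/-- The inclusion of the positions of a smaller composition. -/
def castPos (p : Pos c') : Pos c := ⟨p.1, Fin.castLE (hcc p.1) p.2⟩

variable (θ : ∀ j, M' j →ₗ[F] M j) (hθ : ∀ j, IsGenCompat (G := G) (hcc j) (θ j))

include hθ

theorem outerMap_gP_smul (p : Pos c') (h : G) (z : PiOuter F M') :
    outerMap θ (gP F (Pi.mulSingle p h) • z)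
      = gP F (Pi.mulSingle (castPos hcc p) h) • outerMap θ z := by
  rw [gP_mulSingle, gP_mulSingle]
  exact outerMap_single_smul θ p.1 _ _ ((hθ p.1).g p.2 h) z

theorem outerMap_xP_smul (p : Pos c') (z : PiOuter F M') :
    outerMap θ (xP F G p • z) = xP F G (castPos hcc p) • outerMap θ z :=
  outerMap_single_smul θ p.1 _ _ ((hθ p.1).x p.2) z

theorem outerMap_sP_smul (j : Fin r) (i : ℕ) (hi : i + 1 < c' j) (z : PiOuter F M') :
    outerMap θ (sP F G j i hi • z)
      = sP F G (c := c) j i (hi.trans_le (hcc j)) • outerMap θ z :=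
  outerMap_single_smul θ j _ _ ((hθ j).s i hi) z

end OuterMapPos

/-! ### Generators acting on elements supported at one shuffle -/

section SymmSingle

variable {F : Type*} [Field F] {G : Type*} [Group G] [Fintype G] {r : ℕ} {c : Fin r → ℕ} {n : ℕ}
  {E : Type*} [AddCommGroup E] [Module F E] [Module (⨂[F] k, WHecke F G (c k)) E]
  [IsScalarTower F (⨂[F] k, WHecke F G (c k)) E] {ε : Fin r → G → F}
  (hε : IsBlockIdempotent (c := c) E ε) (hc : ∑ k, c k = n)

theorem gen_g_smul_symm_single (p : Pos c) (h : G) {w : Shuffle c n} {i : Fin n} (hi : w.1 p = i)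
    (v : E) : WHecke.gen F (.g (Pi.mulSingle i h)) • (indEquiv hε hc).symm (Pi.single w v)
      = (indEquiv hε hc).symm (Pi.single w (gP F (Pi.mulSingle p h) • v)) := by
  rw [← indEquiv_symm_modelHom, modelHom_g_single, ← hi, mulSingle_comp_equiv]

theorem gen_x_smul_symm_single (p : Pos c) {w : Shuffle c n} {i : Fin n} (hi : w.1 p = i) (v : E) :
    (WHecke.gen F (.x i) : WHecke F G n) • (indEquiv hε hc).symm (Pi.single w v)
      = (indEquiv hε hc).symm (Pi.single w (xP F G p • v)) := by
  rw [← indEquiv_symm_modelHom, modelHom_x_single, w.symm_eq hi]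

theorem gen_s_smul_symm_single (k : Fin r) (j : ℕ) (hj : j + 1 < c k) {w : Shuffle c n} {i : ℕ}
    (hi : i + 1 < n) (h₁ : w.1 ⟨k, ⟨j, by omega⟩⟩ = ⟨i, by omega⟩)
    (h₂ : w.1 ⟨k, ⟨j + 1, hj⟩⟩ = ⟨i + 1, hi⟩) (v : E) :
    (WHecke.gen F (.s i hi) : WHecke F G n) • (indEquiv hε hc).symm (Pi.single w v)
      = (indEquiv hε hc).symm (Pi.single w (sP F G k j hj • v)) := by
  rw [← indEquiv_symm_modelHom, modelHom_s_single hε i hi w k j hj h₁ h₂]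

end SymmSingle

/-- Frobenius reciprocity with target Hom(W, N), on which A acts through β and the values in N. The
space W only carries parameters. -/
theorem exists_ind_lift_hom {F A A₁ B : Type*} [Field F] [Ring A] [Algebra F A] [Ring A₁]
    [Algebra F A₁] [Ring B] [Algebra F B] {φ : B →ₐ[F] A} (β : A →ₐ[F] A₁) {E W N : Type*}
    [AddCommGroup E] [Module F E] [Module B E] [IsScalarTower F B E] [AddCommGroup W] [Module F W]
    [AddCommGroup N] [Module F N] [Module A₁ N] [IsScalarTower F A₁ N] (f : E →ₗ[F] W →ₗ[F] N)
    (hf : ∀ (b : B) e w, f (b • e) w = β (φ b) • f e w) :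
    ∃ g : Ind φ E →ₗ[F] W →ₗ[F] N, (∀ (a : A) z w, g (a • z) w = β a • g z w) ∧
      ∀ a e w, g (indMk φ a e) w = β a • f e w := by
  let θ : A₁ →ₐ[F] Module.End F (W →ₗ[F] N) := AlgHom.ofLinearMap
    (LinearMap.llcomp F W N N ∘ₗ (Algebra.lsmul F F N : A₁ →ₐ[F] Module.End F N).toLinearMap)
    (by ext; simp) (fun a b => by ext; simp)
  obtain ⟨g, h₁, h₂⟩ := exists_ind_lift (φ := φ) (θ.comp β) f
    fun b e => LinearMap.ext fun w => hf b e w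
  exact ⟨g, fun a z w => LinearMap.congr_fun (h₁ a z) w,
    fun a e w => LinearMap.congr_fun (h₂ a e) w⟩

/-! ### Maps from the summands to the restriction of the induced module -/

section BranchMap

set_option linter.unusedSectionVars false

variable {F : Type*} [Field F] {G : Type*} [Group G] [Fintype G] {r : ℕ} {c c' : Fin r → ℕ}
  {k : Fin r} (hk : c' k + 1 = c k) (hc' : ∀ j, j ≠ k → c' j = c j)
  {E : Type*} [AddCommGroup E] [Module F E] [Module (⨂[F] k, WHecke F G (c k)) E]
  [IsScalarTower F (⨂[F] k, WHecke F G (c k)) E]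
  {E' : Type*} [AddCommGroup E'] [Module F E'] [Module (⨂[F] k, WHecke F G (c' k)) E']
  [IsScalarTower F (⨂[F] k, WHecke F G (c' k)) E']
  {W : Type*} [AddCommGroup W] [Module F W] [Module (WHecke F G 1) W]
  [IsScalarTower F (WHecke F G 1) W]

theorem le_of_pred {c c' : Fin r → ℕ} {k : Fin r} (hk : c' k + 1 = c k)
    (hc' : ∀ j, j ≠ k → c' j = c j) (j : Fin r) : c' j ≤ c j := by
  by_cases h : j = k
  · subst h; omega
  · exact (hc' j h).le

/-- The maps from an outer tensor product `E'` of `H_{c'}(G)`-modules to one of `H_c(G)`-modules,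
depending linearly on an element of an `H_1(G)`-module, that are compatible with the generators. -/
structure IsBranchFamily (ι : W →ₗ[F] E' →ₗ[F] E) : Prop where
  g : ∀ (p : Pos c') (h : G) w e, ι w (gP F (Pi.mulSingle p h) • e)
    = gP F (Pi.mulSingle (castPos (le_of_pred hk hc') p) h) • ι w e
  x : ∀ (p : Pos c') w e, ι w (xP F G p • e)
    = xP F G (castPos (le_of_pred hk hc') p) • ι w e
  s : ∀ (j : Fin r) (i : ℕ) (hi : i + 1 < c' j) w e, ι w (sP F G j i hi • e)
    = sP F G (c := c) j i (hi.trans_le (le_of_pred hk hc' j)) • ι w e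
  g_last : ∀ (t : Fin 1 → G) w e, ι ((WHecke.gen F (.g t) : WHecke F G 1) • w) e
    = gP F (Pi.mulSingle (⟨k, ⟨c' k, by omega⟩⟩ : Pos c) (t 0)) • ι w e
  x_last : ∀ (j : Fin 1) w e, ι ((WHecke.gen F (.x j) : WHecke F G 1) • w) e
    = xP F G (⟨k, ⟨c' k, by omega⟩⟩ : Pos c) • ι w e

variable {n : ℕ} (hc : ∑ j, c j = n + 1) (hn : ∑ j, c' j = n) {ε : Fin r → G → F}
  (hε : IsBlockIdempotent (c := c) E ε)

/-- The shuffle in which the last letter is `k` and the other letters increase. -/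
def lastShuffle : Shuffle c (n + 1) := Shuffle.ext hk hc' hc (Shuffle.base hn)

theorem lastShuffle_castPos (p : Pos c') :
    (lastShuffle hk hc' hc hn).1 (castPos (le_of_pred hk hc') p)
      = (basePlace hn p).castSucc :=
  Shuffle.ext_apply_of_lt hk hc' hc (Shuffle.base hn) p.1 p.2 p.2.2 _

theorem lastShuffle_last :
    (lastShuffle hk hc' hc hn).1 ⟨k, ⟨c' k, by omega⟩⟩ = Fin.last n :=
  Shuffle.ext_apply_last hk hc' hc (Shuffle.base hn) _

variable (ι : W →ₗ[F] E' →ₗ[F] E)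

/-- The bilinear map `E' × W → ind E` whose values are supported at one shuffle. -/
def branchBilin : E' →ₗ[F] W →ₗ[F] Ind (youngHom F G c hc) E :=
  (ι.compr₂ ((indEquiv hε hc).symm.toLinearMap ∘ₗ
    LinearMap.single F (fun _ : Shuffle c (n + 1) => E) (lastShuffle hk hc' hc hn))).flip

theorem branchBilin_apply (e : E') (w : W) : branchBilin hk hc' hc hn hε ι e w
    = (indEquiv hε hc).symm (Pi.single (lastShuffle hk hc' hc hn) (ι w e)) := rfl

variable {ι} (hι : IsBranchFamily (G := G) hk hc' ι)

include hι

/-- On the places before the last one, the special shuffle is the base shuffle of the smaller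
composition, so each generator of the smaller Young subalgebra acts through the same position of E.
-/
theorem branchBilin_smul_left (b : ⨂[F] k, WHecke F G (c' k)) (e : E') (w : W) :
    branchBilin hk hc' hc hn hε ι (b • e) w
      = block F (d := 0) (by omega : 0 + n ≤ n + 1) (youngHom F G c' hn b) •
        branchBilin hk hc' hc hn hε ι e w := by
  induction b using pos_induction generalizing e with
  | hg p h =>
    rw [youngHom_gP_mulSingle, block_gen, shiftGen, extG_mulSingle (by omega), branchBilin_apply, hι.g]
    exact (gen_g_smul_symm_single hε hc _ h
      ((lastShuffle_castPos hk hc' hc hn p).trans (by simp [Fin.ext_iff])) _).symm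
  | hx p =>
    rw [youngHom_xP, block_gen, shiftGen, branchBilin_apply, hι.x]
    exact (gen_x_smul_symm_single hε hc _
      ((lastShuffle_castPos hk hc' hc hn p).trans (by simp [Fin.ext_iff])) _).symm
  | hs j i hi =>
    rw [youngHom_sP, block_gen, shiftGen, branchBilin_apply, hι.s]
    exact (gen_s_smul_symm_single hε hc _ _ _ _
      ((lastShuffle_castPos hk hc' hc hn ⟨j, ⟨i, by omega⟩⟩).trans
        (by simp [basePlace]))
      ((lastShuffle_castPos hk hc' hc hn ⟨j, ⟨i + 1, by omega⟩⟩).trans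
        (by simp [basePlace, add_assoc])) _).symm
  | hc t =>
    simp only [AlgHom.commutes, algebraMap_smul, map_smul, LinearMap.smul_apply]
  | hadd a b ha hb => simp only [add_smul, map_add, LinearMap.add_apply, ha, hb]
  | hmul a b ha hb => rw [mul_smul, ha, hb, map_mul, map_mul, mul_smul]

/-- The last place of the special shuffle is held by the last position of the k-th block, where the
family is compatible with H_1(G). -/
theorem branchBilin_smul_right (b : WHecke F G 1) (e : E') (w : W) :
    branchBilin hk hc' hc hn hε ι e (b • w)
      = block F (d := n) (by omega : n + 1 ≤ n + 1) b • branchBilin hk hc' hc hn hε ι e w := by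
  have hb : b ∈ Algebra.adjoin F (Set.range (WHecke.gen F (G := G) (n := 1))) := by
    rw [WHecke.adjoin_gen]; trivial
  induction hb using Algebra.adjoin_induction generalizing w with
  | mem b hb =>
    obtain ⟨b, rfl⟩ := hb
    cases b with
    | g t =>
      obtain ⟨h, rfl⟩ : ∃ h, t = Pi.mulSingle 0 h :=
        ⟨t 0, funext fun j => by rw [Subsingleton.elim j 0, Pi.mulSingle_eq_same]⟩
      rw [block_gen, shiftGen, extG_mulSingle (by omega), branchBilin_apply, hι.g_last, Pi.mulSingle_eq_same]
      exact (gen_g_smul_symm_single hε hc _ h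
        ((lastShuffle_last hk hc' hc hn).trans (by simp [Fin.ext_iff])) _).symm
    | x j =>
      rw [block_gen, shiftGen, branchBilin_apply, hι.x_last]
      exact (gen_x_smul_symm_single hε hc _
        ((lastShuffle_last hk hc' hc hn).trans (by simp [Fin.ext_iff])) _).symm
    | s j hj => omega
  | algebraMap t => rw [AlgHom.commutes, algebraMap_smul, algebraMap_smul, map_smul]
  | add a b _ _ ha hb => simp only [add_smul, map_add, ha, hb]
  | mul a b _ _ ha hb => rw [mul_smul, ha, hb, map_mul, mul_smul]

/-- Extend from E' to its induced module by Frobenius reciprocity. Linearity over H_1(G) passes from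
E' to all of the induced module because the algebras at the first n places and at the last place
commute. -/
theorem exists_branchMap :
    ∃ Θ : Outer F (Ind (youngHom F G c' hn) E') W →ₗ[WHecke F G n ⊗[F] WHecke F G 1]
        Res (lastHom F G n) (Ind (youngHom F G c hc) E),
      ∀ e w, Θ (outerMk F _ W (indMk _ 1 e) w) = branchBilin hk hc' hc hn hε ι e w := by
  let β : WHecke F G n →ₐ[F] WHecke F G (n + 1) := block F (d := 0) (by omega)
  obtain ⟨g, h₁, h₂⟩ := exists_ind_lift_hom (φ := youngHom F G c' hn) β
    (branchBilin hk hc' hc hn hε ι) (branchBilin_smul_left hk hc' hc hn hε hι)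
  have h₂' : ∀ a e w, g (indMk _ a e) w = β a • branchBilin hk hc' hc hn hε ι e w := h₂
  have H₁ : ∀ (a : WHecke F G n) m w, g (a • m) w = lastHom F G n (a ⊗ₜ 1) • g m w := by
    intro a m w
    rw [h₁, lastHom, Algebra.TensorProduct.lift_tmul, map_one, mul_one]
  have H₂ : ∀ (b : WHecke F G 1) m w, g m (b • w) = lastHom F G n (1 ⊗ₜ b) • g m w := by
    intro b m w
    rw [lastHom, Algebra.TensorProduct.lift_tmul, map_one, one_mul]
    induction m using Ind.induction with
    | h0 => simp
    | hadd x y hx hy => simp only [map_add, LinearMap.add_apply, smul_add, hx, hy]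
    | h a e =>
      rw [h₂, h₂, branchBilin_smul_right hk hc' hc hn hε hι, ← mul_smul, ← mul_smul,
        (block_commute F _ _ (by omega) a b).eq]
  obtain ⟨Θ, hΘ⟩ := exists_outer_lift (lastHom F G n) g H₁ H₂
  exact ⟨Θ, fun e w => (hΘ _ w).trans ((h₂ 1 e w).trans (by rw [map_one, one_smul]))⟩

/-- The kernel corresponds to a submodule of ind E' and then to a submodule of E'. The component of
Θ at the special shuffle is ι, so every e in the latter submodule satisfies ι w e = 0 for all w. -/
theorem branchMap_injective [IsAlgClosed F] [FiniteDimensional F W] [IsSimpleModule (WHecke F G 1) W]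
    (hε' : IsBlockIdempotent (c := c') E' ε) (hinj : ∀ e, (∀ w, ι w e = 0) → e = 0)
    (Θ : Outer F (Ind (youngHom F G c' hn) E') W →ₗ[WHecke F G n ⊗[F] WHecke F G 1]
        Res (lastHom F G n) (Ind (youngHom F G c hc) E))
    (hΘ : ∀ e w, Θ (outerMk F _ W (indMk _ 1 e) w) = branchBilin hk hc' hc hn hε ι e w) :
    Function.Injective Θ := by
  refine outer_lift_injective Θ fun K hK => ?_
  obtain ⟨o, ho⟩ := exists_ind_orderIso hε' hn
  refine o.injective (Eq.trans ?_ (map_bot o).symm)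
  refine (Submodule.eq_bot_iff _).2 fun e he => hinj e fun w => ?_
  have h := hK _ ((ho K e).1 he) w
  rw [hΘ, branchBilin_apply] at h
  exact (Pi.single_eq_zero_iff.1 ((indEquiv hε hc).symm.map_eq_zero_iff.1 h))

end BranchMap

/-! ### The branching maps for a family and semisimplicity after removal -/

section RemoveFamily

set_option linter.unusedSectionVars false

variable {F : Type*} [Field F] [IsAlgClosed F] {G : Type*} [Group G] [Fintype G]

theorem isSimpleModule_lOne (u a : F) : IsSimpleModule (DHecke F u 1) (DHecke.LOne F u a) := by
  refine isSimpleModule_iff_toSpanSingleton_surjective.2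
    ⟨inferInstanceAs (Nontrivial F), fun x hx y => ⟨algebraMap F _ (lOneVal y / lOneVal x), ?_⟩⟩
  rw [LinearMap.toSpanSingleton_apply, algebraMap_smul]
  exact div_mul_cancel₀ (lOneVal y) (b := lOneVal x) hx

section

variable {V : Type*} [AddCommGroup V] [Module F V] [FiniteDimensional F V] (ρ : Representation F G V)
  [ρ.IsIrreducible] (a : F)

theorem isSimpleModule_factor_lOne : IsSimpleModule (WHecke F G 1)
    (Factor ρ 1 (DHecke.LOne F (twist (flipScalar ρ)) a)) := by
  have := isSimpleModule_lOne (twist (flipScalar ρ)) a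
  exact isSimpleModule_factor ρ

theorem finite_factor_lOne :
    FiniteDimensional F (Factor ρ 1 (DHecke.LOne F (twist (flipScalar ρ)) a)) := by
  have : FiniteDimensional F (DHecke.LOne F (twist (flipScalar ρ)) a) :=
    inferInstanceAs (FiniteDimensional F F)
  exact finite_factor ρ

end

universe v₁ v₂

variable {F : Type v₁} [Field F] [IsAlgClosed F] {G : Type*} [Group G] [Fintype G] {r : ℕ}
  {V : Fin r → Type*} [∀ k, AddCommGroup (V k)] [∀ k, Module F (V k)]
  [∀ k, FiniteDimensional F (V k)] {ρ : ∀ k, Representation F G (V k)} [∀ k, (ρ k).IsIrreducible]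
  (L : Family.{_, _, _, v₂} ρ) (k : Fin r) (a : F)

theorem Family.remove_self : L.remove k a k = (L k).eTilde a := Function.update_self _ _ _

variable {k} in
theorem Family.remove_of_ne {j : Fin r} (h : j ≠ k) : L.remove k a j = L j :=
  Function.update_of_ne h _ _

variable {k}

theorem Family.rank_remove_of_ne {j : Fin r} (h : j ≠ k) : (L.remove k a j).rank = (L j).rank := by
  rw [L.remove_of_ne a h]

variable (hk : 0 < (L k).rank)

theorem Family.rank_remove_add_one (hk : 0 < (L k).rank) :
    (L.remove k a k).rank + 1 = (L k).rank :=
  rank_add_one (ρ k) (L.remove_self k a) hk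

open Classical in
/-- The identifications of the factors that are not changed by the removal. -/
def Family.restMap (j : Fin r) :
    Factor (ρ j) (L.remove k a j).rank (L.remove k a j).carrier →ₗ[F]
      Factor (ρ j) (L j).rank (L j).carrier :=
  if h : j = k then 0 else factorCast (ρ j) (L.remove_of_ne a h)

/-- The map `E' × (V_k ⊗ L(a)) → E` between the outer tensor products from which `D(L)` and the
module obtained by removal are induced. -/
def Family.branch : Factor (ρ k) 1 (DHecke.LOne F (twist (flipScalar (ρ k))) a) →ₗ[F]
    PiOuter F (fun j => Factor (ρ j) (L.remove k a j).rank (L.remove k a j).carrier) →ₗ[F]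
    PiOuter F (fun j => Factor (ρ j) (L j).rank (L j).carrier) :=
  outerFamily k (L.restMap a) (removeMap (ρ k) (L.remove_self k a) hk)

theorem Family.isGenCompat_update (w) (j : Fin r)
    (hj : (L.remove k a j).rank ≤ (L j).rank) : IsGenCompat (G := G) hj
      (Function.update (L.restMap a) k (removeMap (ρ k) (L.remove_self k a) hk w) j) := by
  by_cases h : j = k
  · subst h
    rw [Function.update_self]
    exact isGenCompat_removeMap (ρ j) _ _ _ w
  · rw [Function.update_of_ne h, Family.restMap, dif_neg h]
    exact isGenCompat_factorCast (ρ j) _ _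

theorem Family.isBranchFamily (hL : ∀ k, IsSimpleModule
      (DHecke F (twist (flipScalar (ρ k))) (L k).rank) (L k).carrier) :
    IsBranchFamily (G := G) (c := fun j => (L j).rank) (c' := fun j => (L.remove k a j).rank)
      (L.rank_remove_add_one a hk) (fun _ h => L.rank_remove_of_ne a h) (L.branch a hk) where
  g p h w e := outerMap_gP_smul _ _ (fun j => L.isGenCompat_update a hk w j _) p h e
  x p w e := outerMap_xP_smul _ _ (fun j => L.isGenCompat_update a hk w j _) p e
  s j i hi w e := outerMap_sP_smul (le_of_pred (c := fun j => (L j).rank)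
    (c' := fun j => (L.remove k a j).rank) (L.rank_remove_add_one a hk)
    fun _ h => L.rank_remove_of_ne a h) _ (fun j => L.isGenCompat_update a hk w j _) j i hi e
  g_last t w e := by
    rw [gP_mulSingle]
    exact outerFamily_of_eq (A := fun j => WHecke F G (L j).rank) _ _ _ (fun z =>
      removeMap_gen_g_smul (ρ k) (L.remove_self k a) hk t w z) e
  x_last j w e := by
    have := hL k
    exact outerFamily_of_eq (A := fun j => WHecke F G (L j).rank) _ _ _ (fun z =>
      removeMap_gen_x_smul (ρ k) (L.remove_self k a) hk j w z) e

theorem Family.branch_injective {w} (hw : w ≠ 0) : Function.Injective (L.branch a hk w) := by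
  refine piTensorProduct_map_injective _ fun j => ?_
  by_cases h : j = k
  · subst h
    rw [Function.update_self]
    exact removeMap_injective (ρ j) _ _ hw
  · rw [Function.update_of_ne h, Family.restMap, dif_neg h]
    exact factorCast_injective (ρ j) _

theorem Family.eq_zero_of_branch (e) (h : ∀ w, L.branch a hk w e = 0) : e = 0 := by
  have := isSimpleModule_factor_lOne (ρ k) a
  have := IsSimpleModule.nontrivial (WHecke F G 1)
    (Factor (ρ k) 1 (DHecke.LOne F (twist (flipScalar (ρ k))) a))
  obtain ⟨w, hw⟩ := exists_ne (0 : Factor (ρ k) 1 (DHecke.LOne F (twist (flipScalar (ρ k))) a))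
  exact L.branch_injective a hk hw ((h w).trans (map_zero _).symm)

variable (hL : ∀ k, IsSimpleModule
  (DHecke F (twist (flipScalar (ρ k))) (L k).rank) (L k).carrier)

include hL hk

/-- Each factor after removal embeds into the corresponding factor for L, where simplicity gives
finite dimension. -/
theorem Family.finite_remove (j : Fin r) : FiniteDimensional F
    (Factor (ρ j) (L.remove k a j).rank (L.remove k a j).carrier) := by
  have h : FiniteDimensional F (Factor (ρ j) (L j).rank (L j).carrier) := by
    have := hL j
    have := DHecke.finite_of_isSimpleModule (F := F) (u := twist (flipScalar (ρ j)))
      (n := (L j).rank) (L j).carrier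
    exact finite_factor (ρ j)
  by_cases hj : j = k
  · subst hj
    have := isSimpleModule_factor_lOne (ρ j) a
    have := IsSimpleModule.nontrivial (WHecke F G 1)
      (Factor (ρ j) 1 (DHecke.LOne F (twist (flipScalar (ρ j))) a))
    obtain ⟨w, hw⟩ := exists_ne (0 : Factor (ρ j) 1 (DHecke.LOne F (twist (flipScalar (ρ j))) a))
    exact FiniteDimensional.of_injective _
      (removeMap_injective (ρ j) (L.remove_self j a) hk hw)
  · exact FiniteDimensional.of_injective _ (factorCast_injective (ρ j) (L.remove_of_ne a hj))

/-- The module obtained by removal is semisimple. -/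
theorem Family.isSemisimpleModule_remove {ε : Fin r → G → F} (hε : IsSeparating ρ ε) {n : ℕ}
    (hn : ∑ j, (L.remove k a j).rank = n) :
    IsSemisimpleModule (WHecke F G n) ((L.remove k a).D hn) := by
  have := L.finite_remove a hk hL
  -- The lattice isomorphisms for induction, for the outer tensor product and for V_k^{⊗m} ⊗ L
  -- reduce the claim to ẽ_a L_k, which is semisimple as a socle. Only the k-th factor can fail to
  -- be simple.
  obtain ⟨o, -⟩ := exists_ind_orderIso (hε.isBlockIdempotent (L.remove k a)) hn
  obtain ⟨o', -⟩ := exists_piOuter_orderIso (F := F)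
    (A := fun j => WHecke F G (L.remove k a j).rank)
    (M := fun j => Factor (ρ j) (L.remove k a j).rank (L.remove k a j).carrier) k (fun j hj => by
      have : IsSimpleModule (DHecke F (twist (flipScalar (ρ j))) (L.remove k a j).rank)
          (L.remove k a j).carrier := by
        rw [L.remove_of_ne a hj]; exact hL j
      exact isSimpleModule_factor (ρ j))
  have : IsSemisimpleModule (DHecke F (twist (flipScalar (ρ k))) (L.remove k a k).rank)
      (L.remove k a k).carrier := by
    rw [L.remove_self k a]; exact DMod.isSemisimpleModule_eTilde _ a
  have := isSemisimpleModule_factor (G := G) (ρ k) (m := (L.remove k a k).rank)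
    (L := (L.remove k a k).carrier)
  exact isSemisimpleModule_of_orderIso (o.trans o')

end RemoveFamily

/-! ### The component of a submodule of the restriction at the special shuffle -/

section Descent

set_option linter.unusedSectionVars false

variable {F : Type*} [Field F] {G : Type*} [Group G] [Fintype G] {r : ℕ} {c c' : Fin r → ℕ}
  {k : Fin r} (hk : c' k + 1 = c k) (hc' : ∀ j, j ≠ k → c' j = c j) {n : ℕ}
  (hc : ∑ j, c j = n + 1) (hn : ∑ j, c' j = n)
  {E : Type*} [AddCommGroup E] [Module F E] [Module (⨂[F] k, WHecke F G (c k)) E]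
  [IsScalarTower F (⨂[F] k, WHecke F G (c k)) E] {ε : Fin r → G → F}
  (hε : IsBlockIdempotent (c := c) E ε)

theorem gen_g_smul_symm_single' (b : Pos c → G) (w : Shuffle c n) {hc : ∑ j, c j = n} (v : E) :
    WHecke.gen F (.g (b ∘ w.1.symm)) • (indEquiv hε hc).symm (Pi.single w v)
      = (indEquiv hε hc).symm (Pi.single w (gP F b • v)) := by
  rw [← indEquiv_symm_modelHom, modelHom_g_single]
  congr 4
  funext p
  simp

theorem smul_mem_of_mem_parabolic {N : Type*} [AddCommGroup N] [Module F N]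
    [Module (WHecke F G (n + 1)) N] [IsScalarTower F (WHecke F G (n + 1)) N]
    (S : Submodule (WHecke F G n ⊗[F] WHecke F G 1) (Res (lastHom F G n) N))
    {a : WHecke F G (n + 1)} (ha : a ∈ parabolic F G (n + 1) {i | i + 1 < n}) {z : N}
    (hz : (show Res (lastHom F G n) N from z) ∈ S) :
    (show Res (lastHom F G n) N from a • z) ∈ S := by
  rw [← range_lastHom] at ha
  obtain ⟨q, rfl⟩ := ha
  exact S.smul_mem q hz

theorem gen_g_mem_parabolic (T : Set ℕ) (b : Fin n → G) :
    WHecke.gen F (.g b) ∈ parabolic F G n T := Algebra.subset_adjoin (Or.inl ⟨b, rfl⟩)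

theorem gen_x_mem_parabolic (T : Set ℕ) (i : Fin n) :
    (WHecke.gen F (.x i) : WHecke F G n) ∈ parabolic F G n T :=
  Algebra.subset_adjoin (Or.inr (Or.inl ⟨i, rfl⟩))

theorem gen_s_mem_parabolic {T : Set ℕ} {i : ℕ} (hi : i + 1 < n) (hT : i ∈ T) :
    (WHecke.gen F (.s i hi) : WHecke F G n) ∈ parabolic F G n T :=
  Algebra.subset_adjoin (Or.inr (Or.inr ⟨i, hi, hT, rfl⟩))

variable (S : Submodule (WHecke F G n ⊗[F] WHecke F G 1)
  (Res (lastHom F G n) (Ind (youngHom F G c hc) E)))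

/-- The component of a submodule of an induced module at the last shuffle. -/
def component : Submodule F E where
  carrier := {v | (show Res (lastHom F G n) (Ind (youngHom F G c hc) E) from
    (indEquiv hε hc).symm (Pi.single (lastShuffle hk hc' hc hn) v)) ∈ S}
  add_mem' {v v'} hv hv' := by
    have h : (Pi.single (lastShuffle hk hc' hc hn) (v + v') : Shuffle c (n + 1) → E)
      = Pi.single (lastShuffle hk hc' hc hn) v + Pi.single (lastShuffle hk hc' hc hn) v' :=
      Pi.single_add _ _ _
    rw [Set.mem_ofPred_eq, h, map_add]
    exact S.add_mem hv hv'
  zero_mem' := by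
    rw [Set.mem_ofPred_eq, Pi.single_zero, map_zero]
    exact S.zero_mem
  smul_mem' t v hv := by
    have h : (Pi.single (lastShuffle hk hc' hc hn) (t • v) : Shuffle c (n + 1) → E)
      = t • Pi.single (lastShuffle hk hc' hc hn) v := Pi.single_smul _ _ _
    rw [Set.mem_ofPred_eq, h, map_smul]
    exact (S.restrictScalars F).smul_mem t hv

theorem mem_component {v : E} : v ∈ component hk hc' hc hn hε S ↔
    (show Res (lastHom F G n) (Ind (youngHom F G c hc) E) from
      (indEquiv hε hc).symm (Pi.single (lastShuffle hk hc' hc hn) v)) ∈ S := Iff.rfl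

theorem gP_smul_mem_component (b : Pos c → G) {v : E} (hv : v ∈ component hk hc' hc hn hε S) :
    gP F b • v ∈ component hk hc' hc hn hε S := by
  rw [mem_component, ← gen_g_smul_symm_single']
  exact smul_mem_of_mem_parabolic S (gen_g_mem_parabolic _ _) hv

theorem xP_smul_mem_component (p : Pos c) {v : E} (hv : v ∈ component hk hc' hc hn hε S) :
    xP F G p • v ∈ component hk hc' hc hn hε S := by
  rw [mem_component, ← gen_x_smul_symm_single hε hc p rfl]
  exact smul_mem_of_mem_parabolic S (gen_x_mem_parabolic _ _) hv

/-- The bound `hi'` excludes exactly the last reflection of the k-th block, which involves the last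
place and so does not lie in H_{n,1}(G). -/
theorem sP_smul_mem_component (j : Fin r) (i : ℕ) (hi : i + 1 < c j) (hi' : i + 1 < c' j) {v : E}
    (hv : v ∈ component hk hc' hc hn hε S) :
    sP F G j i hi • v ∈ component hk hc' hc hn hε S := by
  have hle := offset_add_le c' hn j
  rw [mem_component, ← gen_s_smul_symm_single hε hc j i hi (i := offset c' j + i) (by omega)
    ((lastShuffle_castPos hk hc' hc hn ⟨j, ⟨i, by omega⟩⟩).trans
        (by simp [basePlace]))
    ((lastShuffle_castPos hk hc' hc hn ⟨j, ⟨i + 1, by omega⟩⟩).trans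
        (by simp [basePlace, add_assoc]))]
  exact smul_mem_of_mem_parabolic S (gen_s_mem_parabolic _ (show offset c' j + i + 1 < n by omega)) hv

/-- All shuffles with last letter k are connected by exchanges at the first n places, and the
corresponding s_i survive the restriction. -/
theorem symm_single_swap_mem (w : Shuffle c' n) (v : E)
    (h : (show Res (lastHom F G n) (Ind (youngHom F G c hc) E) from
      (indEquiv hε hc).symm (Pi.single (Shuffle.ext hk hc' hc w) v)) ∈ S) :
    v ∈ component hk hc' hc hn hε S := by
  induction w using Shuffle.induction hn with
  | h0 => exact h
  | hs w i hi hw ih =>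
    refine ih ?_
    have h' : (Shuffle.ext hk hc' hc w).letter ⟨i, by omega⟩
        ≠ (Shuffle.ext hk hc' hc w).letter ⟨i + 1, by omega⟩ := by
      have h1 := Shuffle.letter_ext_castSucc hk hc' hc w ⟨i, by omega⟩
      have h2 := Shuffle.letter_ext_castSucc hk hc' hc w ⟨i + 1, hi⟩
      intro h3
      exact hw (h1.symm.trans (h3.trans h2))
    rw [Shuffle.ext_swap hk hc' hc w i hi hw h'] at h
    have h1 := smul_mem_of_mem_parabolic S
      (gen_s_mem_parabolic (T := {i | i + 1 < n}) (i := i) (by omega) hi) h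
    rw [← indEquiv_symm_modelHom,
      modelHom_s_single_of_ne hε i _ _ (Shuffle.letter_swap_ne _ i _ h'), Shuffle.swap_swap] at h1
    exact h1

omit hn in
-- Take a nonzero element of S, a shuffle at which it does not vanish, and let k be the last letter
-- of that shuffle. The projection to the shuffle acts through elements of G^n and the x_i alone, so
-- it preserves S.
theorem exists_component_ne_bot (hS : S ≠ ⊥) :
    ∃ k, 0 < c k ∧ ∀ (c' : Fin r → ℕ) (hk : c' k + 1 = c k) (hc' : ∀ j, j ≠ k → c' j = c j)
      (hn : ∑ j, c' j = n), component hk hc' hc hn hε S ≠ ⊥ := by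
  obtain ⟨z, hz, hz0⟩ := S.exists_mem_ne_zero_of_ne_bot hS
  obtain ⟨w, hw⟩ : ∃ w, indEquiv hε hc z w ≠ 0 := by
    by_contra! h
    exact hz0 ((indEquiv hε hc).map_eq_zero_iff.1 (funext h))
  obtain ⟨a, ha, haw⟩ := exists_modelHom_eq_single hε w
  have hmem : (show Res (lastHom F G n) (Ind (youngHom F G c hc) E) from
      (indEquiv hε hc).symm (Pi.single w (indEquiv hε hc z w))) ∈ S := by
    rw [← haw, indEquiv_symm_modelHom]
    refine (congrArg (fun y : Ind (youngHom F G c hc) E =>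
      (show Res (lastHom F G n) (Ind (youngHom F G c hc) E) from a • y) ∈ S)
      ((indEquiv hε hc).symm_apply_apply z)).mpr ?_
    exact smul_mem_of_mem_parabolic S (Algebra.adjoin_mono (by
      rintro x (h | h | ⟨i, hi, h, -⟩)
      · exact Or.inl h
      · exact Or.inr (Or.inl h)
      · exact absurd h (Set.notMem_empty _)) ha) hz
  refine ⟨w.letter (Fin.last n), (Nat.zero_le _).trans_lt (w.1.symm (Fin.last n)).2.2,
    fun c' hk hc' hn h => hw ?_⟩
  obtain ⟨w', hw'⟩ := Shuffle.exists_ext hk hc' hc w rfl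
  have h1 := symm_single_swap_mem hk hc' hc hn hε S w' (indEquiv hε hc z w) (by rw [hw']; exact hmem)
  rw [h] at h1
  exact (Submodule.mem_bot F).1 h1

end Descent

/-! ### From a subspace of the outer tensor product to its k-th factor -/

section DescentPiOuter

set_option linter.unusedSectionVars false

variable {F : Type*} [Field F] [IsAlgClosed F] {G : Type*} [Group G] [Fintype G] {r : ℕ}
  {c : Fin r → ℕ} {k : Fin r} {M : Fin r → Type*} [∀ k, AddCommGroup (M k)] [∀ k, Module F (M k)]
  [∀ k, Module (WHecke F G (c k)) (M k)] [∀ k, IsScalarTower F (WHecke F G (c k)) (M k)]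
  [∀ j, FiniteDimensional F (M j)] (hM : ∀ j, j ≠ k → IsSimpleModule (WHecke F G (c j)) (M j))
  (K : Submodule F (PiOuter F M))

theorem single_smul_mem_of_gen {j : Fin r}
    (hgen : ∀ a, ∀ z ∈ K, PiTensorProduct.singleAlgHom (R := F) (A := fun k => WHecke F G (c k)) j
      (WHecke.gen F a) • z ∈ K) (u : WHecke F G (c j)) {z : PiOuter F M} (hz : z ∈ K) :
    PiTensorProduct.singleAlgHom (R := F) (A := fun k => WHecke F G (c k)) j u • z ∈ K := by
  have hu : u ∈ Algebra.adjoin F (Set.range (WHecke.gen F (G := G) (n := c j))) := by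
    rw [WHecke.adjoin_gen]; trivial
  induction hu using Algebra.adjoin_induction generalizing z with
  | mem u hu => obtain ⟨a, rfl⟩ := hu; exact hgen a z hz
  | algebraMap t => rw [AlgHom.commutes, algebraMap_smul]; exact K.smul_mem t hz
  | add a b _ _ ha hb => rw [map_add, add_smul]; exact K.add_mem (ha hz) (hb hz)
  | mul a b _ _ ha hb => rw [map_mul, mul_smul]; exact ha (hb hz)

theorem tprod_smul_mem_of_single {a : ∀ j, WHecke F G (c j)}
    (h : ∀ j, ∀ z ∈ K, PiTensorProduct.singleAlgHom (R := F) (A := fun k => WHecke F G (c k)) j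
      (a j) • z ∈ K) {z : PiOuter F M} (hz : z ∈ K) : PiTensorProduct.tprod F a • z ∈ K := by
  let X : Submonoid (∀ j, WHecke F G (c j)) :=
    { carrier := {a | ∀ z ∈ K, PiTensorProduct.tprod F a • z ∈ K}
      one_mem' := fun z hz => by
        rwa [← PiTensorProduct.one_def, one_smul]
      mul_mem' := fun {a b} ha hb z hz => by
        rw [← PiTensorProduct.tprod_mul_tprod, mul_smul]
        exact ha _ (hb z hz) }
  refine (Submonoid.pi_mem_of_mulSingle_mem (H := X) a fun j z hz => ?_) z hz
  have h1 := h j z hz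
  rwa [PiTensorProduct.singleAlgHom_apply, MonoidHom.mulSingle_apply] at h1

theorem single_gen_g_smul_mem (hg : ∀ b, ∀ z ∈ K, gP F (c := c) (G := G) b • z ∈ K) {j : Fin r}
    (b : Fin (c j) → G) {z} (hz : z ∈ K) :
    PiTensorProduct.singleAlgHom (R := F) (A := fun k => WHecke F G (c k)) j
      (WHecke.gen F (.g b)) • z ∈ K := by
  have h := gP_eq_single (F := F) (c := c) j (fun p => if h : p.1 = j then b (h ▸ p.2) else 1)
    (fun l hl i => dif_neg hl)
  simp only [dite_true] at h
  rw [← h]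
  exact hg _ _ hz

include hM in
/-- A nonzero subspace of an outer tensor product that is stable under all generators but the last
simple reflection of the `k`-th factor contains a nonzero subspace that is the tensor product of
the other factors with a subspace of the `k`-th factor, where the latter is stable likewise. -/
theorem exists_untens_piOuter (hK : K ≠ ⊥) (hg : ∀ b, ∀ z ∈ K, gP F (c := c) (G := G) b • z ∈ K)
    (hx : ∀ p, ∀ z ∈ K, xP F G (c := c) p • z ∈ K)
    (hs : ∀ j i hi, (j = k → i + 1 + 1 < c j) → ∀ z ∈ K, sP F G (c := c) j i hi • z ∈ K) :
    ∃ Y : Submodule F (M k), Y ≠ ⊥ ∧ (∀ x ∈ Y, ∀ w, (splitEquiv F M k).symm (w ⊗ₜ x) ∈ K) ∧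
      (∀ b, ∀ z ∈ Y, (WHecke.gen F (.g b) : WHecke F G (c k)) • z ∈ Y) ∧
      (∀ i, ∀ z ∈ Y, (WHecke.gen F (.x i) : WHecke F G (c k)) • z ∈ Y) ∧
      (∀ i hi, i + 1 + 1 < c k →
        ∀ z ∈ Y, (WHecke.gen F (.s i hi) : WHecke F G (c k)) • z ∈ Y) := by
  have : FiniteDimensional F (Rest F M k) := finite_piTensorProduct
  let K' : Submodule F (Rest F M k ⊗[F] M k) := K.comap (splitEquiv F M k).symm.toLinearMap
  have hK' : ∀ z, z ∈ K' ↔ (splitEquiv F M k).symm z ∈ K := fun z => Iff.rfl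
  have h := tens_untens K' fun T z hz => by
    rw [hK'] at hz ⊢
    -- The missing reflection belongs to the k-th block. In the other factors all generators are
    -- available, so Burnside's theorem applies to the complement of the k-th factor.
    have h1 := rTensor_mem_of_single_smul_mem k hM K (fun a ha z hz =>
      tprod_smul_mem_of_single K (fun j z hz => by
        by_cases hj : j = k
        · subst hj; rwa [ha, map_one, one_smul]
        · refine single_smul_mem_of_gen K (fun a z hz => ?_) (a j) hz
          cases a with
          | g b => exact single_gen_g_smul_mem K hg b hz
          | x i => exact hx ⟨j, i⟩ z hz
          | s i hi => exact hs j i hi (fun h => absurd h hj) z hz) hz) T _ hz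
    rwa [LinearEquiv.apply_symm_apply] at h1
  refine ⟨untens K', fun h0 => hK ?_, fun x hx w => hx w, fun b z hz w => ?_, fun i z hz w => ?_,
    fun i hi hi' z hz w => ?_⟩
  · rw [h0] at h
    have h1 : tens (Rest F M k) (⊥ : Submodule F (M k)) = ⊥ :=
      le_bot_iff.1 (tens_le_iff.2 fun w x hx => by
        rw [(Submodule.mem_bot F).1 hx, TensorProduct.tmul_zero]; exact zero_mem _)
    refine (Submodule.eq_bot_iff _).2 fun z hz => ?_
    have h2 : splitEquiv F M k z ∈ K' := by
      rw [hK', LinearEquiv.symm_apply_apply]; exact hz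
    rw [← h, h1, Submodule.mem_bot] at h2
    exact (splitEquiv F M k).map_eq_zero_iff.1 h2
  · rw [hK', splitEquiv_symm_smul (A := fun k => WHecke F G (c k))]
    exact single_gen_g_smul_mem K hg b (hz w)
  · rw [hK', splitEquiv_symm_smul (A := fun k => WHecke F G (c k))]
    exact hx ⟨k, i⟩ _ (hz w)
  · rw [hK', splitEquiv_symm_smul (A := fun k => WHecke F G (c k))]
    exact hs k i hi (fun _ => hi') _ (hz w)

end DescentPiOuter

/-! ### Subspaces of E that are stable under the smaller algebra meet a branching map -/

section Socle

set_option linter.unusedSectionVars false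

universe v₁ v₂

variable {F : Type v₁} [Field F] [IsAlgClosed F] {G : Type*} [Group G] [Fintype G] {r : ℕ}
  {V : Fin r → Type*} [∀ k, AddCommGroup (V k)] [∀ k, Module F (V k)]
  [∀ k, FiniteDimensional F (V k)] {ρ : ∀ k, Representation F G (V k)} [∀ k, (ρ k).IsIrreducible]
  (L : Family.{_, _, _, v₂} ρ) (hL : ∀ k, IsSimpleModule
    (DHecke F (twist (flipScalar (ρ k))) (L k).rank) (L k).carrier)

include hL

/-- Reduce K to a subspace of the k-th factor, and there find z whose images under the removal map
all lie in that subspace. The other entries of the pure tensor e may be any nonzero vectors. -/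
theorem Family.exists_branch_mem {k : Fin r} (hk : 0 < (L k).rank)
    (K : Submodule F (PiOuter F fun j => Factor (ρ j) (L j).rank (L j).carrier)) (hK : K ≠ ⊥)
    (hg : ∀ b, ∀ z ∈ K, gP F (c := fun j => (L j).rank) (G := G) b • z ∈ K)
    (hx : ∀ p, ∀ z ∈ K, xP F G (c := fun j => (L j).rank) p • z ∈ K)
    (hs : ∀ j i hi, (j = k → i + 1 + 1 < (L j).rank) →
      ∀ z ∈ K, sP F G (c := fun j => (L j).rank) j i hi • z ∈ K) :
    ∃ a e, e ≠ 0 ∧ ∀ w, L.branch a hk w e ∈ K := by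
  have hfin : ∀ j, FiniteDimensional F (Factor (ρ j) (L j).rank (L j).carrier) := fun j => by
    have := hL j
    have := DHecke.finite_of_isSimpleModule (F := F) (u := twist (flipScalar (ρ j)))
      (n := (L j).rank) (L j).carrier
    exact finite_factor (ρ j)
  have hsimple : ∀ j, IsSimpleModule (WHecke F G (L j).rank)
      (Factor (ρ j) (L j).rank (L j).carrier) := fun j => by
    have := hL j
    exact isSimpleModule_factor (ρ j)
  obtain ⟨Y, hY, hYK, hg', hx', hs'⟩ := exists_untens_piOuter (G := G) (c := fun j => (L j).rank)
    (k := k) (fun j _ => hsimple j) K hK hg hx hs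
  have := hL k
  obtain ⟨a, ha⟩ := exists_removeMap_mem (ρ k) hk Y hY hg' hx' hs'
  obtain ⟨z, hz, hzY⟩ := ha (L.remove_self k a)
  have hm : ∀ j, ∃ m : Factor (ρ j) (L.remove k a j).rank (L.remove k a j).carrier, m ≠ 0 ∧
      ∀ h : j = k, m = h ▸ z := by
    intro j
    by_cases h : j = k
    · subst h; exact ⟨z, hz, fun _ => rfl⟩
    · have h1 : IsSimpleModule (DHecke F (twist (flipScalar (ρ j))) (L.remove k a j).rank)
          (L.remove k a j).carrier := by
        rw [L.remove_of_ne a h]; exact hL j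
      have h2 := isSimpleModule_factor (G := G) (ρ j) (m := (L.remove k a j).rank)
        (L := (L.remove k a j).carrier)
      have := IsSimpleModule.nontrivial (WHecke F G (L.remove k a j).rank)
        (Factor (ρ j) (L.remove k a j).rank (L.remove k a j).carrier)
      obtain ⟨m, hm⟩ := exists_ne (0 : Factor (ρ j) (L.remove k a j).rank (L.remove k a j).carrier)
      exact ⟨m, hm, fun h' => absurd h' h⟩
  choose m hm hmk using hm
  refine ⟨a, otprod F m, tprod_ne_zero m hm, fun w => ?_⟩
  have h1 := hYK _ (hzY w) (PiTensorProduct.tprod F fun j : ({k}ᶜ : Set (Fin r)) =>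
    L.restMap a j (m j))
  rw [Family.branch, outerFamily_apply, outerMap_otprod]
  refine (congrArg (· ∈ K) ?_).mp h1
  rw [LinearEquiv.symm_apply_eq, splitEquiv_tprod]
  congr 1
  · congr 1
    funext j
    have hj : (j : Fin r) ≠ k := j.2
    rw [Function.update_of_ne hj]
  · rw [Function.update_self]
    exact congrArg _ (hmk k rfl).symm

end Socle

/-! ### The socle of the restriction -/

section Branching

set_option linter.unusedSectionVars false

universe v₁ v₂

variable {F : Type v₁} [Field F] [IsAlgClosed F] {G : Type*} [Group G] [Fintype G] {r : ℕ}
  {V : Fin r → Type*} [∀ k, AddCommGroup (V k)] [∀ k, Module F (V k)]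
  [∀ k, FiniteDimensional F (V k)] {ρ : ∀ k, Representation F G (V k)} [∀ k, (ρ k).IsIrreducible]
  {ε : Fin r → G → F} (hε : IsSeparating ρ ε)
  {n : ℕ} (L : Family.{_, _, _, v₂} ρ) (hn : ∑ k, (L k).rank = n + 1)
  (hL : ∀ k, IsSimpleModule (DHecke F (twist (flipScalar (ρ k))) (L k).rank) (L k).carrier)

/-- The smaller composition is determined by c and k. This identifies the special shuffles formed
for different a, since the ranks after removal do not depend on a. -/
theorem lastShuffle_congr {c c₁ c₂ : Fin r → ℕ} {k : Fin r} {n : ℕ} (hk₁ : c₁ k + 1 = c k)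
    (hc₁ : ∀ j, j ≠ k → c₁ j = c j) (hc : ∑ j, c j = n + 1) (hn₁ : ∑ j, c₁ j = n)
    (hk₂ : c₂ k + 1 = c k) (hc₂ : ∀ j, j ≠ k → c₂ j = c j) (hn₂ : ∑ j, c₂ j = n) :
    lastShuffle hk₁ hc₁ hc hn₁ = lastShuffle hk₂ hc₂ hc hn₂ := by
  obtain rfl : c₁ = c₂ := funext fun j => by
    by_cases h : j = k
    · subst h
      omega
    · rw [hc₁ j h, hc₂ j h]
  rfl

/-- The summands of the socle. -/
abbrev Family.Summand (p : F × {k : Fin r // 0 < (L k).rank}) : Type _ :=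
  Outer F ((L.remove p.2.1 p.1).D (Family.sum_rank_remove hn p.2.2 p.1))
    (Factor (ρ p.2.1) 1 (DHecke.LOne F (twist (flipScalar (ρ p.2.1))) p.1))

include hε in
-- For equal k the last x acts by γ_k a with γ_k ≠ 0 and separates the values a. For different k the
-- separating element of the group algebra, placed at the last position, acts as 1 on one summand
-- and as 0 on the other.
theorem Family.exists_separating (p q : F × {k : Fin r // 0 < (L k).rank}) (hpq : p ≠ q) :
    ∃ (b : WHecke F G n ⊗[F] WHecke F G 1) (χ : F × {k : Fin r // 0 < (L k).rank} → F),
      (∀ s (z : L.Summand hn s), b • z = χ s • z) ∧ χ p ≠ χ q := by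
  by_cases h : p.2 = q.2
  · refine ⟨1 ⊗ₜ WHecke.gen F (.x 0), fun s => scale (flipScalar (ρ s.2.1)) * s.1,
      fun s z => one_tmul_smul _ _ (fun w => gen_x_smul_factor_one (ρ s.2.1) 0 w) z, ?_⟩
    intro h1
    beta_reduce at h1
    rw [h] at h1
    exact hpq (Prod.ext (mul_left_cancel₀ (scale_ne_zero _) h1) h)
  · refine ⟨1 ⊗ₜ ∑ g, ε p.2.1 g • WHecke.gen F (.g (Pi.mulSingle 0 g)),
      fun s => if s.2.1 = p.2.1 then 1 else 0, fun s z => one_tmul_smul _ _ (fun w => ?_) z, ?_⟩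
    · rw [Finset.sum_smul]
      simp only [smul_assoc]
      rw [hε.sum_smul]
      split_ifs
      · rw [one_smul]
      · rw [zero_smul]
    · beta_reduce
      rw [if_pos rfl, if_neg fun h' => h (Subtype.ext h'.symm)]
      exact one_ne_zero

include hε hL in
theorem Family.isSemisimpleModule_summand (p : F × {k : Fin r // 0 < (L k).rank}) :
    IsSemisimpleModule (WHecke F G n ⊗[F] WHecke F G 1) (L.Summand hn p) := by
  have := isSimpleModule_factor_lOne (ρ p.2.1) p.1
  have := finite_factor_lOne (ρ p.2.1) p.1
  have := L.isSemisimpleModule_remove p.1 p.2.2 hL hε (Family.sum_rank_remove hn p.2.2 p.1)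
  obtain ⟨e, -⟩ := exists_outer_orderIso (F := F) (WHecke F G n) (WHecke F G 1)
    ((L.remove p.2.1 p.1).D (Family.sum_rank_remove hn p.2.2 p.1))
    (Factor (ρ p.2.1) 1 (DHecke.LOne F (twist (flipScalar (ρ p.2.1))) p.1))
  exact isSemisimpleModule_of_orderIso e

include hε hL in
/-- The socle of the restriction of `D(L)`. -/
theorem Family.exists_socle_equiv :
    Nonempty (socle (WHecke F G n ⊗[F] WHecke F G 1) (Res (lastHom F G n) (L.D hn))
      ≃ₗ[WHecke F G n ⊗[F] WHecke F G 1] ⨁ p, L.Summand hn p) := by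
  classical
  have hb := hε.isBlockIdempotent L
  have hk := fun p : F × {k : Fin r // 0 < (L k).rank} => L.rank_remove_add_one p.1 p.2.2
  have hc := fun p : F × {k : Fin r // 0 < (L k).rank} => fun j h =>
    L.rank_remove_of_ne (k := p.2.1) (j := j) p.1 h
  have hs := fun p : F × {k : Fin r // 0 < (L k).rank} => Family.sum_rank_remove hn p.2.2 p.1
  choose Θ hΘ using fun p : F × {k : Fin r // 0 < (L k).rank} =>
    exists_branchMap (hk p) (hc p) hn (hs p) hb (L.isBranchFamily p.1 p.2.2 hL)
  refine WreathHecke.exists_socle_equiv (F := F) Θ (fun p => ?_) (L.isSemisimpleModule_summand hε hn hL)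
    (L.exists_separating hε hn) fun S hS => ?_
  · have := isSimpleModule_factor_lOne (ρ p.2.1) p.1
    have := finite_factor_lOne (ρ p.2.1) p.1
    exact branchMap_injective (hk p) (hc p) hn (hs p) hb (L.isBranchFamily p.1 p.2.2 hL)
      (hε.isBlockIdempotent _) (L.eq_zero_of_branch p.1 p.2.2) (Θ p) (hΘ p)
  · have hS' : S ≠ ⊥ := (IsSimpleModule.isAtom (m := S)).1
    obtain ⟨k, hk0, hcomp⟩ := exists_component_ne_bot hn hb S hS'
    -- The eigenvalue is not known yet. The composition after removal does not depend on it, so 0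
    -- stands in.
    have hK := hcomp _ (L.rank_remove_add_one 0 hk0) (fun j h => L.rank_remove_of_ne 0 h)
      (Family.sum_rank_remove hn hk0 0)
    obtain ⟨a, e, he, heK⟩ := L.exists_branch_mem hL hk0 _ hK
      (fun b z hz => gP_smul_mem_component _ _ hn _ hb S b hz)
      (fun p z hz => xP_smul_mem_component _ _ hn _ hb S p hz)
      (fun j i hi hi' z hz => sP_smul_mem_component _ _ hn _ hb S j i hi (by
        by_cases h : j = k
        · have := L.rank_remove_add_one 0 hk0
          have := hi' h
          subst h
          omega
        · exact hi.trans_eq (L.rank_remove_of_ne 0 h).symm) hz)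
    have := isSimpleModule_factor_lOne (ρ k) a
    have := IsSimpleModule.nontrivial (WHecke F G 1)
      (Factor (ρ k) 1 (DHecke.LOne F (twist (flipScalar (ρ k))) a))
    obtain ⟨w, hw⟩ := exists_ne (0 : Factor (ρ k) 1 (DHecke.LOne F (twist (flipScalar (ρ k))) a))
    have hz := hΘ (a, ⟨k, hk0⟩) e w
    rw [branchBilin_apply] at hz
    refine ⟨(a, ⟨k, hk0⟩), outerMk F _ _ (indMk _ 1 e) w, fun h0 => he ?_, ?_⟩
    · rw [h0, map_zero] at hz
      exact L.branch_injective a hk0 hw ((Pi.single_eq_zero_iff.1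
        ((indEquiv hb hn).symm.map_eq_zero_iff.1 hz.symm)).trans (map_zero _).symm)
    · rw [hz, lastShuffle_congr (hk _) (hc _) hn (hs _) (L.rank_remove_add_one 0 hk0)
        (fun j h => L.rank_remove_of_ne 0 h) (Family.sum_rank_remove hn hk0 0)]
      exact heK w

end Branching

end

end WreathHecke

theorem mainTheorem3 {F : Type*} [Field F] [IsAlgClosed F] {G : Type*} [Group G] [Fintype G]
    {r : ℕ} {V : Fin r → Type*} [∀ k, AddCommGroup (V k)] [∀ k, Module F (V k)]
    [∀ k, FiniteDimensional F (V k)] (ρ : ∀ k, Representation F G (V k))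
    [∀ k, (ρ k).IsIrreducible] (hρ : ∀ j k, j ≠ k → IsEmpty ((ρ j).Equiv (ρ k)))
    (n : ℕ) (L : WreathHecke.Family ρ) (hn : ∑ k, (L k).rank = n + 1)
    (hL : ∀ k, IsSimpleModule
      (WreathHecke.DHecke F (WreathHecke.twist (WreathHecke.flipScalar (ρ k))) (L k).rank)
      (L k).carrier) :
    (∀ (a : F) (k : Fin r) (hk : 0 < (L k).rank),
      IsSemisimpleModule (WreathHecke.WHecke F G n)
        ((L.remove k a).D (WreathHecke.Family.sum_rank_remove hn hk a))) ∧
    Nonempty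
      (WreathHecke.socle (WreathHecke.WHecke F G n ⊗[F] WreathHecke.WHecke F G 1)
          (WreathHecke.Res (WreathHecke.lastHom F G n) (L.D hn))
        ≃ₗ[WreathHecke.WHecke F G n ⊗[F] WreathHecke.WHecke F G 1]
        ⨁ p : F × {k : Fin r // 0 < (L k).rank},
          WreathHecke.Outer F
            ((L.remove p.2.1 p.1).D (WreathHecke.Family.sum_rank_remove hn p.2.2 p.1))
            (WreathHecke.Factor (ρ p.2.1) 1
              (WreathHecke.DHecke.LOne F
                (WreathHecke.twist (WreathHecke.flipScalar (ρ p.2.1))) p.1))) := by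
  obtain ⟨ε, hε⟩ := WreathHecke.exists_isSeparating hρ
  exact ⟨fun a k hk => L.isSemisimpleModule_remove a hk hL hε _, L.exists_socle_equiv hε hn hL⟩
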